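/- **Setting.** Pauli operators on $N$ qubits are tensor products of $I,X,Y,Z$, taken modulo phases. The weight $w(p)$ is the number of non-identity factors. For a set $A$ of operators, $\mathcal C(A)$ is the set of operators that commute with all of $A$, and $\mathcal G(A)$ is the set of all products of members of $A$; for a set or sequence $Q$ of pairs, $U(Q)$ is the set of all members of its pairs. A pair $(a,b)$ is *conjugal* in relation to $A\supseteq\{a,b\}$ if $a$ anti-commutes with $b$ and commutes with all other members of $A$, and likewise $b$ anti-commutes with $a$ only. For a set $S$ of operators, an *undetectable error* acting on $l$ is some $e\in\mathcal C(S)$ that anti-commutes with $l$; $\omega_S(l)$ is the minimal weight of such an error, $m_S(a,b)=\min(\omega_S(a),\omega_S(b))$, and $\vec M_S(\vec P)=(m_S(\vec P_i))_i$. A *choice of qubits stabilized by $S$* is a finite sequence $\vec P$ of pairs, no two of which share an operator, such that $U(\vec P)\subseteq\mathcal C(S)$, each pair is conjugal in relation to $S\cup U(\vec P)$, $\omega_S(a)=m_S(a,b)$ for each pair $(a,b)$ of $\vec P$, and $\vec M_S(\vec P)$ is non-decreasing. It is *optimal* if every choice $\vec P'$ stabilized by $S$ with $\mathcal G(U(\vec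 P'))=\mathcal G(U(\vec P))$ has $|\vec P'|=|\vec P|$ and $\vec M_S(\vec P')_i\le\vec M_S(\vec P)_i$ for all $i$. **The optimization sequence.** Let $S$ be a set of commuting operators and $L$ a set of pairs with $U(L)\subseteq\mathcal C(S)$, each conjugal in relation to $U(L)\cup S$, with no operator in more than one pair. The sequence $\mathcal O(S,L)$ of triples $(Q,\vec P,\vec s)$ ($Q$ a set of pairs, $\vec P$ a sequence of pairs, $\vec s$ a sequence of bits with $|\vec s|=|\vec P|$) starts with $(L,\emptyset,\emptyset)$ and ends at a triple with $Q=\emptyset$. If $Q\neq\emptyset$, let $R$ be the set of second members of the pairs $\vec P_i$ with $\vec s_i=1$, and let $h$ be an undetectable error of minimal weight among those that act on some operator in $U(Q)\cup R$. Put $g(a,b)=b$ if $h$ anti-commutes with $a$ and $g(a,b)=I$ otherwise; for a given operator $o$ put $f(x)=x\,o$ if $h$ anti-commutes with $x$ and $f(x)=x$ otherwise; and write $\beta(Q)=\prod_{(a,b)\in Q}g(a,b)\,g(b,a)$. 1. If $h$ acts on some operator in $R$, let $k$ be the least index such that $\vec s_k=1$ and $h$ acts on the second member $o$ of $\vec P_k=(a,o)$.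 Each $(c,e)\in Q$ is replaced by $(f(c),f(e))$; $\vec P_k$ by $\bigl(a\cdot\prod_{i>k,\ \vec s_i=1}g(b_i,a_i)\cdot\beta(Q),\,o\bigr)$, where $\vec P_i=(a_i,b_i)$; $\vec P_i$ by $(a_i,f(b_i))$ for $i>k$ with $\vec s_i=1$; and $\vec s_k$ by $0$. 2. Otherwise choose $q\in Q$ on one of whose members $h$ acts, call that member $o$ and the other one $b$. Put $Q_0=Q\setminus\{q\}$, replace $Q$ by $\{(f(c),f(e)):(c,e)\in Q_0\}$, and append to $\vec P$ the pair $\bigl(o,\,f(b\cdot\beta(Q_0))\bigr)$ and to $\vec s$ the bit $1$. The choices of $h$, of $q$ and of the order of its members are arbitrary. **Theorem.** For all such $N,S,L$, whatever choices are made, the sequence $\mathcal O(S,L)$ exists and is finite; if $(Q,\vec P,\vec s)$ is its last element, then $Q=\emptyset$, $\vec P$ is an optimal choice of qubits stabilized by $S$, and $\mathcal G(U(\vec P))=\mathcal G(U(L))$. Moreover, there is a constant $K$ such that for all such $N,S,L$ and every set $C$ of Pauli operators with $\mathcal G(C)=\mathcal C(S)$, such a sequence $\mathcal O(S,L)$,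 for suitable choices, is computed from listings of $C$ and $L$ by the following algorithm in time at most $$K\left(|C|^2+|L|^2\,d\,3^d\binom Nd\right),\qquad d=\vec M_S(\vec P)_{|\vec P|},$$ where $\vec P$ belongs to the last element of the sequence, so that $d$ is the distance of the best qubit (and the second summand is $0$ if $L=\emptyset$). Here time is the number of products of Pauli operators, and tests of whether two of them anti-commute are counted too. The algorithm first turns $C$ by Gaussian elimination into at most $N$ pseudo-generators (sets of one or two operators with pivots on one qubit, the pivots of different sets lying on different qubits). In every step it finds $h$ by enumerating, for $r=1,2,\dots$, the products of non-identity elements generated by $r$ pseudo-generators, until the best error found has weight at most the next value of $r$; then it carries out case 1 or 2. -/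

import Mathlib

set_option linter.unusedSimpArgs false

namespace PauliCode

/-! ### Pauli operators modulo phases -/

/-- The group of `N`-qubit Pauli operators modulo phases.  The tensor factor on a qubit is recorded
by two bits `(x, z)`: `(0,0)` is `I`, `(1,0)` is `X`, `(0,1)` is `Z`, `(1,1)` is `Y`.  The product
of operators modulo phases is the product of this group. -/
abbrev PauliOp (N : ℕ) : Type := Fin N → Multiplicative (ZMod 2 × ZMod 2)

/-- A pair of Pauli operators. -/
abbrev OpPair (N : ℕ) : Type := PauliOp N × PauliOp N

/-- The single-qubit Pauli matrix with the given bits. -/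
noncomputable def pauliMatrix (u : Multiplicative (ZMod 2 × ZMod 2)) :
    Matrix (Fin 2) (Fin 2) ℂ :=
  if u.toAdd = (0, 0) then 1
  else if u.toAdd = (1, 0) then !![0, 1; 1, 0]
  else if u.toAdd = (0, 1) then !![1, 0; 0, -1]
  else !![0, -Complex.I; Complex.I, 0]

/-- The tensor product of Pauli matrices that represents a Pauli operator on the space of `N`
qubits, with the computational basis indexed by `Fin N → Fin 2`. -/
noncomputable def opMatrix {N : ℕ} (p : PauliOp N) :
    Matrix (Fin N → Fin 2) (Fin N → Fin 2) ℂ :=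
  Matrix.of fun i j => ∏ k, pauliMatrix (p k) (i k) (j k)

/-- The symplectic form: the parity of the number of qubits on which the factors of `p` and `q`
anti-commute. -/
def sympl {N : ℕ} (p q : PauliOp N) : ZMod 2 :=
  ∑ k, ((p k).toAdd.1 * (q k).toAdd.2 + (p k).toAdd.2 * (q k).toAdd.1)

/-- `p` and `q` anti-commute.  Two Pauli operators either commute or anti-commute, so `¬ Anti p q`
says that they commute; `anti_iff_opMatrix` and `not_anti_iff_opMatrix` compare this with the
matrices. -/
def Anti {N : ℕ} (p q : PauliOp N) : Prop := sympl p q = 1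

instance {N : ℕ} (p q : PauliOp N) : Decidable (Anti p q) :=
  inferInstanceAs (Decidable (sympl p q = 1))

/-- The number of qubits on which `p` acts by a factor other than the identity. -/
def weight {N : ℕ} (p : PauliOp N) : ℕ := (Finset.univ.filter fun k => p k ≠ 1).card

theorem opMatrix_mul_apply {N : ℕ} (p q : PauliOp N) (i j : Fin N → Fin 2) :
    (opMatrix p * opMatrix q) i j =
      ∏ k, (pauliMatrix (p k) * pauliMatrix (q k)) (i k) (j k) := by
  simp only [Matrix.mul_apply, opMatrix, Matrix.of_apply, ← Finset.prod_mul_distrib]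
  rw [Finset.prod_univ_sum]
  simp

theorem bits_cases (u : Multiplicative (ZMod 2 × ZMod 2)) :
    u = Multiplicative.ofAdd (0, 0) ∨ u = Multiplicative.ofAdd (1, 0) ∨
      u = Multiplicative.ofAdd (0, 1) ∨ u = Multiplicative.ofAdd (1, 1) := by
  revert u; decide

theorem pauliMatrix_mul (u v : Multiplicative (ZMod 2 × ZMod 2)) :
    ∃ c ∈ ({1, -1, Complex.I, -Complex.I} : Set ℂ),
      pauliMatrix u * pauliMatrix v = c • pauliMatrix (u * v) := by
  have h2 : (1 : ZMod 2) + 1 = 0 := by decide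
  rcases bits_cases u with rfl | rfl | rfl | rfl <;>
    rcases bits_cases v with rfl | rfl | rfl | rfl <;>
    simp only [Set.mem_insert_iff, Set.mem_singleton_iff, exists_eq_or_imp, exists_eq_left,
      ← ofAdd_add, Prod.mk_add_mk, add_zero, zero_add, h2] <;>
    simp [pauliMatrix, ← Matrix.ext_iff, Fin.forall_fin_two, Matrix.mul_apply]

theorem pauliMatrix_swap (u v : Multiplicative (ZMod 2 × ZMod 2)) :
    pauliMatrix u * pauliMatrix v =
      ((-1 : ℂ) ^ (u.toAdd.1 * v.toAdd.2 + u.toAdd.2 * v.toAdd.1).val) •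
        (pauliMatrix v * pauliMatrix u) := by
  have h2 : (1 : ZMod 2) + 1 = 0 := by decide
  have h1 : (1 : ZMod 2).val = 1 := by decide
  rcases bits_cases u with rfl | rfl | rfl | rfl <;>
    rcases bits_cases v with rfl | rfl | rfl | rfl <;>
    simp [pauliMatrix, ← Matrix.ext_iff, Fin.forall_fin_two, Matrix.mul_apply, h1, h2]

/-- Up to a phase, the matrix of a product is the product of the matrices. -/
theorem opMatrix_mul {N : ℕ} (p q : PauliOp N) :
    ∃ c : ℂ, c ^ 4 = 1 ∧ opMatrix p * opMatrix q = c • opMatrix (p * q) := by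
  choose c hc h using fun k => pauliMatrix_mul (p k) (q k)
  refine ⟨∏ k, c k, ?_, ?_⟩
  · rw [← Finset.prod_pow]
    refine Finset.prod_eq_one fun k _ => ?_
    have hk := hc k
    simp only [Set.mem_insert_iff, Set.mem_singleton_iff] at hk
    rcases hk with hk | hk | hk | hk <;> rw [hk]
    · simp
    · norm_num
    · exact Complex.I_pow_four
    · rw [Even.neg_pow (by decide), Complex.I_pow_four]
  · ext i j
    rw [opMatrix_mul_apply]
    simp [h, opMatrix, Finset.prod_mul_distrib]

theorem opMatrix_swap {N : ℕ} (p q : PauliOp N) :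
    opMatrix p * opMatrix q = ((-1 : ℂ) ^ (sympl p q).val) • (opMatrix q * opMatrix p) := by
  have key : ∀ a b : ZMod 2, (-1 : ℂ) ^ (a + b).val = (-1) ^ a.val * (-1) ^ b.val := by
    intro a b
    have h01 : ∀ x : ZMod 2, x = 0 ∨ x = 1 := by decide
    have h2 : (1 : ZMod 2) + 1 = 0 := by decide
    have h1 : (1 : ZMod 2).val = 1 := by decide
    rcases h01 a with rfl | rfl <;> rcases h01 b with rfl | rfl <;> simp [h1, h2]
  have hs : ∀ (s : Finset (Fin N)) (f : Fin N → ZMod 2),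
      (-1 : ℂ) ^ (∑ k ∈ s, f k).val = ∏ k ∈ s, (-1 : ℂ) ^ (f k).val := by
    intro s f
    induction s using Finset.cons_induction with
    | empty => simp
    | cons a s ha ih => rw [Finset.sum_cons, Finset.prod_cons, key, ih]
  ext i j
  rw [Matrix.smul_apply, opMatrix_mul_apply, opMatrix_mul_apply, sympl, hs, smul_eq_mul,
    ← Finset.prod_mul_distrib]
  refine Finset.prod_congr rfl fun k _ => ?_
  rw [pauliMatrix_swap]
  rfl

theorem opMatrix_mul_ne_neg {N : ℕ} (p q : PauliOp N) :
    opMatrix p * opMatrix q ≠ -(opMatrix p * opMatrix q) := by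
  have hsq : ∀ r : PauliOp N, opMatrix r * opMatrix r = 1 := by
    intro r
    have h1 : ∀ u : Multiplicative (ZMod 2 × ZMod 2), pauliMatrix u * pauliMatrix u = 1 := by
      intro u
      rcases bits_cases u with rfl | rfl | rfl | rfl <;>
        simp [pauliMatrix, ← Matrix.ext_iff, Fin.forall_fin_two, Matrix.mul_apply]
    ext i j
    rw [opMatrix_mul_apply]
    simp only [h1, Matrix.one_apply]
    by_cases hij : i = j
    · simp [hij]
    · obtain ⟨k, hk⟩ := Function.ne_iff.mp hij
      rw [if_neg hij]
      exact Finset.prod_eq_zero (Finset.mem_univ k) (by simp [hk])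
  intro h'
  have h : opMatrix p * opMatrix q = 0 := by
    have h3 : (2 : ℂ) • (opMatrix p * opMatrix q) = 0 := by
      rw [two_smul]
      exact eq_neg_iff_add_eq_zero.mp h'
    exact (smul_eq_zero.mp h3).resolve_left two_ne_zero
  have h2 : opMatrix p * (opMatrix p * opMatrix q) * opMatrix q = 1 := by
    rw [← mul_assoc, hsq, one_mul, hsq]
  rw [h] at h2
  simp at h2

theorem anti_iff_opMatrix {N : ℕ} (p q : PauliOp N) :
    Anti p q ↔ opMatrix p * opMatrix q = -(opMatrix q * opMatrix p) := by
  have hs := opMatrix_swap p q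
  have hz : sympl p q = 0 ∨ sympl p q = 1 := by
    generalize sympl p q = a
    revert a; decide
  unfold Anti
  rcases hz with hz | hz
  · rw [hz] at hs ⊢
    simp only [ZMod.val_zero, pow_zero, one_smul] at hs
    simp only [zero_ne_one, false_iff]
    intro h
    rw [hs] at h
    exact opMatrix_mul_ne_neg q p h
  · rw [hz] at hs ⊢
    simpa [show (1 : ZMod 2).val = 1 from rfl] using hs

theorem not_anti_iff_opMatrix {N : ℕ} (p q : PauliOp N) :
    ¬ Anti p q ↔ opMatrix p * opMatrix q = opMatrix q * opMatrix p := by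
  have hs := opMatrix_swap p q
  have hz : sympl p q = 0 ∨ sympl p q = 1 := by
    generalize sympl p q = a
    revert a; decide
  rcases hz with hz | hz
  · rw [hz] at hs
    simpa [Anti, hz] using hs
  · have ha : Anti p q := hz
    have hm := (anti_iff_opMatrix p q).mp ha
    simp only [ha, not_true_eq_false, false_iff]
    intro h
    rw [h] at hm
    exact opMatrix_mul_ne_neg q p hm

/-! ### Choices of qubits -/

/-- The operators that commute with every member of `S`. -/
def centralizer {N : ℕ} (S : Set (PauliOp N)) : Set (PauliOp N) :=
  {e | ∀ s ∈ S, ¬ Anti e s}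

/-- The set of all products of members of `X`.  Operators modulo phases square to the identity, so
this is the subgroup generated by `X`. -/
def generated {N : ℕ} (X : Set (PauliOp N)) : Set (PauliOp N) :=
  (Subgroup.closure X : Subgroup (PauliOp N))

/-- The set of all members of a set of pairs. -/
def unpack {N : ℕ} (Q : Set (OpPair N)) : Set (PauliOp N) :=
  {o | ∃ q ∈ Q, o = q.1 ∨ o = q.2}

/-- `q` is a conjugal pair in relation to `X`: within `X`, each member of the pair anti-commutes
with its partner and with nothing else. -/
def IsConjugalPair {N : ℕ} (X : Set (PauliOp N)) (q : OpPair N) : Prop :=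
  ∀ x ∈ X, (Anti q.1 x ↔ x = q.2) ∧ (Anti q.2 x ↔ x = q.1)

/-- The two pairs have no operator in common. -/
def SharesNoOp {N : ℕ} (q r : OpPair N) : Prop :=
  q.1 ≠ r.1 ∧ q.1 ≠ r.2 ∧ q.2 ≠ r.1 ∧ q.2 ≠ r.2

/-- `e` is an undetectable error with respect to `S` acting on `l`. -/
def IsUndetectableError {N : ℕ} (S : Set (PauliOp N)) (l e : PauliOp N) : Prop :=
  e ∈ centralizer S ∧ Anti e l

/-- The minimal weight of an undetectable error with respect to `S` acting on `l`. -/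
noncomputable def omega {N : ℕ} (S : Set (PauliOp N)) (l : PauliOp N) : ℕ :=
  sInf (weight '' {e | IsUndetectableError S l e})

/-- The distance of the qubit given by the pair `q`. -/
noncomputable def pairDist {N : ℕ} (S : Set (PauliOp N)) (q : OpPair N) : ℕ :=
  min (omega S q.1) (omega S q.2)

/-- The sequence of the distances of the qubits in `P`. -/
noncomputable def distances {N : ℕ} (S : Set (PauliOp N)) (P : List (OpPair N)) : List ℕ :=
  P.map (pairDist S)

/-- `P` is a choice of qubits stabilized by `S`. -/
structure IsChoice {N : ℕ} (S : Set (PauliOp N)) (P : List (OpPair N)) : Prop where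
  noShared : P.Pairwise SharesNoOp
  subset_centralizer : unpack {q | q ∈ P} ⊆ centralizer S
  conjugal : ∀ q ∈ P, IsConjugalPair (S ∪ unpack {q | q ∈ P}) q
  first_minimal : ∀ q ∈ P, omega S q.1 = pairDist S q
  sorted : (distances S P).Pairwise (· ≤ ·)

/-- `P` is an optimal choice of qubits stabilized by `S`: every choice `P'` that generates the same
group has the same length and is entrywise no better. -/
def IsOptimalChoice {N : ℕ} (S : Set (PauliOp N)) (P : List (OpPair N)) : Prop :=
  IsChoice S P ∧ ∀ P', IsChoice S P' →
    generated (unpack {q | q ∈ P'}) = generated (unpack {q | q ∈ P}) →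
      List.Forall₂ (· ≤ ·) (distances S P') (distances S P)

/-! ### The optimization sequence -/

/-- A triple `(Q, P, s)`.  The sequence `P` of pairs and the sequence `s` of bits have the same
length and are stored as one sequence `Ps`. -/
structure OptState (N : ℕ) where
  Q : Finset (OpPair N)
  Ps : List (OpPair N × Bool)

/-- The sequence `P` of a triple `(Q, P, s)`. -/
def OptState.P {N : ℕ} (st : OptState N) : List (OpPair N) := st.Ps.map Prod.fst

/-- The set `R` of the second members of those pairs in `P` whose bit is `1`. -/
def OptState.R {N : ℕ} (st : OptState N) : Set (PauliOp N) :=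
  {o | ∃ y ∈ st.Ps, y.2 = true ∧ o = y.1.2}

/-- The set `X`, the union of `R` and the set of all members of pairs in `Q`. -/
def OptState.X {N : ℕ} (st : OptState N) : Set (PauliOp N) :=
  unpack (st.Q : Set (OpPair N)) ∪ st.R

/-- `h` has minimal weight among the undetectable errors with respect to `S` that act on some
operator in `X`. -/
def IsMinimalError {N : ℕ} (S X : Set (PauliOp N)) (h : PauliOp N) : Prop :=
  (∃ x ∈ X, IsUndetectableError S x h) ∧
    ∀ e, (∃ x ∈ X, IsUndetectableError S x e) → weight h ≤ weight e

/-- Multiply `x` by `o` if it anti-commutes with `h`. -/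
def fixOp {N : ℕ} (h o x : PauliOp N) : PauliOp N := if Anti h x then x * o else x

/-- The operator `b` if `a` anti-commutes with `h`, and the identity otherwise. -/
def partnerFactor {N : ℕ} (h a b : PauliOp N) : PauliOp N := if Anti h a then b else 1

/-- Apply `fixOp` to both members of a pair. -/
def fixPair {N : ℕ} (h o : PauliOp N) (q : OpPair N) : OpPair N :=
  (fixOp h o q.1, fixOp h o q.2)

/-- The product over `(a, b) ∈ Q` of the partners of those members that anti-commute with `h`. -/
def pairsFactor {N : ℕ} (h : PauliOp N) (Q : Finset (OpPair N)) : PauliOp N :=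
  ∏ q ∈ Q, partnerFactor h q.1 q.2 * partnerFactor h q.2 q.1

/-- The product over the pairs with bit `1` of the first members of those pairs whose second member
anti-commutes with `h`. -/
def flaggedFactor {N : ℕ} (h : PauliOp N) (l : List (OpPair N × Bool)) : PauliOp N :=
  (l.map fun y => if y.2 = true then partnerFactor h y.1.2 y.1.1 else 1).prod

/-- Multiply the second member of a pair with bit `1` by `o` if it anti-commutes with `h`. -/
def fixFlagged {N : ℕ} (h o : PauliOp N) (y : OpPair N × Bool) : OpPair N × Bool :=
  if y.2 = true then ((y.1.1, fixOp h o y.1.2), y.2) else y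

/-- One step of the optimization, with all of its free choices (of a minimal-weight error `h` and,
in the second case, of a pair on which `h` acts and of an order of its members).

In `case1` the error `h` acts on some operator in `R`; the pair `(a, o)` is the first one in `P`
with bit `1` on whose second member `h` acts.  In `case2` it acts on no operator in `R`. -/
inductive Step {N : ℕ} (S : Set (PauliOp N)) : OptState N → OptState N → Prop
  | case1 (Q : Finset (OpPair N)) (pre post : List (OpPair N × Bool)) (a o h : PauliOp N)
      (hQ : Q.Nonempty)
      (hmin : IsMinimalError S (OptState.X ⟨Q, pre ++ ((a, o), true) :: post⟩) h)
      (hact : Anti h o)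
      (hfirst : ∀ y ∈ pre, y.2 = true → ¬ Anti h y.1.2) :
      Step S ⟨Q, pre ++ ((a, o), true) :: post⟩
        ⟨Q.image (fixPair h o),
          pre ++ ((a * flaggedFactor h post * pairsFactor h Q, o), false) ::
            post.map (fixFlagged h o)⟩
  | case2 (Q : Finset (OpPair N)) (Ps : List (OpPair N × Bool)) (q : OpPair N)
      (o b h : PauliOp N)
      (hmin : IsMinimalError S (OptState.X ⟨Q, Ps⟩) h)
      (hR : ∀ r ∈ OptState.R ⟨Q, Ps⟩, ¬ Anti h r)
      (hq : q ∈ Q)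
      (hqo : q = (o, b) ∨ q = (b, o))
      (hact : Anti h o) :
      Step S ⟨Q, Ps⟩
        ⟨(Q.erase q).image (fixPair h o),
          Ps ++ [((o, fixOp h o (b * pairsFactor h (Q.erase q))), true)]⟩

/-- `O` is an optimization sequence for `(S, L)`, with `O i = none` beyond its end.  It starts with
`(L, ∅, ∅)`; it ends at a triple with `Q = ∅`, and any other triple is followed by one that is
obtained from it by a step. -/
structure IsOptSequence {N : ℕ} (S : Set (PauliOp N)) (L : Finset (OpPair N))
    (O : ℕ → Option (OptState N)) : Prop where
  start : O 0 = some ⟨L, []⟩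
  ends : ∀ i st, O i = some st → st.Q = ∅ → O (i + 1) = none
  next : ∀ i st, O i = some st → st.Q ≠ ∅ → ∃ st', Step S st st' ∧ O (i + 1) = some st'
  after : ∀ i, O i = none → O (i + 1) = none

/-! ### The computation and its cost

The algorithm below has access to Pauli operators only through multiplication, the test whether two
operators anti-commute, the weight, and the test for the identity.  The time counts every product,
and also every test for anti-commutation. -/

/-- A result together with the time that was spent on computing it. -/
structure Timed (α : Type) where
  val : α
  time : ℕ

instance : Monad Timed where
  pure a := ⟨a, 0⟩
  bind x f := ⟨(f x.val).val, x.time + (f x.val).time⟩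

/-- The product of two operators, in time one. -/
def mulT {N : ℕ} (p q : PauliOp N) : Timed (PauliOp N) := ⟨p * q, 1⟩

/-- The test whether two operators anti-commute, in time one. -/
def antiT {N : ℕ} (p q : PauliOp N) : Timed Bool := ⟨decide (Anti p q), 1⟩

/-- The operator on qubit `n` that is `X` (for `false`) or `Z` (for `true`). -/
def singleOp {N : ℕ} (c : Fin N × Bool) : PauliOp N :=
  Function.update 1 c.1 (Multiplicative.ofAdd (if c.2 then (0, 1) else (1, 0)))

/-- Multiply `x` by `o` if it anti-commutes with `h`. -/
def fixOpT {N : ℕ} (h o x : PauliOp N) : Timed (PauliOp N) := do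
  if ← antiT h x then mulT x o else pure x

/-- Does `e` anti-commute with one of the listed operators? -/
def anyAntiT {N : ℕ} (e : PauliOp N) : List (PauliOp N) → Timed Bool
  | [] => pure false
  | x :: xs => do if ← antiT e x then pure true else anyAntiT e xs

/-- A generator with its pivot, a single-qubit operator. -/
abbrev Row (N : ℕ) : Type := PauliOp N × (Fin N × Bool)

/-- Multiply `o` by the rows whose pivots anti-commute with it. -/
def reduceT {N : ℕ} : List (Row N) → PauliOp N → Timed (PauliOp N)
  | [], o => pure o
  | r :: rs, o => do
    let o' ← fixOpT (singleOp r.2) r.1 o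
    reduceT rs o'

/-- The first listed single-qubit operator that anti-commutes with `o`. -/
def findPivotT {N : ℕ} (o : PauliOp N) : List (Fin N × Bool) → Timed (Option (Fin N × Bool))
  | [] => pure none
  | c :: cs => do if ← antiT o (singleOp c) then pure (some c) else findPivotT o cs

/-- Multiply by `o` the rows that anti-commute with the pivot `c`. -/
def eliminateT {N : ℕ} (o : PauliOp N) (c : Fin N × Bool) : List (Row N) → Timed (List (Row N))
  | [] => pure []
  | r :: rs => do
    let x ← fixOpT (singleOp c) o r.1
    let rest ← eliminateT o c rs
    pure ((x, r.2) :: rest)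

/-- The candidates for pivots: `X` and `Z` on every qubit, qubit by qubit. -/
def allPivots (N : ℕ) : List (Fin N × Bool) :=
  (List.finRange N).flatMap fun n => [(n, false), (n, true)]

/-- The elimination that turns a list of operators into a list of rows, each of which is the only
one that anti-commutes with its pivot. -/
def rowsT {N : ℕ} : List (PauliOp N) → List (Row N) → Timed (List (Row N))
  | [], rows => pure rows
  | o :: os, rows => do
    let o' ← reduceT rows o
    if o' = 1 then rowsT os rows
    else
      match ← findPivotT o' (allPivots N) with
      | none => rowsT os rows
      | some c => do
        let rows' ← eliminateT o' c rows
        rowsT os (rows' ++ [(o', c)])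

/-- The pseudo-generators: the rows grouped by the qubits of their pivots. -/
def pseudoGeneratorsT {N : ℕ} (C : List (PauliOp N)) : Timed (List (List (PauliOp N))) := do
  let rows ← rowsT C []
  pure (((List.finRange N).map fun n =>
    (rows.filter fun r => r.2.1 = n).map Prod.fst).filter fun g => !g.isEmpty)

/-- The products of the non-empty subsets of a pseudo-generator, which has one or two members. -/
def spanT {N : ℕ} : List (PauliOp N) → Timed (List (PauliOp N))
  | [] => pure []
  | [a] => pure [a]
  | a :: b :: _ => do
    let c ← mulT a b
    pure [a, b, c]

/-- The products of `x` with the listed operators. -/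
def mulEachT {N : ℕ} (x : PauliOp N) : List (PauliOp N) → Timed (List (PauliOp N))
  | [] => pure []
  | y :: ys => do
    let z ← mulT x y
    let zs ← mulEachT x ys
    pure (z :: zs)

/-- All products of a member of the first list and a member of the second list. -/
def mulAllT {N : ℕ} : List (PauliOp N) → List (PauliOp N) → Timed (List (PauliOp N))
  | [], _ => pure []
  | x :: xs, ys => do
    let zs ← mulEachT x ys
    let ws ← mulAllT xs ys
    pure (zs ++ ws)

/-- The pseudo-product of a list of pseudo-generators. -/
def pseudoProductT {N : ℕ} : List (List (PauliOp N)) → Timed (List (PauliOp N))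
  | [] => pure [1]
  | g :: gs => do
    let xs ← spanT g
    let ys ← pseudoProductT gs
    mulAllT xs ys

/-- Improve the best error found so far by the candidates that act on an operator in `X`. -/
def scanT {N : ℕ} (X : List (PauliOp N)) :
    List (PauliOp N) → Option (PauliOp N) → Timed (Option (PauliOp N))
  | [], best => pure best
  | e :: es, best => do
    if best.any fun m => decide (weight m ≤ weight e) then scanT X es best
    else if ← anyAntiT e X then scanT X es (some e)
    else scanT X es best

/-- Scan the pseudo-products of the listed collections of pseudo-generators. -/
def scanLevelT {N : ℕ} (X : List (PauliOp N)) :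
    List (List (List (PauliOp N))) → Option (PauliOp N) → Timed (Option (PauliOp N))
  | [], best => pure best
  | H :: Hs, best => do
    let es ← pseudoProductT H
    let best' ← scanT X es best
    scanLevelT X Hs best'

/-- Scan the pseudo-products of `r` pseudo-generators for the listed values of `r`, until an error
of weight at most `r` is known before those of `r` pseudo-generators are scanned. -/
def searchT {N : ℕ} (G : List (List (PauliOp N))) (X : List (PauliOp N)) :
    List ℕ → Option (PauliOp N) → Timed (Option (PauliOp N))
  | [], best => pure best
  | r :: rs, best => do
    if best.any fun m => decide (weight m ≤ r) then pure best
    else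
      let best' ← scanLevelT X (List.sublistsLen r G) best
      searchT G X rs best'

/-- A product of pseudo-generators of minimal weight that acts on some operator in `X`. -/
def findErrorT {N : ℕ} (G : List (List (PauliOp N))) (X : List (PauliOp N)) :
    Timed (Option (PauliOp N)) :=
  searchT G X ((List.range G.length).map (· + 1)) none

/-- The data of the algorithm: a listing of `Q`, and `P` with its bits. -/
structure AlgState (N : ℕ) where
  pending : List (OpPair N)
  Ps : List (OpPair N × Bool)

/-- The triple `(Q, P, s)` that the data represent. -/
def AlgState.toOptState {N : ℕ} (st : AlgState N) : OptState N := ⟨st.pending.toFinset, st.Ps⟩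

/-- A listing of the operators on which the errors are to act. -/
def AlgState.targets {N : ℕ} (st : AlgState N) : List (PauliOp N) :=
  ((st.Ps.filter fun y => y.2).map fun y => y.1.2) ++ st.pending.flatMap fun q => [q.1, q.2]

/-- Split `Ps` at the first pair with bit `1` on whose second member `h` acts. -/
def splitFlaggedT {N : ℕ} (h : PauliOp N) : List (OpPair N × Bool) →
    Timed (Option (List (OpPair N × Bool) × OpPair N × List (OpPair N × Bool)))
  | [] => pure none
  | y :: ys => do
    if ← (if y.2 then antiT h y.1.2 else pure false) then pure (some ([], y.1, ys))
    else
      match ← splitFlaggedT h ys with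
      | none => pure none
      | some (pre, q, post) => pure (some (y :: pre, q, post))

/-- Take out the first listed pair on which `h` acts, with a member on which `h` acts in front. -/
def takePendingT {N : ℕ} (h : PauliOp N) :
    List (OpPair N) → Timed (Option (OpPair N × List (OpPair N)))
  | [] => pure none
  | q :: qs => do
    if ← antiT h q.1 then pure (some (q, qs))
    else if ← antiT h q.2 then pure (some (q.swap, qs))
    else
      match ← takePendingT h qs with
      | none => pure none
      | some (q', rest) => pure (some (q', q :: rest))

/-- Fix the second members of the pairs with bit `1`, and multiply `acc` by their partners. -/
def fixFlaggedT {N : ℕ} (h o : PauliOp N) :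
    PauliOp N → List (OpPair N × Bool) → Timed (PauliOp N × List (OpPair N × Bool))
  | acc, [] => pure (acc, [])
  | acc, y :: ys => do
    if ← (if y.2 then antiT h y.1.2 else pure false) then
      let acc' ← mulT acc y.1.1
      let b ← mulT y.1.2 o
      let r ← fixFlaggedT h o acc' ys
      pure (r.1, ((y.1.1, b), true) :: r.2)
    else
      let r ← fixFlaggedT h o acc ys
      pure (r.1, y :: r.2)

/-- Multiply `x` by `o` and `acc` by `partner` if `h` acts on `x`. -/
def fixMemberT {N : ℕ} (h o acc x partner : PauliOp N) : Timed (PauliOp N × PauliOp N) := do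
  if ← antiT h x then
    let acc' ← mulT acc partner
    let x' ← mulT x o
    pure (acc', x')
  else pure (acc, x)

/-- Fix both members of the listed pairs, and multiply `acc` by their partners. -/
def fixPendingT {N : ℕ} (h o : PauliOp N) :
    PauliOp N → List (OpPair N) → Timed (PauliOp N × List (OpPair N))
  | acc, [] => pure (acc, [])
  | acc, q :: qs => do
    let u ← fixMemberT h o acc q.1 q.2
    let v ← fixMemberT h o u.1 q.2 q.1
    let r ← fixPendingT h o v.1 qs
    pure (r.1, (u.2, v.2) :: r.2)

/-- One step of the algorithm. -/
def stepT {N : ℕ} (G : List (List (PauliOp N))) (st : AlgState N) : Timed (AlgState N) := do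
  match ← findErrorT G st.targets with
  | none => pure st
  | some h =>
    match ← splitFlaggedT h st.Ps with
    | some (pre, q, post) => do
      let u ← fixFlaggedT h q.2 q.1 post
      let v ← fixPendingT h q.2 u.1 st.pending
      pure ⟨v.2, pre ++ ((v.1, q.2), false) :: u.2⟩
    | none =>
      match ← takePendingT h st.pending with
      | none => pure st
      | some (q, rest) => do
        let v ← fixPendingT h q.1 q.2 rest
        let b ← fixOpT h q.1 v.1
        pure ⟨v.2, st.Ps ++ [((q.1, b), true)]⟩

/-- The triples that are met from `st` on, until no pairs are pending or `fuel` steps were made. -/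
def loopT {N : ℕ} (G : List (List (PauliOp N))) : ℕ → AlgState N → Timed (List (AlgState N))
  | 0, st => pure [st]
  | fuel + 1, st => do
    if st.pending.isEmpty then pure [st]
    else
      let st' ← stepT G st
      let rest ← loopT G fuel st'
      pure (st :: rest)

/-- The whole computation, from a listing of generators of the centralizer of the stabilizers and a
listing of conjugal pairs.  A step either moves a pair from `Q` to `P` or changes a bit from `1` to
`0`, so there are at most `2 * L.length` steps. -/
def optimizeT {N : ℕ} (C : List (PauliOp N)) (L : List (OpPair N)) :
    Timed (List (AlgState N)) := do
  let G ← pseudoGeneratorsT C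
  loopT G (2 * L.length) ⟨L, []⟩

end PauliCode

open PauliCode

/-! Correctness. At every moment the pairs of `Q` and `P` together form a hyperbolic (symplectic)
sequence that generates the fixed group of `L`. A step multiplies certain operators by `o` and
compensates on the partner of `o`, which is a change of symplectic basis (`Hyperbolic.shear`,
`pairSpan_shear`, `Step.pairs_hyperbolic`). The protected operators `X`, the members of `Q` together
with `R`, behave simply: after a step with error `h` they generate exactly those operators of the
former group that commute with `h` (`Step.exists_error`, `mem_closure_of_mem_closure_insert`). As
`h` has minimal weight, the group generated by `X` always contains every operator of the original
group that no undetectable error up to the weight of the next error acts on (`complete` in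
`OptInvariant`).

Each pair of `P` remembers the error that acted when it was appended. This error keeps acting on the
first member, no lighter error acts on either member, and the remembered weights increase weakly.
Thus they are the distances in the end (`OptInvariant.pairDist_eq`). Pairs with bit 1 may still
change. They stay harmless because a remembered error commutes with everything that can be
multiplied onto its first member.

Optimality is a count of hyperbolic pairs. Suppose the pair appended at position `i` gets distance
`w`, and a competing choice has a larger distance there. Its pairs from `i` on then have distance
above `w`, because distances are sorted. So they lie in the group generated by `Q` and `R` after the
step. Since `R` commutes with itself and with `Q`, that group holds at most `|Q|` hyperbolic pairs
(`Hyperbolic.length_le`), one too few (`OptInvariant.pairDist_le`). Termination: `2|Q|` plus the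
number of bits 1 decreases (`Step.size_lt`), so there are at most `2|L|` steps.

Running time. After elimination each row is the only one that anti-commutes with its single-qubit
pivot, so an operator of weight `w` involves pivots on at most `w` qubits and is a product from at
most `w` pseudo-generators (`exists_pseudoProductT`). Searching by the number `r` of
pseudo-generators may therefore stop once an error of weight at most `r` is known (`searchT_spec`).
The last qubit of the result is generated by the protected operators of every earlier state, hence
an error of weight `d` is always available and no level beyond `d` is scanned (`loopT_spec`). The
levels are bounded by the `d`-th one because `2d ≤ N + 1` (`two_mul_pairDist_le`, by moving an
operator off half of the qubits), and elimination costs `O(|C|²)` because `N ≤ |C|`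
(`le_length_of_closure_eq_centralizer`). -/

namespace PauliCode

/-! ### The symplectic form -/

section Symplectic

variable {N : ℕ}

theorem sympl_comm (p q : PauliOp N) : sympl p q = sympl q p :=
  Finset.sum_congr rfl fun k _ => by ring

theorem sympl_mul_left (p q r : PauliOp N) : sympl (p * q) r = sympl p r + sympl q r := by
  rw [sympl, sympl, sympl, ← Finset.sum_add_distrib]
  refine Finset.sum_congr rfl fun k _ => ?_
  simp only [Pi.mul_apply, toAdd_mul, Prod.fst_add, Prod.snd_add]
  ring

theorem anti_comm {p q : PauliOp N} : Anti p q ↔ Anti q p := by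
  rw [Anti, sympl_comm, Anti]

theorem Anti.symm {p q : PauliOp N} (h : Anti p q) : Anti q p := anti_comm.mp h

theorem anti_mul_left {p q r : PauliOp N} : Anti (p * q) r ↔ (Anti p r ↔ ¬ Anti q r) := by
  rw [Anti, sympl_mul_left, Anti, Anti]
  generalize sympl p r = x
  generalize sympl q r = y
  revert x y
  decide

theorem anti_mul_right {p q r : PauliOp N} : Anti r (p * q) ↔ (Anti r p ↔ ¬ Anti r q) := by
  rw [anti_comm, anti_mul_left, anti_comm, @anti_comm _ q]

theorem PauliOp.mul_self (p : PauliOp N) : p * p = 1 := by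
  funext k
  have : ∀ u : Multiplicative (ZMod 2 × ZMod 2), u * u = 1 := by decide
  exact this (p k)

@[simp] theorem not_anti_one_right (p : PauliOp N) : ¬ Anti p 1 := by
  simp [Anti, sympl]

@[simp] theorem not_anti_one_left (p : PauliOp N) : ¬ Anti 1 p := by
  simp [Anti, sympl]

@[simp] theorem not_anti_self (p : PauliOp N) : ¬ Anti p p := by
  have h : ∀ k, (p k).toAdd.1 * (p k).toAdd.2 + (p k).toAdd.2 * (p k).toAdd.1 = 0 := fun k => by
    generalize (p k).toAdd = u
    revert u
    decide
  simp [Anti, sympl, h]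

/-- The centralizer as a subgroup. -/
def commutant (X : Set (PauliOp N)) : Subgroup (PauliOp N) where
  carrier := centralizer X
  one_mem' := fun _ _ => not_anti_one_left _
  mul_mem' := fun ha hb s hs => by
    have h1 := ha s hs
    have h2 := hb s hs
    rw [anti_mul_left]
    tauto
  inv_mem' := fun {a} ha => by
    rwa [inv_eq_of_mul_eq_one_left (PauliOp.mul_self a)]

theorem mem_commutant {X : Set (PauliOp N)} {e : PauliOp N} :
    e ∈ commutant X ↔ e ∈ centralizer X := Iff.rfl

/-- The operators that commute with `h` form a subgroup, so `h` cannot commute with all generators.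
This is how errors on products are traced back to errors on listed operators. -/
theorem exists_anti_of_anti_closure {X : Set (PauliOp N)} {h v : PauliOp N}
    (hv : v ∈ Subgroup.closure X) (ha : Anti h v) : ∃ x ∈ X, Anti h x := by
  by_contra! hX
  have hle : Subgroup.closure X ≤ commutant {h} := by
    rw [Subgroup.closure_le]
    rintro x hx _ rfl
    exact fun hxh => hX x hx hxh.symm
  exact hle hv h rfl ha.symm

/-- If `h` anti-commutes with `o` and commutes with `X`, then the operators that commute with `h`
and are generated by `o` and `X` are generated by `X`. -/
theorem mem_closure_of_mem_closure_insert {X : Set (PauliOp N)} {h o v : PauliOp N}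
    (hX : ∀ x ∈ X, ¬ Anti h x) (ho : Anti h o) (hv : v ∈ Subgroup.closure (insert o X))
    (hhv : ¬ Anti h v) : v ∈ Subgroup.closure X := by
  rw [Set.insert_eq, Subgroup.closure_union, Subgroup.mem_sup] at hv
  obtain ⟨_, hz, w, hw, rfl⟩ := hv
  obtain ⟨z, rfl⟩ := Subgroup.mem_closure_singleton.mp hz
  have hhw : ¬ Anti h w := fun ha => by
    obtain ⟨x, hx, hax⟩ := exists_anti_of_anti_closure hw ha
    exact hX x hx hax
  -- Operators square to the identity, so only the parity of the exponent of `o` matters; an odd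
  -- exponent would make `h` anti-commute with `v`.
  rcases Int.even_or_odd' z with ⟨m, rfl | rfl⟩
  · have : o ^ (2 * m) = 1 := by rw [zpow_mul, zpow_two, PauliOp.mul_self, one_zpow]
    rwa [this, one_mul]
  · have : o ^ (2 * m + 1) = o := by
      rw [zpow_add, zpow_mul, zpow_two, PauliOp.mul_self, one_zpow, one_mul, zpow_one]
    rw [this, anti_mul_right] at hhv
    tauto

theorem fixOp_eq_or (h o x : PauliOp N) : fixOp h o x = x ∨ fixOp h o x = x * o := by
  unfold fixOp
  split_ifs <;> simp

theorem not_anti_fixOp {h o : PauliOp N} (ho : Anti h o) (x : PauliOp N) :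
    ¬ Anti h (fixOp h o x) := by
  unfold fixOp
  split_ifs with hx
  · rw [anti_mul_right]
    tauto
  · exact hx

theorem fixOp_mem {H : Subgroup (PauliOp N)} {h o x : PauliOp N} (ho : o ∈ H) :
    fixOp h o x ∈ H ↔ x ∈ H := by
  unfold fixOp
  split_ifs
  · exact H.mul_mem_cancel_right ho
  · exact Iff.rfl

theorem partnerFactor_mem {H : Subgroup (PauliOp N)} {h a b : PauliOp N} (hb : b ∈ H) :
    partnerFactor h a b ∈ H := by
  unfold partnerFactor
  split_ifs
  · exact hb
  · exact H.one_mem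

theorem pairsFactor_mem {H : Subgroup (PauliOp N)} {h : PauliOp N} {Q : Finset (OpPair N)}
    (hQ : ∀ q ∈ Q, q.1 ∈ H ∧ q.2 ∈ H) : pairsFactor h Q ∈ H :=
  H.prod_mem fun q hq => H.mul_mem (partnerFactor_mem (hQ q hq).2) (partnerFactor_mem (hQ q hq).1)

theorem flaggedFactor_mem {H : Subgroup (PauliOp N)} {h : PauliOp N}
    {l : List (OpPair N × Bool)} (hl : ∀ y ∈ l, y.2 = true → y.1.1 ∈ H) :
    flaggedFactor h l ∈ H := by
  refine H.list_prod_mem fun x hx => ?_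
  obtain ⟨y, hy, rfl⟩ := List.mem_map.mp hx
  split_ifs with h2
  · exact partnerFactor_mem (hl y hy h2)
  · exact H.one_mem

end Symplectic

/-! ### Hyperbolic sequences of pairs -/

section Hyperbolic

variable {N : ℕ}

/-- The members of the two pairs commute with each other. -/
def PairsCommute (q r : OpPair N) : Prop :=
  ¬ Anti q.1 r.1 ∧ ¬ Anti q.1 r.2 ∧ ¬ Anti q.2 r.1 ∧ ¬ Anti q.2 r.2

theorem PairsCommute.symm {q r : OpPair N} (h : PairsCommute q r) : PairsCommute r q :=
  ⟨mt anti_comm.mp h.1, mt anti_comm.mp h.2.2.1, mt anti_comm.mp h.2.1, mt anti_comm.mp h.2.2.2⟩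

/-- The members of each pair anti-commute, and different pairs commute. -/
def Hyperbolic (l : List (OpPair N)) : Prop :=
  (∀ q ∈ l, Anti q.1 q.2) ∧ l.Pairwise PairsCommute

theorem Hyperbolic.perm {l l' : List (OpPair N)} (h : Hyperbolic l) (hp : l.Perm l') :
    Hyperbolic l' :=
  ⟨fun q hq => h.1 q (hp.mem_iff.mpr hq), h.2.perm hp PairsCommute.symm⟩

theorem Hyperbolic.sublist {l l' : List (OpPair N)} (h : Hyperbolic l) (hp : l'.Sublist l) :
    Hyperbolic l' :=
  ⟨fun q hq => h.1 q (hp.subset hq), h.2.sublist hp⟩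

theorem hyperbolic_cons {q : OpPair N} {l : List (OpPair N)} :
    Hyperbolic (q :: l) ↔ Anti q.1 q.2 ∧ (∀ r ∈ l, PairsCommute q r) ∧ Hyperbolic l := by
  simp only [Hyperbolic, List.mem_cons, forall_eq_or_imp, List.pairwise_cons]
  tauto

theorem hyperbolic_swap {a b : PauliOp N} {l : List (OpPair N)} (h : Hyperbolic ((a, b) :: l)) :
    Hyperbolic ((b, a) :: l) := by
  rw [hyperbolic_cons] at h ⊢
  refine ⟨h.1.symm, fun r hr => ?_, h.2.2⟩
  have := h.2.1 r hr
  simp only [PairsCommute] at this ⊢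
  tauto

theorem Hyperbolic.pairwise_ne {l : List (OpPair N)} (h : Hyperbolic l) :
    l.Pairwise fun q r => SharesNoOp q r := by
  refine h.2.imp_of_mem fun {q r} hq hr hc => ?_
  have h1 := h.1 q hq
  have h2 := h.1 r hr
  obtain ⟨c1, c2, c3, c4⟩ := hc
  refine ⟨?_, ?_, ?_, ?_⟩ <;> intro he
  · exact c2 (he ▸ h2)
  · exact c1 (he ▸ h2.symm)
  · exact c4 (he ▸ h2)
  · exact c3 (he ▸ h2.symm)

theorem Hyperbolic.nodup {l : List (OpPair N)} (h : Hyperbolic l) : l.Nodup :=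
  h.pairwise_ne.imp fun hs he => hs.1 (congrArg Prod.fst he)

/-- The power of an operator with exponent a bit. -/
def bitPow (p : PauliOp N) (x : Bool) : PauliOp N := if x then p else 1

/-- Multiply the members of a pair by the powers of `o` with the given bits. -/
def shearPair (o : PauliOp N) (y : (Bool × Bool) × OpPair N) : OpPair N :=
  (y.2.1 * bitPow o y.1.1, y.2.2 * bitPow o y.1.2)

/-- The product of the partners of the members with bit `1`. -/
def partnerProd (l : List ((Bool × Bool) × OpPair N)) : PauliOp N :=
  (l.map fun y => bitPow y.2.2 y.1.1 * bitPow y.2.1 y.1.2).prod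

theorem bitPow_mem {H : Subgroup (PauliOp N)} {p : PauliOp N} (hp : p ∈ H) (x : Bool) :
    bitPow p x ∈ H := by
  unfold bitPow
  split_ifs
  · exact hp
  · exact H.one_mem

theorem anti_bitPow_left {p q : PauliOp N} {x : Bool} :
    Anti (bitPow p x) q ↔ x = true ∧ Anti p q := by
  cases x <;> simp [bitPow]

theorem anti_bitPow_right {p q : PauliOp N} {x : Bool} :
    Anti q (bitPow p x) ↔ x = true ∧ Anti q p := by
  cases x <;> simp [bitPow]

theorem partnerProd_mem {H : Subgroup (PauliOp N)} {l : List ((Bool × Bool) × OpPair N)}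
    (hl : ∀ y ∈ l, y.2.1 ∈ H ∧ y.2.2 ∈ H) : partnerProd l ∈ H := by
  refine H.list_prod_mem fun x hx => ?_
  obtain ⟨y, hy, rfl⟩ := List.mem_map.mp hx
  exact H.mul_mem (bitPow_mem (hl y hy).2 _) (bitPow_mem (hl y hy).1 _)

theorem partnerProd_commute {l : List ((Bool × Bool) × OpPair N)} {p : PauliOp N}
    (hl : ∀ y ∈ l, ¬ Anti p y.2.1 ∧ ¬ Anti p y.2.2) : ¬ Anti (partnerProd l) p := by
  have : partnerProd l ∈ commutant {p} := by
    refine partnerProd_mem fun y hy => ⟨?_, ?_⟩ <;> rintro _ rfl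
    · exact mt anti_comm.mp (hl y hy).1
    · exact mt anti_comm.mp (hl y hy).2
  exact this p rfl

/-- In a hyperbolic sequence only the partner anti-commutes with a given member, so anti-commutation
reads off the bit that governs the exponent of the partner. -/
theorem anti_partnerProd {l : List ((Bool × Bool) × OpPair N)}
    (hl : Hyperbolic (l.map Prod.snd)) {y : (Bool × Bool) × OpPair N} (hy : y ∈ l) :
    (Anti (partnerProd l) y.2.1 ↔ y.1.1 = true) ∧
      (Anti (partnerProd l) y.2.2 ↔ y.1.2 = true) := by
  induction l with
  | nil => simp at hy
  | cons x l ih =>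
    rw [List.map_cons, hyperbolic_cons] at hl
    obtain ⟨h1, h2, h3⟩ := hl
    have hp : partnerProd (x :: l) = bitPow x.2.2 x.1.1 * bitPow x.2.1 x.1.2 * partnerProd l := by
      simp [partnerProd]
    rw [hp]
    simp only [anti_mul_left, anti_bitPow_left]
    have h1' := h1.symm
    rcases List.mem_cons.mp hy with rfl | hy
    · have c1 : ¬ Anti (partnerProd l) y.2.1 := partnerProd_commute fun z hz => by
        have := h2 z.2 (List.mem_map_of_mem hz)
        exact ⟨this.1, this.2.1⟩
      have c2 : ¬ Anti (partnerProd l) y.2.2 := partnerProd_commute fun z hz => by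
        have := h2 z.2 (List.mem_map_of_mem hz)
        exact ⟨this.2.2.1, this.2.2.2⟩
      simp [c1, c2, h1, h1']
    · obtain ⟨i1, i2⟩ := ih h3 hy
      obtain ⟨c1, c2, c3, c4⟩ := h2 y.2 (List.mem_map_of_mem hy)
      simp [i1, i2, c1, c2, c3, c4]

/-- A symplectic transvection along `o`, followed by a compensation on the partner of `o`, keeps
the sequence hyperbolic. -/
theorem Hyperbolic.shear {a o : PauliOp N} {l : List ((Bool × Bool) × OpPair N)} (z : Bool)
    (hl : Hyperbolic ((a, o) :: l.map Prod.snd)) :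
    Hyperbolic ((a * partnerProd l * bitPow o z, o) :: l.map (shearPair o)) := by
  rw [hyperbolic_cons] at hl ⊢
  obtain ⟨h1, h2, h3⟩ := hl
  have h2' : ∀ y ∈ l, PairsCommute (a, o) y.2 := fun y hy => h2 _ (List.mem_map_of_mem hy)
  have ho : ¬ Anti (partnerProd l) o := partnerProd_commute fun y hy => by
    have := h2' y hy
    exact ⟨this.2.2.1, this.2.2.2⟩
  dsimp only at h1 ⊢
  refine ⟨?_, ?_, ?_, ?_⟩
  · simp [anti_mul_left, anti_bitPow_left, h1, ho]
  · intro r hr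
    obtain ⟨y, hy, rfl⟩ := List.mem_map.mp hr
    obtain ⟨c1, c2, c3, c4⟩ := h2' y hy
    -- The sign from `a` against the new factor `o` and the sign from `partnerProd l` against the
    -- old member are governed by the same bit, so they cancel. The factor `bitPow o z` commutes
    -- with everything here.
    obtain ⟨i1, i2⟩ := anti_partnerProd h3 hy
    dsimp only at c1 c2 c3 c4
    simp [PairsCommute, shearPair, anti_mul_left, anti_mul_right, anti_bitPow_left,
      anti_bitPow_right, c1, c2, c3, c4, i1, i2, h1, ho]
  · intro r hr
    obtain ⟨y, hy, rfl⟩ := List.mem_map.mp hr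
    obtain ⟨c1, c2, c3, c4⟩ := h2' y hy
    dsimp only at c1 c2 c3 c4
    have := h3.1 y.2 (List.mem_map_of_mem hy)
    simp [shearPair, anti_mul_left, anti_mul_right, anti_bitPow_left,
      anti_bitPow_right, c3, c4, @anti_comm _ _ o, this]
  · have h4 := h3.2
    rw [List.pairwise_map] at h4 ⊢
    refine h4.imp_of_mem fun {x y} hx hy hxy => ?_
    obtain ⟨c1, c2, c3, c4⟩ := h2' y hy
    obtain ⟨d1, d2, d3, d4⟩ := h2' x hx
    obtain ⟨e1, e2, e3, e4⟩ := hxy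
    dsimp only at c1 c2 c3 c4 d1 d2 d3 d4
    simp [PairsCommute, shearPair, anti_mul_left, anti_mul_right, anti_bitPow_left,
      anti_bitPow_right, c3, c4, e1, e2, e3, e4, d3, d4, @anti_comm _ _ o]

/-- The group generated by the members of the listed pairs. -/
def pairSpan (l : List (OpPair N)) : Subgroup (PauliOp N) :=
  Subgroup.closure (unpack {q | q ∈ l})

theorem mem_pairSpan {l : List (OpPair N)} {q : OpPair N} (hq : q ∈ l) :
    q.1 ∈ pairSpan l ∧ q.2 ∈ pairSpan l :=
  ⟨Subgroup.subset_closure ⟨q, hq, Or.inl rfl⟩, Subgroup.subset_closure ⟨q, hq, Or.inr rfl⟩⟩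

theorem pairSpan_le {l : List (OpPair N)} {H : Subgroup (PauliOp N)} :
    pairSpan l ≤ H ↔ ∀ q ∈ l, q.1 ∈ H ∧ q.2 ∈ H := by
  rw [pairSpan, Subgroup.closure_le]
  constructor
  · exact fun h q hq => ⟨h ⟨q, hq, Or.inl rfl⟩, h ⟨q, hq, Or.inr rfl⟩⟩
  · rintro h x ⟨q, hq, rfl | rfl⟩
    · exact (h q hq).1
    · exact (h q hq).2

theorem pairSpan_perm {l l' : List (OpPair N)} (h : l.Perm l') : pairSpan l = pairSpan l' := by
  unfold pairSpan
  congr 2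
  ext q
  exact h.mem_iff

theorem pairSpan_swap (a b : PauliOp N) (l : List (OpPair N)) :
    pairSpan ((a, b) :: l) = pairSpan ((b, a) :: l) := by
  have key : ∀ a b : PauliOp N, pairSpan ((a, b) :: l) ≤ pairSpan ((b, a) :: l) := by
    intro a b
    rw [pairSpan_le]
    intro q hq
    rcases List.mem_cons.mp hq with rfl | hq
    · exact (mem_pairSpan (List.mem_cons_self (a := (b, a)))).symm
    · exact mem_pairSpan (List.mem_cons_of_mem _ hq)
  exact le_antisymm (key a b) (key b a)

/-- A shear is invertible: `o` is kept, so the old members, and from them `partnerProd l` and `a`,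
are recovered by multiplying once more. -/
theorem pairSpan_shear (a o : PauliOp N) (l : List ((Bool × Bool) × OpPair N)) (z : Bool) :
    pairSpan ((a * partnerProd l * bitPow o z, o) :: l.map (shearPair o)) =
      pairSpan ((a, o) :: l.map Prod.snd) := by
  apply le_antisymm
  · have ho := (mem_pairSpan (List.mem_cons_self (a := (a, o)) (l := l.map Prod.snd)))
    have hl : ∀ y ∈ l, y.2.1 ∈ pairSpan ((a, o) :: l.map Prod.snd) ∧
        y.2.2 ∈ pairSpan ((a, o) :: l.map Prod.snd) := fun y hy =>
      mem_pairSpan (List.mem_cons_of_mem _ (List.mem_map_of_mem hy))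
    rw [pairSpan_le]
    intro q hq
    rcases List.mem_cons.mp hq with rfl | hq
    · exact ⟨mul_mem (mul_mem ho.1 (partnerProd_mem hl)) (bitPow_mem ho.2 _), ho.2⟩
    · obtain ⟨y, hy, rfl⟩ := List.mem_map.mp hq
      exact ⟨mul_mem (hl y hy).1 (bitPow_mem ho.2 _), mul_mem (hl y hy).2 (bitPow_mem ho.2 _)⟩
  · have ho := (mem_pairSpan (List.mem_cons_self (a := (a * partnerProd l * bitPow o z, o))
      (l := l.map (shearPair o))))
    set H := pairSpan ((a * partnerProd l * bitPow o z, o) :: l.map (shearPair o))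
    have hl : ∀ y ∈ l, y.2.1 ∈ H ∧ y.2.2 ∈ H := fun y hy => by
      have := mem_pairSpan (List.mem_cons_of_mem (a * partnerProd l * bitPow o z, o)
        (List.mem_map_of_mem (f := shearPair o) hy))
      exact ⟨(H.mul_mem_cancel_right (bitPow_mem ho.2 _)).mp this.1,
        (H.mul_mem_cancel_right (bitPow_mem ho.2 _)).mp this.2⟩
    rw [pairSpan_le]
    intro q hq
    rcases List.mem_cons.mp hq with rfl | hq
    · refine ⟨?_, ho.2⟩
      exact (H.mul_mem_cancel_right (partnerProd_mem hl)).mp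
        ((H.mul_mem_cancel_right (bitPow_mem ho.2 _)).mp ho.1)
    · obtain ⟨q', hy, rfl⟩ := List.mem_map.mp hq
      exact hl _ hy

/-- A hyperbolic sequence within the group generated by the members of some pairs and by operators
`R` that commute with them and with each other is not longer than the sequence of these pairs. -/
theorem Hyperbolic.length_le {l B : List (OpPair N)} {R : Set (PauliOp N)} (hl : Hyperbolic l)
    (hR : ∀ r ∈ R, (∀ r' ∈ R, ¬ Anti r r') ∧ ∀ q ∈ B, ¬ Anti r q.1 ∧ ¬ Anti r q.2)
    (hlB : ∀ q ∈ l, q.1 ∈ Subgroup.closure (unpack {q | q ∈ B} ∪ R) ∧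
      q.2 ∈ Subgroup.closure (unpack {q | q ∈ B} ∪ R)) :
    l.length ≤ B.length := by
  set T := Subgroup.closure (unpack {q | q ∈ B} ∪ R)
  -- Counting takes the place of dimensions: there are `4 ^ |l|` exponent patterns, and `ρ` sends
  -- each one to the commutation pattern of its product with `B`, out of `4 ^ |B|`.
  let E : (Fin l.length → Bool × Bool) → List ((Bool × Bool) × OpPair N) :=
    fun f => List.ofFn fun i => (f i, l.get i)
  have hE : ∀ f, (E f).map Prod.snd = l := fun f => by
    simp only [E, List.map_ofFn]
    exact List.ofFn_get l
  let ρ : (Fin l.length → Bool × Bool) → (Fin B.length → Bool × Bool) := fun f j =>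
    (decide (Anti (partnerProd (E f)) (B.get j).1), decide (Anti (partnerProd (E f)) (B.get j).2))
  have hmem : ∀ f, partnerProd (E f) ∈ T := fun f => partnerProd_mem fun y hy =>
    hlB y.2 (by rw [← hE f]; exact List.mem_map_of_mem hy)
  have hinj : Function.Injective ρ := by
    intro f g hfg
    have hB : ∀ q ∈ B, ¬ Anti (partnerProd (E f) * partnerProd (E g)) q.1 ∧
        ¬ Anti (partnerProd (E f) * partnerProd (E g)) q.2 := by
      intro q hq
      obtain ⟨j, rfl⟩ := List.get_of_mem hq
      have := congrFun hfg j
      simp only [ρ, Prod.mk.injEq, decide_eq_decide] at this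
      rw [anti_mul_left, anti_mul_left, this.1, this.2]
      tauto
    have hcR : ∀ r ∈ R, ∀ v ∈ T, ¬ Anti r v := by
      intro r hr v hv ha
      obtain ⟨x, hx, hxa⟩ := exists_anti_of_anti_closure hv ha
      rcases hx with ⟨q, hq, rfl | rfl⟩ | hx
      · exact ((hR r hr).2 q hq).1 hxa
      · exact ((hR r hr).2 q hq).2 hxa
      · exact (hR r hr).1 x hx hxa
    -- Two products with equal patterns differ by an element of `T` that commutes with all of `T`.
    -- Since `l` lies in `T`, both have the same commutation with `l`, which determines the bits.
    have hc : ∀ v ∈ T, ¬ Anti (partnerProd (E f) * partnerProd (E g)) v := by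
      intro v hv ha
      obtain ⟨x, hx, hxa⟩ := exists_anti_of_anti_closure hv ha
      rcases hx with ⟨q, hq, rfl | rfl⟩ | hx
      · exact (hB q hq).1 hxa
      · exact (hB q hq).2 hxa
      · exact hcR x hx _ (mul_mem (hmem f) (hmem g)) hxa.symm
    funext i
    have hi : ∀ f, (f i, l.get i) ∈ E f := fun f => (List.mem_ofFn' _ _).mpr ⟨i, rfl⟩
    have h1 := anti_partnerProd (by rw [hE]; exact hl) (hi f)
    have h2 := anti_partnerProd (by rw [hE]; exact hl) (hi g)
    have h3 := hc _ (hlB _ (List.get_mem l i)).1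
    have h4 := hc _ (hlB _ (List.get_mem l i)).2
    rw [anti_mul_left] at h3 h4
    dsimp only at h1 h2
    rw [h1.1, h2.1] at h3
    rw [h1.2, h2.2] at h4
    ext
    · cases h : (f i).1 <;> cases h' : (g i).1 <;> simp_all
    · cases h : (f i).2 <;> cases h' : (g i).2 <;> simp_all
  have := Fintype.card_le_of_injective ρ hinj
  simp only [Fintype.card_pi, Fintype.card_prod, Fintype.card_bool, Finset.prod_const,
    Finset.card_univ, Fintype.card_fin] at this
  exact (Nat.pow_le_pow_iff_right (by norm_num)).mp this

end Hyperbolic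

/-! ### The effect of a step -/

section Steps

variable {N : ℕ}

/-- All pairs of a triple. -/
noncomputable def OptState.pairs (st : OptState N) : List (OpPair N) := st.Q.toList ++ st.P

theorem Hyperbolic.not_anti_snd {l : List (OpPair N)} (h : Hyperbolic l) {q r : OpPair N}
    (hq : q ∈ l) (hr : r ∈ l) : ¬ Anti q.2 r.2 := by
  have : Std.Symm fun q r : OpPair N => ¬ Anti q.2 r.2 := ⟨fun _ _ h => mt anti_comm.mp h⟩
  have h2 : l.Pairwise fun q r => ¬ Anti q.2 r.2 := h.2.imp fun hqr => hqr.2.2.2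
  exact h2.forall_of_forall (fun _ _ => not_anti_self _) hq hr

/-- The image of a finset could merge pairs. In a step, hyperbolicity of the sheared sequence
excludes this and provides the hypothesis. -/
theorem image_toList_perm {α : Type*} [DecidableEq α] {Q : Finset α} {f : α → α}
    (h : (Q.toList.map f).Nodup) : (Q.image f).toList.Perm (Q.toList.map f) := by
  rw [List.perm_ext_iff_of_nodup (Finset.nodup_toList _) h]
  simp

theorem erase_toList_perm {α : Type*} [DecidableEq α] {Q : Finset α} {q : α} (hq : q ∈ Q) :
    Q.toList.Perm (q :: (Q.erase q).toList) := by
  rw [List.perm_ext_iff_of_nodup (Finset.nodup_toList _) (by simp [Finset.nodup_toList])]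
  intro a
  by_cases ha : a = q <;> simp [ha, hq]

/-- The pair with the bits that say which members anti-commute with `h`. -/
def withBits (h : PauliOp N) (q : OpPair N) : (Bool × Bool) × OpPair N :=
  ((decide (Anti h q.1), decide (Anti h q.2)), q)

/-- The pair with the bits that say which members `fixFlagged` changes. -/
def withFlagBits (h : PauliOp N) (y : OpPair N × Bool) : (Bool × Bool) × OpPair N :=
  ((false, y.2 && decide (Anti h y.1.2)), y.1)

theorem mul_bitPow (h o x : PauliOp N) : x * bitPow o (decide (Anti h x)) = fixOp h o x := by
  by_cases hx : Anti h x <;> simp [bitPow, fixOp, hx]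

theorem bitPow_decide (h a b : PauliOp N) : bitPow b (decide (Anti h a)) = partnerFactor h a b := by
  by_cases ha : Anti h a <;> simp [bitPow, partnerFactor, ha]

theorem shearPair_withBits (h o : PauliOp N) : shearPair o ∘ withBits h = fixPair h o := by
  funext q
  simp [shearPair, withBits, fixPair, mul_bitPow]

theorem shearPair_withFlagBits (h o : PauliOp N) :
    shearPair o ∘ withFlagBits h = Prod.fst ∘ fixFlagged h o := by
  funext y
  obtain ⟨⟨a, b⟩, _ | _⟩ := y
  · simp [shearPair, withFlagBits, fixFlagged, bitPow]
  · simp [shearPair, withFlagBits, fixFlagged, ← mul_bitPow]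
    simp [bitPow]

theorem partnerProd_append (l l' : List ((Bool × Bool) × OpPair N)) :
    partnerProd (l ++ l') = partnerProd l * partnerProd l' := by
  simp [partnerProd]

theorem partnerProd_withBits (h : PauliOp N) (l : List (OpPair N)) :
    partnerProd (l.map (withBits h)) =
      (l.map fun q => partnerFactor h q.1 q.2 * partnerFactor h q.2 q.1).prod := by
  simp [partnerProd, withBits, Function.comp_def, bitPow_decide]

theorem partnerProd_withBits_toList (h : PauliOp N) (Q : Finset (OpPair N)) :
    partnerProd (Q.toList.map (withBits h)) = pairsFactor h Q := by
  rw [partnerProd_withBits, Finset.prod_map_toList, pairsFactor]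

theorem partnerProd_withFlagBits (h : PauliOp N) (l : List (OpPair N × Bool)) :
    partnerProd (l.map (withFlagBits h)) = flaggedFactor h l := by
  rw [partnerProd, flaggedFactor, List.map_map]
  congr 2
  funext y
  obtain ⟨⟨a, b⟩, _ | _⟩ := y
  · simp [withFlagBits, bitPow]
  · simp [withFlagBits, ← bitPow_decide]
    simp [bitPow]

theorem partnerProd_zeroBits (l : List (OpPair N)) :
    partnerProd (l.map fun q => ((false, false), q)) = 1 := by
  simp [partnerProd, bitPow, Function.comp_def]

/-- Both cases are shears along `o`, up to order: bits taken from `h` for the pending pairs, in case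
1 also for the later flagged second members, and zero bits for the untouched pairs. -/
theorem Step.pairs_hyperbolic {S : Set (PauliOp N)} {st st' : OptState N} (hs : Step S st st')
    (hh : Hyperbolic st.pairs) :
    Hyperbolic st'.pairs ∧ pairSpan st'.pairs = pairSpan st.pairs ∧
      st'.pairs.length = st.pairs.length := by
  have hzero : ∀ o : PauliOp N, shearPair o ∘ (fun q => ((false, false), q)) = id := by
    intro o
    funext q
    simp [shearPair, bitPow]
  have hsnd : ∀ h : PauliOp N, Prod.snd ∘ withBits h = id := fun h => rfl
  have hsnd' : ∀ h : PauliOp N, Prod.snd ∘ withFlagBits h = Prod.fst := fun h => rfl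
  cases hs with
  | case1 Q pre post a o h hQ hmin hact hfirst =>
    set l : List ((Bool × Bool) × OpPair N) := Q.toList.map (withBits h) ++
      ((pre.map Prod.fst).map (fun q => ((false, false), q)) ++ post.map (withFlagBits h)) with hl
    have h1 : (OptState.pairs ⟨Q, pre ++ ((a, o), true) :: post⟩).Perm
        ((a, o) :: l.map Prod.snd) := by
      simp only [OptState.pairs, OptState.P, hl, List.map_append, List.map_map, hsnd, hsnd',
        List.map_id, List.map_cons]
      rw [← List.append_assoc, ← List.append_assoc]
      exact List.perm_middle
    have h2 := (hh.perm h1).shear false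
    have hfac : a * partnerProd l * bitPow o false =
        a * flaggedFactor h post * pairsFactor h Q := by
      rw [hl, partnerProd_append, partnerProd_append, partnerProd_withBits_toList,
        partnerProd_zeroBits, partnerProd_withFlagBits]
      rw [one_mul, mul_comm (pairsFactor h Q), ← mul_assoc]
      exact mul_one _
    have hmap : l.map (shearPair o) = Q.toList.map (fixPair h o) ++
        (pre.map Prod.fst ++ (post.map (fixFlagged h o)).map Prod.fst) := by
      simp only [hl, List.map_append, List.map_map, shearPair_withBits, shearPair_withFlagBits]
      rw [← Function.comp_assoc, hzero]
      rfl
    have h4 : (OptState.pairs ⟨Q.image (fixPair h o),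
          pre ++ ((a * flaggedFactor h post * pairsFactor h Q, o), false) ::
            post.map (fixFlagged h o)⟩).Perm
        ((a * partnerProd l * bitPow o false, o) :: l.map (shearPair o)) := by
      have hnd := ((List.nodup_cons.mp h2.nodup).2)
      rw [hmap] at hnd
      rw [hfac, hmap]
      simp only [OptState.pairs, OptState.P, List.map_append, List.map_cons]
      refine ((image_toList_perm (List.nodup_append.mp hnd).1).append_right _).trans ?_
      rw [← List.append_assoc, ← List.append_assoc]
      exact List.perm_middle
    exact ⟨h2.perm h4.symm, by rw [pairSpan_perm h4, pairSpan_perm h1, pairSpan_shear],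
      by rw [h4.length_eq, h1.length_eq]; simp⟩
  | case2 Q Ps q o b h hmin hR hq hqo hact =>
    set l : List ((Bool × Bool) × OpPair N) := (Q.erase q).toList.map (withBits h) ++
      (Ps.map Prod.fst).map (fun q => ((false, false), q)) with hl
    have h1 : (OptState.pairs ⟨Q, Ps⟩).Perm (q :: l.map Prod.snd) := by
      simp only [OptState.pairs, OptState.P, hl, List.map_append, List.map_map, hsnd,
        List.map_id]
      exact (erase_toList_perm hq).append_right _
    have h2 : Hyperbolic ((b, o) :: l.map Prod.snd) ∧
        pairSpan (OptState.pairs ⟨Q, Ps⟩) = pairSpan ((b, o) :: l.map Prod.snd) := by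
      rw [pairSpan_perm h1]
      have := hh.perm h1
      rcases hqo with rfl | rfl
      · exact ⟨hyperbolic_swap this, pairSpan_swap _ _ _⟩
      · exact ⟨this, rfl⟩
    have hfac : b * partnerProd l = b * pairsFactor h (Q.erase q) := by
      rw [hl, partnerProd_append, partnerProd_withBits_toList, partnerProd_zeroBits, mul_one]
    have hmap : l.map (shearPair o) = (Q.erase q).toList.map (fixPair h o) ++
        Ps.map Prod.fst := by
      simp only [hl, List.map_append, List.map_map, shearPair_withBits]
      rw [← Function.comp_assoc, hzero]
      rfl
    -- The extra power of `o` is the one that makes the new partner commute with `h`; it produces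
    -- the outer `fixOp` of case 2.
    have h3 := h2.1.shear (decide (Anti h (b * partnerProd l)))
    have h5 := pairSpan_shear b o l (decide (Anti h (b * partnerProd l)))
    rw [mul_bitPow, hfac] at h3 h5
    have h4 : (OptState.pairs ⟨(Q.erase q).image (fixPair h o),
          Ps ++ [((o, fixOp h o (b * pairsFactor h (Q.erase q))), true)]⟩).Perm
        ((o, fixOp h o (b * pairsFactor h (Q.erase q))) :: l.map (shearPair o)) := by
      have hnd := ((List.nodup_cons.mp h3.nodup).2)
      rw [hmap] at hnd ⊢
      simp only [OptState.pairs, OptState.P, List.map_append, List.map_cons, List.map_nil]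
      refine ((image_toList_perm (List.nodup_append.mp hnd).1).append_right _).trans ?_
      rw [← List.append_assoc]
      exact List.perm_append_singleton _ _
    refine ⟨(hyperbolic_swap h3).perm h4.symm, ?_, by rw [h4.length_eq, h1.length_eq]; simp⟩
    rw [pairSpan_perm h4, pairSpan_swap, h5, h2.2]

/-- The operators that are to be protected from errors shrink by a step to a group that commutes
with the error `h` and together with some `o` generates the former ones. A pair that is appended
has the first member `o`. -/
theorem Step.exists_error {S : Set (PauliOp N)} {st st' : OptState N} (hs : Step S st st') :
    ∃ h o, IsMinimalError S st.X h ∧ Anti h o ∧ (∀ x ∈ st'.X, ¬ Anti h x) ∧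
      (∀ x ∈ st'.X, x ∈ Subgroup.closure st.X) ∧
      (∀ x ∈ st.X, x ∈ Subgroup.closure (insert o st'.X)) ∧
      ∀ y, st'.Ps = st.Ps ++ [y] → y.1.1 = o := by
  have hfix : ∀ {H : Subgroup (PauliOp N)} {h o : PauliOp N} {Q : Finset (OpPair N)}, o ∈ H →
      (∀ q ∈ Q, q.1 ∈ H ∧ q.2 ∈ H) → ∀ x ∈ unpack (Q.image (fixPair h o) : Set (OpPair N)),
      x ∈ H := by
    rintro H h o Q ho hQ x ⟨q, hq, hx⟩
    simp only [Finset.coe_image, Set.mem_image, Finset.mem_coe] at hq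
    obtain ⟨p, hp, rfl⟩ := hq
    rcases hx with rfl | rfl
    · exact (fixOp_mem ho).mpr (hQ p hp).1
    · exact (fixOp_mem ho).mpr (hQ p hp).2
  have hfix' : ∀ {H : Subgroup (PauliOp N)} {h o : PauliOp N} {Q : Finset (OpPair N)}, o ∈ H →
      (∀ x ∈ unpack (Q.image (fixPair h o) : Set (OpPair N)), x ∈ H) →
      ∀ q ∈ Q, q.1 ∈ H ∧ q.2 ∈ H := by
    intro H h o Q ho hQ q hq
    have hm : fixPair h o q ∈ ((Q.image (fixPair h o) : Finset _) : Set (OpPair N)) := by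
      rw [Finset.mem_coe]
      exact Finset.mem_image_of_mem _ hq
    exact ⟨(fixOp_mem ho).mp (hQ _ ⟨_, hm, Or.inl rfl⟩), (fixOp_mem ho).mp (hQ _ ⟨_, hm, Or.inr rfl⟩)⟩
  have hcomm : ∀ {h o : PauliOp N} {Q : Finset (OpPair N)}, Anti h o →
      ∀ x ∈ unpack (Q.image (fixPair h o) : Set (OpPair N)), ¬ Anti h x := by
    rintro h o Q ho x ⟨q, hq, hx⟩
    simp only [Finset.coe_image, Set.mem_image, Finset.mem_coe] at hq
    obtain ⟨p, hp, rfl⟩ := hq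
    rcases hx with rfl | rfl <;> exact not_anti_fixOp ho _
  cases hs with
  | case1 Q pre post a o h hQ hmin hact hfirst =>
    refine ⟨h, o, hmin, hact, ?_, ?_, ?_, ?_⟩
    · rintro x (hx | ⟨y, hy, hy2, rfl⟩)
      · exact hcomm hact x hx
      · simp only [List.mem_append, List.mem_cons, List.mem_map] at hy
        rcases hy with hy | rfl | ⟨z, hz, rfl⟩
        -- Flagged pairs before the chosen one are left alone, which is admissible because its index
        -- is the least one on which `h` acts.
        · exact hfirst y hy hy2
        · simp at hy2
        · unfold fixFlagged at hy2 ⊢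
          split_ifs at hy2 ⊢ with hz2
          · exact not_anti_fixOp hact _
          · exact absurd hy2 hz2
    · set H := Subgroup.closure (OptState.X ⟨Q, pre ++ ((a, o), true) :: post⟩)
      have hoH : o ∈ H := Subgroup.subset_closure (Or.inr ⟨((a, o), true), by simp, rfl, rfl⟩)
      have hQH : ∀ q ∈ Q, q.1 ∈ H ∧ q.2 ∈ H := fun q hq =>
        ⟨Subgroup.subset_closure (Or.inl ⟨q, hq, Or.inl rfl⟩),
          Subgroup.subset_closure (Or.inl ⟨q, hq, Or.inr rfl⟩)⟩
      rintro x (hx | ⟨y, hy, hy2, rfl⟩)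
      · exact hfix hoH hQH x hx
      · simp only [List.mem_append, List.mem_cons, List.mem_map] at hy
        rcases hy with hy | rfl | ⟨z, hz, rfl⟩
        · exact Subgroup.subset_closure (Or.inr ⟨y, by simp [hy], hy2, rfl⟩)
        · simp at hy2
        · unfold fixFlagged at hy2 ⊢
          split_ifs at hy2 ⊢ with hz2
          · exact (fixOp_mem hoH).mpr
              (Subgroup.subset_closure (Or.inr ⟨z, by simp [hz], hz2, rfl⟩))
          · exact absurd hy2 hz2
    · set X' := OptState.X ⟨Q.image (fixPair h o),
          pre ++ ((a * flaggedFactor h post * pairsFactor h Q, o), false) ::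
            post.map (fixFlagged h o)⟩ with hX'
      set H := Subgroup.closure (insert o X')
      have hoH : o ∈ H := Subgroup.subset_closure (Set.mem_insert _ _)
      have hXH : ∀ x ∈ X', x ∈ H := fun x hx => Subgroup.subset_closure (Set.mem_insert_of_mem _ hx)
      have hQH := hfix' hoH fun x hx => hXH x (Or.inl hx)
      rintro x (⟨q, hq, rfl | rfl⟩ | ⟨y, hy, hy2, rfl⟩)
      · exact (hQH q hq).1
      · exact (hQH q hq).2
      · simp only [List.mem_append, List.mem_cons] at hy
        rcases hy with hy | rfl | hy
        · exact hXH _ (Or.inr ⟨y, by simp [hy], hy2, rfl⟩)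
        · exact hoH
        · have : fixOp h o y.1.2 ∈ X' := Or.inr ⟨fixFlagged h o y, by
            simp only [List.mem_append, List.mem_cons, List.mem_map]
            exact Or.inr (Or.inr ⟨y, hy, rfl⟩), by simp [fixFlagged, hy2], by simp [fixFlagged, hy2]⟩
          exact (fixOp_mem hoH).mp (hXH _ this)
    · intro y hy
      simpa using congrArg List.length hy
  | case2 Q Ps q o b h hmin hR hq hqo hact =>
    refine ⟨h, o, hmin, hact, ?_, ?_, ?_, ?_⟩
    · rintro x (hx | ⟨y, hy, hy2, rfl⟩)
      · exact hcomm hact x hx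
      · simp only [List.mem_append, List.mem_singleton] at hy
        rcases hy with hy | rfl
        · exact hR _ ⟨y, hy, hy2, rfl⟩
        · exact not_anti_fixOp hact _
    · set H := Subgroup.closure (OptState.X ⟨Q, Ps⟩)
      have hQH : ∀ q ∈ Q, q.1 ∈ H ∧ q.2 ∈ H := fun q hq =>
        ⟨Subgroup.subset_closure (Or.inl ⟨q, hq, Or.inl rfl⟩),
          Subgroup.subset_closure (Or.inl ⟨q, hq, Or.inr rfl⟩)⟩
      have hob : o ∈ H ∧ b ∈ H := by
        rcases hqo with rfl | rfl
        · exact hQH _ hq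
        · exact (hQH _ hq).symm
      have hQ0 : ∀ p ∈ Q.erase q, p.1 ∈ H ∧ p.2 ∈ H := fun p hp => hQH p (Finset.mem_of_mem_erase hp)
      rintro x (hx | ⟨y, hy, hy2, rfl⟩)
      · exact hfix hob.1 hQ0 x hx
      · simp only [List.mem_append, List.mem_singleton] at hy
        rcases hy with hy | rfl
        · exact Subgroup.subset_closure (Or.inr ⟨y, hy, hy2, rfl⟩)
        · exact (fixOp_mem hob.1).mpr (mul_mem hob.2 (pairsFactor_mem hQ0))
    · set X' := OptState.X ⟨(Q.erase q).image (fixPair h o),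
          Ps ++ [((o, fixOp h o (b * pairsFactor h (Q.erase q))), true)]⟩ with hX'
      set H := Subgroup.closure (insert o X')
      have hoH : o ∈ H := Subgroup.subset_closure (Set.mem_insert _ _)
      have hXH : ∀ x ∈ X', x ∈ H := fun x hx => Subgroup.subset_closure (Set.mem_insert_of_mem _ hx)
      have hQH := hfix' hoH fun x hx => hXH x (Or.inl hx)
      have hbH : b ∈ H := by
        have h1 : fixOp h o (b * pairsFactor h (Q.erase q)) ∈ X' :=
          Or.inr ⟨((o, fixOp h o (b * pairsFactor h (Q.erase q))), true), by simp, rfl, rfl⟩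
        exact (H.mul_mem_cancel_right (pairsFactor_mem hQH)).mp ((fixOp_mem hoH).mp (hXH _ h1))
      rintro x (⟨p, hp, hx⟩ | ⟨y, hy, hy2, rfl⟩)
      · by_cases hpq : p = q
        · subst hpq
          rcases hqo with rfl | rfl <;> rcases hx with rfl | rfl <;> assumption
        · have := hQH p (Finset.mem_erase.mpr ⟨hpq, hp⟩)
          rcases hx with rfl | rfl
          · exact this.1
          · exact this.2
      · exact hXH _ (Or.inr ⟨y, by simp only [List.mem_append]; exact Or.inl hy, hy2, rfl⟩)
    · intro y hy
      rw [List.append_cancel_left_eq, List.singleton_inj] at hy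
      rw [← hy]

/-- Twice the number of pairs in `Q` plus the number of bits `1`. -/
def OptState.size (st : OptState N) : ℕ := 2 * st.Q.card + st.Ps.countP fun y => y.2

/-- Case 2 trades a pending pair for a bit 1 and case 1 clears a bit, hence the factor 2 in front of
the number of pending pairs. -/
theorem Step.size_lt {S : Set (PauliOp N)} {st st' : OptState N} (hs : Step S st st') :
    st'.size < st.size := by
  cases hs with
  | case1 Q pre post a o h hQ hmin hact hfirst =>
    have h1 : (post.map (fixFlagged h o)).countP (fun y => y.2) = post.countP fun y => y.2 := by
      rw [List.countP_map]
      congr 1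
      funext y
      simp only [Function.comp, fixFlagged]
      split_ifs <;> simp_all
    have h2 : (Q.image (fixPair h o)).card ≤ Q.card := Finset.card_image_le
    simp only [OptState.size, List.countP_append, List.countP_cons, h1]
    simp
    omega
  | case2 Q Ps q o b h hmin hR hq hqo hact =>
    have h2 : ((Q.erase q).image (fixPair h o)).card ≤ (Q.erase q).card := Finset.card_image_le
    have h3 := Finset.card_erase_add_one hq
    simp only [OptState.size, List.countP_append, List.countP_cons]
    simp
    omega

end Steps

/-! ### Optimality -/

section Optimality

variable {N : ℕ}

/-! ### Minimal weights of errors. -/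

theorem omega_le {S : Set (PauliOp N)} {l e : PauliOp N} (h : IsUndetectableError S l e) :
    omega S l ≤ weight e :=
  Nat.sInf_le ⟨e, h, rfl⟩

theorem exists_weight_eq_omega {S : Set (PauliOp N)} {l e : PauliOp N}
    (h : IsUndetectableError S l e) : ∃ e', IsUndetectableError S l e' ∧ weight e' = omega S l :=
  Nat.sInf_mem (s := weight '' {e | IsUndetectableError S l e}) ⟨_, e, h, rfl⟩

/-- An error must be exhibited, since `sInf ∅ = 0` makes `omega` vanish where no error acts. -/
theorem le_omega {S : Set (PauliOp N)} {l e : PauliOp N} {n : ℕ}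
    (h : IsUndetectableError S l e) (hn : ∀ e', IsUndetectableError S l e' → n ≤ weight e') :
    n ≤ omega S l := by
  obtain ⟨e', he', hw⟩ := exists_weight_eq_omega h
  exact hw ▸ hn e' he'

/-- An error that acts on an operator generated by `X` acts on a member of `X`. -/
theorem IsMinimalError.weight_le {S X : Set (PauliOp N)} {h e v : PauliOp N}
    (hm : IsMinimalError S X h) (hv : v ∈ Subgroup.closure X) (he : IsUndetectableError S v e) :
    weight h ≤ weight e := by
  obtain ⟨x, hx, hex⟩ := exists_anti_of_anti_closure hv he.2
  exact hm.2 e ⟨x, hx, he.1, hex⟩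

theorem hyperbolic_of_conjugal {X : Set (PauliOp N)} {l : List (OpPair N)}
    (hl : l.Pairwise SharesNoOp) (hX : ∀ q ∈ l, q.1 ∈ X ∧ q.2 ∈ X)
    (hc : ∀ q ∈ l, IsConjugalPair X q) : Hyperbolic l := by
  refine ⟨fun q hq => ((hc q hq _ (hX q hq).2).1).mpr rfl, hl.imp_of_mem ?_⟩
  intro q r hq hr hs
  obtain ⟨h1, h2⟩ := hX r hr
  obtain ⟨s1, s2, s3, s4⟩ := hs
  refine ⟨?_, ?_, ?_, ?_⟩
  · rw [(hc q hq _ h1).1]; exact s3.symm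
  · rw [(hc q hq _ h2).1]; exact s4.symm
  · rw [(hc q hq _ h1).2]; exact s1.symm
  · rw [(hc q hq _ h2).2]; exact s2.symm

theorem IsChoice.hyperbolic {S : Set (PauliOp N)} {P : List (OpPair N)} (h : IsChoice S P) :
    Hyperbolic P :=
  hyperbolic_of_conjugal h.noShared
    (fun q hq => ⟨Or.inr ⟨q, hq, Or.inl rfl⟩, Or.inr ⟨q, hq, Or.inr rfl⟩⟩) h.conjugal

/-- Beyond the commutation relations, conjugality asks that no operator which commutes with both
members be one of them; this holds because each member anti-commutes with its partner. -/
theorem Hyperbolic.isConjugalPair {S : Set (PauliOp N)} {l : List (OpPair N)}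
    (hl : Hyperbolic l) (hS : ∀ q ∈ l, q.1 ∈ centralizer S ∧ q.2 ∈ centralizer S)
    {q : OpPair N} (hq : q ∈ l) : IsConjugalPair (S ∪ unpack {q | q ∈ l}) q := by
  have hqq := hl.1 q hq
  rintro x (hx | ⟨r, hr, hx⟩)
  · have h1 := (hS q hq).1 x hx
    have h2 := (hS q hq).2 x hx
    refine ⟨iff_of_false h1 ?_, iff_of_false h2 ?_⟩
    · rintro rfl
      exact h1 hqq
    · rintro rfl
      exact h2 hqq.symm
  · by_cases hqr : q = r
    · subst hqr
      have hne : q.1 ≠ q.2 := fun h => by rw [h] at hqq; exact not_anti_self _ hqq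
      rcases hx with rfl | rfl
      · simp [hne, hqq.symm]
      · simp [hne.symm, hqq]
    · have : Std.Symm (PairsCommute (N := N)) := ⟨fun _ _ => PairsCommute.symm⟩
      obtain ⟨c1, c2, c3, c4⟩ := hl.2.forall hq hr hqr
      have hrr := hl.1 r hr
      have key : ¬ Anti q.1 x ∧ ¬ Anti q.2 x := by rcases hx with rfl | rfl <;> tauto
      refine ⟨iff_of_false key.1 ?_, iff_of_false key.2 ?_⟩
      · rintro rfl
        exact key.1 hqq
      · rintro rfl
        exact key.2 hqq.symm

theorem Hyperbolic.length_eq {l l' : List (OpPair N)} (hl : Hyperbolic l) (hl' : Hyperbolic l')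
    (h : pairSpan l = pairSpan l') : l.length = l'.length := by
  have key : ∀ {l l' : List (OpPair N)}, Hyperbolic l → pairSpan l = pairSpan l' →
      l.length ≤ l'.length := by
    intro l l' hl h
    refine hl.length_le (R := ∅) (by simp) fun q hq => ?_
    rw [Set.union_empty]
    change _ ∈ pairSpan l' ∧ _ ∈ pairSpan l'
    rw [← h]
    exact mem_pairSpan hq
  exact le_antisymm (key hl h) (key hl' h.symm)

/-- What holds at the triple `st` of an optimization sequence for `(S, L)`; the entries of `E` are
the pairs of `P` with their bits and with the errors that acted when these pairs were appended. -/
structure OptInvariant (S : Set (PauliOp N)) (L : Finset (OpPair N)) (st : OptState N)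
    (E : List ((OpPair N × Bool) × PauliOp N)) : Prop where
  entries : st.Ps = E.map Prod.fst
  hyperbolic : Hyperbolic st.pairs
  span : pairSpan st.pairs = pairSpan L.toList
  length : st.pairs.length = L.card
  error : ∀ x ∈ E, IsUndetectableError S x.1.1.1 x.2
  minimal : ∀ x ∈ E, ∀ e, IsUndetectableError S x.1.1.1 e ∨ IsUndetectableError S x.1.1.2 e →
    weight x.2 ≤ weight e
  later : ∀ x ∈ E, ∀ e, (∃ y ∈ st.X, IsUndetectableError S y e) → weight x.2 ≤ weight e
  -- With the second half of `ordered`, this says that a remembered error commutes with all factors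
  -- which case 1 may multiply onto the first member.
  commutes : ∀ x ∈ E, x.1.2 = true → ∀ y ∈ st.X, ¬ Anti x.2 y
  ordered : E.Pairwise fun x y =>
    weight x.2 ≤ weight y.2 ∧ (x.1.2 = true → y.1.2 = true → ¬ Anti x.2 y.1.1.1)
  -- Whatever is untouched by all errors up to the weight of an error acting on `X` has not been
  -- lost from the group of `X`. This is the input to the counting argument for `bound`.
  complete : ∀ e, (∃ y ∈ st.X, IsUndetectableError S y e) → ∀ v ∈ pairSpan L.toList,
    (∀ e' ∈ centralizer S, weight e' ≤ weight e → ¬ Anti e' v) → v ∈ Subgroup.closure st.X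
  bound : ∀ P' : List (OpPair N), IsChoice S P' → pairSpan P' = pairSpan L.toList → ∀ (i : ℕ) q h, P'[i]? = some q →
    (E.map Prod.snd)[i]? = some h → pairDist S q ≤ weight h

theorem optInvariant_start {S : Set (PauliOp N)} {L : Finset (OpPair N)}
    (hL : Hyperbolic L.toList) : OptInvariant S L ⟨L, []⟩ [] where
  entries := rfl
  hyperbolic := by simpa [OptState.pairs, OptState.P] using hL
  span := by simp [OptState.pairs, OptState.P]
  length := by simp [OptState.pairs, OptState.P]
  error := by simp
  minimal := by simp
  later := by simp
  commutes := by simp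
  ordered := List.Pairwise.nil
  complete := fun _ _ v hv _ => by
    refine Subgroup.closure_mono ?_ hv
    rintro x ⟨q, hq, hx⟩
    exact Or.inl ⟨q, by simpa using hq, hx⟩
  bound := by simp

/-- The hyperbolic pairs that commute with the errors of weight at most that of `h` lie in the
group generated by `Q` and `R` after the step that `h` causes. -/
theorem OptInvariant.pairDist_le {S : Set (PauliOp N)} {L : Finset (OpPair N)}
    {st st' : OptState N} {E : List ((OpPair N × Bool) × PauliOp N)} {h o : PauliOp N}
    (hI : OptInvariant S L st E) (hs : Step S st st') (hL : Hyperbolic L.toList)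
    (hmin : IsMinimalError S st.X h) (hact : Anti h o) (hX' : ∀ x ∈ st'.X, ¬ Anti h x)
    (hX : ∀ x ∈ st.X, x ∈ Subgroup.closure (insert o st'.X))
    (hlen : st'.Ps.length = st.Ps.length + 1) {P' : List (OpPair N)} (hP' : IsChoice S P')
    (hspan : pairSpan P' = pairSpan L.toList) {q : OpPair N} (hq : P'[st.Ps.length]? = some q) :
    pairDist S q ≤ weight h := by
  by_contra! hlt
  obtain ⟨hi, rfl⟩ := List.getElem?_eq_some_iff.mp hq
  obtain ⟨h1, -, h3⟩ := hs.pairs_hyperbolic hI.hyperbolic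
  have hcard : st'.Q.card + st'.Ps.length = P'.length := by
    rw [hP'.hyperbolic.length_eq hL hspan, Finset.length_toList, ← hI.length, ← h3]
    simp [OptState.pairs, OptState.P]
  -- The pairs of `P'` from this index on lie in the group generated by `Q` and `R` after the step,
  -- and `R` is isotropic and commutes with `Q`.
  have hle : (P'.drop st.Ps.length).length ≤ st'.Q.toList.length := by
    refine (hP'.hyperbolic.sublist (List.drop_sublist _ _)).length_le (R := st'.R) ?_ ?_
    · rintro r ⟨y, hy, -, rfl⟩
      have hyP : y.1 ∈ st'.P := List.mem_map_of_mem hy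
      refine ⟨?_, fun p hp => ?_⟩
      · rintro r' ⟨z, hz, -, rfl⟩
        exact h1.not_anti_snd (List.mem_append_right _ hyP)
          (List.mem_append_right _ (List.mem_map_of_mem hz))
      · have := (List.pairwise_append.mp h1.2).2.2 p hp _ hyP
        exact ⟨mt anti_comm.mp this.2.1, mt anti_comm.mp this.2.2.2⟩
    · intro p hp
      have hp' : p ∈ P' := List.mem_of_mem_drop hp
      have hge : pairDist S P'[st.Ps.length] ≤ pairDist S p := by
        have hs := hP'.sorted
        rw [distances, List.pairwise_map] at hs
        rw [List.drop_eq_getElem_cons hi, List.mem_cons] at hp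
        rcases hp with rfl | hp
        · exact le_rfl
        · have := hs.sublist (List.drop_sublist st.Ps.length _)
          rw [List.drop_eq_getElem_cons hi, List.pairwise_cons] at this
          exact this.1 p hp
      -- A member of these pairs has no error of weight up to that of `h`. It is therefore in the
      -- group of `st.X` by `complete`, and it does not need `o` since it commutes with `h`.
      have hv : ∀ v ∈ pairSpan P', pairDist S p ≤ omega S v →
          v ∈ Subgroup.closure (unpack {q | q ∈ st'.Q.toList} ∪ st'.R) := by
        intro v hv hpv
        have hcomm : ∀ e' ∈ centralizer S, weight e' ≤ weight h → ¬ Anti e' v := by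
          intro e' he' hw ha
          have := omega_le ⟨he', ha⟩
          omega
        have h4 := hI.complete h hmin.1 v (hspan ▸ hv) hcomm
        have h5 : v ∈ Subgroup.closure (insert o st'.X) :=
          (Subgroup.closure_le _).mpr (fun x hx => hX x hx) h4
        have h6 := mem_closure_of_mem_closure_insert hX' hact h5
          (hcomm h (hmin.1.elim fun _ h => h.2.1) le_rfl)
        simpa [OptState.X] using h6
      exact ⟨hv _ (mem_pairSpan hp').1 (min_le_left _ _), hv _ (mem_pairSpan hp').2 (min_le_right _ _)⟩
  -- The step has appended a pair, so `|Q'| = |P'| - |P| - 1`, one less than the number of remaining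
  -- pairs of `P'`.
  rw [List.length_drop, Finset.length_toList] at hle
  omega

/-- The protected group only shrinks, so `later` and `commutes` persist for old entries. Case 1
alters pairs but not the remembered errors, hence keeps `bound`; case 2 adds the error `h` and one
new instance of `bound`. -/
theorem OptInvariant.step {S : Set (PauliOp N)} {L : Finset (OpPair N)}
    {st st' : OptState N} {E : List ((OpPair N × Bool) × PauliOp N)}
    (hI : OptInvariant S L st E) (hs : Step S st st') (hL : Hyperbolic L.toList) :
    ∃ E', OptInvariant S L st' E' := by
  obtain ⟨h1, h2, h3⟩ := hs.pairs_hyperbolic hI.hyperbolic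
  obtain ⟨h, o, hmin, hact, hX', hsub, hX, ho⟩ := hs.exists_error
  have hacts : ∀ e, (∃ y ∈ st'.X, IsUndetectableError S y e) →
      ∃ y ∈ st.X, IsUndetectableError S y e := by
    rintro e ⟨y, hy, hey⟩
    obtain ⟨x, hx, hex⟩ := exists_anti_of_anti_closure (hsub y hy) hey.2
    exact ⟨x, hx, hey.1, hex⟩
  have hcl : ∀ {v e}, v ∈ Subgroup.closure st.X → IsUndetectableError S v e →
      ∃ y ∈ st.X, IsUndetectableError S y e := by
    intro v e hv he
    obtain ⟨x, hx, hex⟩ := exists_anti_of_anti_closure hv he.2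
    exact ⟨x, hx, he.1, hex⟩
  -- Such an `e` already acted on the former operators, so `h` is at most as heavy and is among the
  -- errors that `v` commutes with; therefore `o` can be dropped.
  have hcomp : ∀ e, (∃ y ∈ st'.X, IsUndetectableError S y e) → ∀ v ∈ pairSpan L.toList,
      (∀ e' ∈ centralizer S, weight e' ≤ weight e → ¬ Anti e' v) →
        v ∈ Subgroup.closure st'.X := by
    intro e he v hv hcomm
    have h4 := hI.complete e (hacts e he) v hv hcomm
    exact mem_closure_of_mem_closure_insert hX' hact
      ((Subgroup.closure_le _).mpr (fun x hx => hX x hx) h4)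
      (hcomm h (hmin.1.elim fun _ h => h.2.1) (hmin.2 e (hacts e he)))
  have hlater : ∀ x ∈ E, ∀ e, (∃ y ∈ st'.X, IsUndetectableError S y e) → weight x.2 ≤ weight e :=
    fun x hx e he => hI.later x hx e (hacts e he)
  have hcommX : ∀ x ∈ E, x.1.2 = true → ∀ v ∈ Subgroup.closure st.X, ¬ Anti x.2 v := by
    intro x hx hx2 v hv ha
    obtain ⟨y, hy, hay⟩ := exists_anti_of_anti_closure hv ha
    exact hI.commutes x hx hx2 y hy hay
  have hbound := hI.bound
  cases hs' : hs with
  | case1 Q pre post a o' h' hQ hmin' hact' hfirst =>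
    obtain ⟨Epre, Erest, rfl, rfl, hE⟩ := List.map_eq_append_iff.mp hI.entries.symm
    obtain ⟨⟨y, hk⟩, Epost, rfl, hy, rfl⟩ := List.map_eq_cons_iff.mp hE
    dsimp only at hy
    subst hy
    set f : (OpPair N × Bool) × PauliOp N → (OpPair N × Bool) × PauliOp N :=
      fun x => (fixFlagged h' o' x.1, x.2) with hf
    set T := Subgroup.closure (OptState.X ⟨Q, Epre.map Prod.fst ++ ((a, o'), true) ::
      Epost.map Prod.fst⟩) with hT
    have hoT : o' ∈ T := Subgroup.subset_closure (Or.inr ⟨((a, o'), true), by simp, rfl, rfl⟩)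
    have hβ : pairsFactor h' Q ∈ T := pairsFactor_mem fun q hq =>
      ⟨Subgroup.subset_closure (Or.inl ⟨q, hq, Or.inl rfl⟩),
        Subgroup.subset_closure (Or.inl ⟨q, hq, Or.inr rfl⟩)⟩
    have hff : ∀ x, (f x).2 = x.2 ∧ (f x).1.2 = x.1.2 ∧ (f x).1.1.1 = x.1.1.1 ∧
        (f x).1.1.2 = fixOp h' o' x.1.1.2 ∨ f x = x := by
      intro x
      simp only [f, fixFlagged]
      split_ifs with hx
      · simp
      · exact Or.inr rfl
    have hf' : ∀ x, (f x).2 = x.2 ∧ (f x).1.2 = x.1.2 ∧ (f x).1.1.1 = x.1.1.1 := by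
      intro x
      rcases hff x with h | h
      · exact ⟨h.1, h.2.1, h.2.2.1⟩
      · rw [h]; simp
    -- An error on the modified first member acts on at least one of its three factors.
    have hfactor : ∀ e, IsUndetectableError S (a * flaggedFactor h' (Epost.map Prod.fst) *
        pairsFactor h' Q) e → IsUndetectableError S a e ∨
          (∃ x ∈ Epost, x.1.2 = true ∧ IsUndetectableError S x.1.1.1 e) ∨
          IsUndetectableError S (pairsFactor h' Q) e := by
      rintro e ⟨heS, hea⟩
      by_contra! hcon
      obtain ⟨c1, c2, c3⟩ := hcon
      have c1' : ¬ Anti e a := fun h => c1 ⟨heS, h⟩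
      have c3' : ¬ Anti e (pairsFactor h' Q) := fun h => c3 ⟨heS, h⟩
      have c2' : flaggedFactor h' (Epost.map Prod.fst) ∈ commutant {e} := by
        refine flaggedFactor_mem fun y hy hy2 => ?_
        obtain ⟨x, hx, rfl⟩ := List.mem_map.mp hy
        rintro _ rfl ha
        exact c2 x hx hy2 ⟨heS, ha.symm⟩
      have c2'' := mt anti_comm.mp (c2' e rfl)
      rw [anti_mul_right, anti_mul_right] at hea
      tauto
    have hord := hI.ordered
    rw [List.pairwise_append, List.pairwise_cons] at hord
    obtain ⟨o1, ⟨o2, o3⟩, o4⟩ := hord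
    have hsnd : (Epre ++ (((a * flaggedFactor h' (Epost.map Prod.fst) * pairsFactor h' Q, o'),
        false), hk) :: Epost.map f).map Prod.snd =
          (Epre ++ (((a, o'), true), hk) :: Epost).map Prod.snd := by
      simp [f, Function.comp_def]
    have hkmem : (((a, o'), true), hk) ∈ Epre ++ (((a, o'), true), hk) :: Epost := by simp
    have hpostmem : ∀ x ∈ Epost, x ∈ Epre ++ (((a, o'), true), hk) :: Epost := by
      intro x hx; simp [hx]
    have hpremem : ∀ x ∈ Epre, x ∈ Epre ++ (((a, o'), true), hk) :: Epost := by
      intro x hx; simp [hx]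
    refine ⟨Epre ++ (((a * flaggedFactor h' (Epost.map Prod.fst) * pairsFactor h' Q, o'), false),
      hk) :: Epost.map f, ?_, h1, h2.trans hI.span, h3.trans hI.length, ?_, ?_, ?_, ?_, ?_, hcomp,
      ?_⟩
    · simp [f, Function.comp_def]
    · intro x hx
      simp only [List.mem_append, List.mem_cons, List.mem_map] at hx
      rcases hx with hx | rfl | ⟨z, hz, rfl⟩
      · exact hI.error x (hpremem x hx)
      · refine ⟨(hI.error _ hkmem).1, ?_⟩
        -- The remembered error acts on `a` and commutes with both new factors, by `commutes` and
        -- the second half of `ordered`, so it acts on the product.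
        have e1 : Anti hk a := (hI.error _ hkmem).2
        have e3 : ¬ Anti hk (pairsFactor h' Q) := hcommX _ hkmem rfl _ hβ
        have e2 : flaggedFactor h' (Epost.map Prod.fst) ∈ commutant {hk} := by
          refine flaggedFactor_mem fun y hy hy2 => ?_
          obtain ⟨x, hx, rfl⟩ := List.mem_map.mp hy
          rintro _ rfl ha
          exact (o2 x hx).2 rfl hy2 ha.symm
        have e2' := mt anti_comm.mp (e2 hk rfl)
        simp only
        rw [anti_mul_right, anti_mul_right]
        tauto
      · have := hI.error z (hpostmem z hz)
        rwa [(hf' z).1, (hf' z).2.2]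
    · intro x hx e he
      simp only [List.mem_append, List.mem_cons, List.mem_map] at hx
      rcases hx with hx | rfl | ⟨z, hz, rfl⟩
      · exact hI.minimal x (hpremem x hx) e he
      · rcases he with he | he
        -- Each factor has its own lower bound: the old entry, the entry of a later pair with a
        -- remembered weight at least as large, or `later` for a product of pending operators.
        · rcases hfactor e he with he | ⟨x, hx, hx2, he⟩ | he
          · exact hI.minimal _ hkmem e (Or.inl he)
          · exact (o2 x hx).1.trans (hI.minimal x (hpostmem x hx) e (Or.inl he))
          · exact hI.later _ hkmem e (hcl hβ he)
        · exact hI.minimal _ hkmem e (Or.inr he)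
      · rcases hff z with ⟨z1, z2, z3, z4⟩ | hz'
        · rw [z1]
          rw [z3, z4] at he
          rcases he with he | he
          · exact hI.minimal z (hpostmem z hz) e (Or.inl he)
          -- An error that acts on the corrected second member but not on the old one acts on `o'`,
          -- which was protected, so `later` applies.
          · by_cases hb : Anti e z.1.1.2
            · exact hI.minimal z (hpostmem z hz) e (Or.inr ⟨he.1, hb⟩)
            · refine hI.later z (hpostmem z hz) e (hcl hoT ⟨he.1, ?_⟩)
              have := he.2
              unfold fixOp at this
              split_ifs at this
              · rw [anti_mul_right] at this
                tauto
              · exact absurd this hb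
        · rw [hz'] at he ⊢
          exact hI.minimal z (hpostmem z hz) e he
    · intro x hx
      simp only [List.mem_append, List.mem_cons, List.mem_map] at hx
      rcases hx with hx | rfl | ⟨z, hz, rfl⟩
      · exact hlater x (hpremem x hx)
      · exact hlater (((a, o'), true), hk) hkmem
      · rw [(hf' z).1]
        exact hlater z (hpostmem z hz)
    · intro x hx hx2 y hy
      simp only [List.mem_append, List.mem_cons, List.mem_map] at hx
      rcases hx with hx | rfl | ⟨z, hz, rfl⟩
      · exact hcommX x (hpremem x hx) hx2 y (hsub y hy)
      · simp at hx2
      · rw [(hf' z).2.1] at hx2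
        rw [(hf' z).1]
        exact hcommX z (hpostmem z hz) hx2 y (hsub y hy)
    · rw [List.pairwise_append, List.pairwise_cons]
      refine ⟨o1, ⟨?_, ?_⟩, ?_⟩
      · intro y hy
        obtain ⟨z, hz, rfl⟩ := List.mem_map.mp hy
        rw [(hf' z).1]
        exact ⟨(o2 z hz).1, by simp⟩
      · rw [List.pairwise_map]
        refine o3.imp fun {x y} hxy => ?_
        rwa [(hf' x).1, (hf' x).2.1, (hf' y).1, (hf' y).2.1, (hf' y).2.2]
      · intro x hx y hy
        rcases List.mem_cons.mp hy with rfl | hy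
        · exact ⟨(o4 x hx _ List.mem_cons_self).1, by simp⟩
        · obtain ⟨z, hz, rfl⟩ := List.mem_map.mp hy
          rw [(hf' z).1, (hf' z).2.1, (hf' z).2.2]
          exact o4 x hx z (List.mem_cons_of_mem _ hz)
    · intro P' hP' hsp i q g hi hg
      rw [hsnd] at hg
      exact hbound P' hP' hsp i q g hi hg
  | case2 Q Ps q o' b h' hmin' hR hq hqo hact' =>
    -- The entry remembers the error `h` supplied by `Step.exists_error`; it remains to identify its
    -- `o` with the first member just appended.
    obtain rfl : o' = o := ho _ rfl
    have hPs : Ps = E.map Prod.fst := hI.entries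
    set b' := fixOp h' o' (b * pairsFactor h' (Q.erase q)) with hb'
    have ho1 : o' ∈ OptState.X ⟨Q, Ps⟩ := by
      rcases hqo with rfl | rfl
      · exact Or.inl ⟨_, hq, Or.inl rfl⟩
      · exact Or.inl ⟨_, hq, Or.inr rfl⟩
    have hb1 : b' ∈ Subgroup.closure (OptState.X ⟨Q, Ps⟩) :=
      hsub b' (Or.inr ⟨((o', b'), true), by simp, rfl, rfl⟩)
    refine ⟨E ++ [(((o', b'), true), h)], ?_, h1, h2.trans hI.span, h3.trans hI.length,
      ?_, ?_, ?_, ?_, ?_, hcomp, ?_⟩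
    · simp [hPs]
    · intro x hx
      rcases List.mem_append.mp hx with hx | hx
      · exact hI.error x hx
      · rw [List.mem_singleton.mp hx]
        exact ⟨hmin.1.elim fun _ h => h.2.1, hact⟩
    · intro x hx e he
      rcases List.mem_append.mp hx with hx | hx
      · exact hI.minimal x hx e he
      · rw [List.mem_singleton.mp hx] at he ⊢
        rcases he with he | he
        · exact hmin.weight_le (Subgroup.subset_closure ho1) he
        · exact hmin.weight_le hb1 he
    · intro x hx e he
      rcases List.mem_append.mp hx with hx | hx
      · exact hlater x hx e he
      · rw [List.mem_singleton.mp hx]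
        exact hmin.2 e (hacts e he)
    · intro x hx hx2 y hy
      rcases List.mem_append.mp hx with hx | hx
      · exact hcommX x hx hx2 y (hsub y hy)
      · rw [List.mem_singleton.mp hx]
        exact hX' y hy
    · rw [List.pairwise_append]
      refine ⟨hI.ordered, List.pairwise_singleton _ _, fun x hx y hy => ?_⟩
      rw [List.mem_singleton.mp hy]
      -- Monotonicity of the weights is `later` of the old entry applied to the new error.
      exact ⟨hI.later x hx h hmin.1, fun hx2 _ => hI.commutes x hx hx2 o' ho1⟩
    · intro P' hP' hsp i p g hi hg
      rw [List.map_append, List.map_singleton] at hg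
      rcases lt_or_ge i E.length with hiE | hiE
      · rw [List.getElem?_append_left (by simpa using hiE)] at hg
        exact hbound P' hP' hsp i p g hi hg
      · rw [List.getElem?_append_right (by simpa using hiE), List.getElem?_singleton,
          List.length_map] at hg
        split_ifs at hg with hi0
        obtain rfl := Option.some.inj hg
        have hiP : i = (OptState.Ps ⟨Q, Ps⟩).length := by
          simp only [hPs, List.length_map]
          omega
        subst hiP
        exact hI.pairDist_le hs hL hmin hact hX' hX (by simp) hP' hsp hi

/-- The remembered error attains the minimum on the first member, and `minimal` covers the second
one. So the order of the members in the pair is also the required one. -/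
theorem OptInvariant.pairDist_eq {S : Set (PauliOp N)} {L : Finset (OpPair N)}
    {st : OptState N} {E : List ((OpPair N × Bool) × PauliOp N)} (hI : OptInvariant S L st E)
    (hS : ∀ q ∈ st.P, q.1 ∈ centralizer S ∧ q.2 ∈ centralizer S)
    {x : (OpPair N × Bool) × PauliOp N} (hx : x ∈ E) :
    omega S x.1.1.1 = weight x.2 ∧ pairDist S x.1.1 = weight x.2 := by
  have hxP : x.1.1 ∈ st.P := by
    rw [OptState.P, hI.entries, List.map_map]
    exact List.mem_map_of_mem hx
  have h1 : omega S x.1.1.1 = weight x.2 :=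
    le_antisymm (omega_le (hI.error x hx))
      (le_omega (hI.error x hx) fun e he => hI.minimal x hx e (Or.inl he))
  refine ⟨h1, ?_⟩
  have h2 : weight x.2 ≤ omega S x.1.1.2 :=
    le_omega ⟨(hS _ hxP).1, hI.hyperbolic.1 _ (List.mem_append_right _ hxP)⟩
      fun e he => hI.minimal x hx e (Or.inr he)
  rw [pairDist, h1]
  exact min_eq_left h2

/-- With `Q` empty all pairs are in `P`. The remembered weights are then the distances, `ordered`
sorts them and `bound` compares them with those of any competitor. -/
theorem OptInvariant.optimal {S : Set (PauliOp N)} {L : Finset (OpPair N)}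
    {st : OptState N} {E : List ((OpPair N × Bool) × PauliOp N)} (hI : OptInvariant S L st E)
    (hLS : ∀ v ∈ pairSpan L.toList, v ∈ centralizer S) (hQ : st.Q = ∅) :
    IsOptimalChoice S st.P ∧ pairSpan st.P = pairSpan L.toList := by
  have hpairs : st.pairs = st.P := by simp [OptState.pairs, hQ]
  have hspan := hI.span
  have hhyp := hI.hyperbolic
  rw [hpairs] at hspan hhyp
  have hS : ∀ q ∈ st.P, q.1 ∈ centralizer S ∧ q.2 ∈ centralizer S := fun q hq =>
    ⟨hLS _ (hspan ▸ (mem_pairSpan hq).1), hLS _ (hspan ▸ (mem_pairSpan hq).2)⟩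
  have hP : st.P = E.map fun x => x.1.1 := by
    rw [OptState.P, hI.entries, List.map_map]
    rfl
  have hdist : distances S st.P = E.map fun x => weight x.2 := by
    rw [distances, hP, List.map_map]
    exact List.map_congr_left fun x hx => (hI.pairDist_eq hS hx).2
  refine ⟨⟨⟨hhyp.pairwise_ne, ?_, fun q hq => hhyp.isConjugalPair hS hq, ?_, ?_⟩, ?_⟩, hspan⟩
  · rintro x ⟨q, hq, rfl | rfl⟩
    · exact (hS q hq).1
    · exact (hS q hq).2
  · intro q hq
    rw [hP] at hq
    obtain ⟨x, hx, rfl⟩ := List.mem_map.mp hq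
    obtain ⟨h1, h2⟩ := hI.pairDist_eq hS hx
    rw [h1, h2]
  · rw [hdist, List.pairwise_map]
    exact hI.ordered.imp fun h => h.1
  · intro P' hP' hgen
    have hsp : pairSpan P' = pairSpan st.P := SetLike.coe_injective hgen
    have hlen := hP'.hyperbolic.length_eq hhyp hsp
    rw [List.forall₂_iff_get]
    refine ⟨by simpa [distances] using hlen, fun i h1 h2 => ?_⟩
    have hi' : i < P'.length := by simpa [distances] using h1
    have hiE : i < E.length := by simpa [hdist] using h2
    have := hI.bound P' hP' (hsp.trans hspan) i P'[i] (E[i].2) (List.getElem?_eq_getElem hi')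
      (by simp [hiE])
    have h3 : (distances S st.P)[i] = weight E[i].2 := by simp only [hdist, List.getElem_map]
    rw [List.get_eq_getElem, List.get_eq_getElem, h3]
    simpa [distances] using this

end Optimality

/-! ### Double commutants and bounds on the distance -/

section Duality

variable {N : ℕ}

theorem anti_singleOp {e : PauliOp N} {c : Fin N × Bool} :
    Anti e (singleOp c) ↔ (if c.2 then (e c.1).toAdd.1 else (e c.1).toAdd.2) = 1 := by
  obtain ⟨n, b⟩ := c
  have hs : sympl e (singleOp (n, b)) =
      ((e n).toAdd.1 * (singleOp (n, b) n).toAdd.2 +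
        (e n).toAdd.2 * (singleOp (n, b) n).toAdd.1) := by
    rw [sympl]
    refine Finset.sum_eq_single n (fun k _ hk => ?_) (by simp)
    simp [singleOp, Function.update_of_ne hk]
  rw [Anti, hs]
  cases b <;> simp [singleOp]

theorem ne_one_of_anti_singleOp {e : PauliOp N} {c : Fin N × Bool} (h : Anti e (singleOp c)) :
    e c.1 ≠ 1 := by
  intro he
  rw [anti_singleOp, he] at h
  simp at h

theorem exists_anti_singleOp {e : PauliOp N} {n : Fin N} (he : e n ≠ 1) :
    ∃ b, Anti e (singleOp (n, b)) := by
  by_contra! h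
  have h0 := h false
  have h1 := h true
  rw [anti_singleOp] at h0 h1
  apply he
  have key : ∀ u : Multiplicative (ZMod 2 × ZMod 2), ¬ u.toAdd.1 = 1 → ¬ u.toAdd.2 = 1 → u = 1 := by
    decide
  exact key _ (by simpa using h1) (by simpa using h0)

theorem eq_one_of_forall_not_anti {e : PauliOp N} (h : ∀ c, ¬ Anti e (singleOp c)) : e = 1 := by
  funext n
  by_contra hn
  obtain ⟨b, hb⟩ := exists_anti_singleOp hn
  exact h _ hb

/-- The double commutant theorem. -/
theorem mem_closure_of_forall_commute {X : Set (PauliOp N)} {v : PauliOp N}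
    (hv : ∀ h, (∀ x ∈ X, ¬ Anti h x) → ¬ Anti h v) : v ∈ Subgroup.closure X := by
  induction X, X.toFinite using Set.Finite.induction_on generalizing v with
  | empty =>
    rw [eq_one_of_forall_not_anti fun c => mt anti_comm.mp (hv (singleOp c) (by simp))]
    exact one_mem _
  | @insert x X _ _ ih =>
    have hle : Subgroup.closure X ≤ Subgroup.closure (insert x X) :=
      Subgroup.closure_mono (Set.subset_insert _ _)
    by_cases hx : ∃ h, (∀ y ∈ X, ¬ Anti h y) ∧ Anti h x
    · obtain ⟨g, hg, hgx⟩ := hx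
      -- Here `g` commutes with `X` and acts on `x`, and `v` is corrected by `x` so as to commute
      -- with `g`. If `h` commutes with `X` but acts on `x`, then `h * g` commutes with both `x` and
      -- `X`, so the hypothesis on `v` applies to it.
      have hmem : fixOp g x v ∈ Subgroup.closure X := by
        refine ih fun h hh => ?_
        by_cases hhx : Anti h x
        · have h1 : ¬ Anti (h * g) v := hv _ fun y hy => by
            rw [anti_mul_left]
            rcases Set.mem_insert_iff.mp hy with rfl | hy
            · tauto
            · have := hh y hy
              have := hg y hy
              tauto
          rw [anti_mul_left] at h1
          unfold fixOp
          split_ifs with hgv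
          · rw [anti_mul_right]
            tauto
          · tauto
        · have h1 : ¬ Anti h v := hv h fun y hy => by
            rcases Set.mem_insert_iff.mp hy with rfl | hy
            · exact hhx
            · exact hh y hy
          rcases fixOp_eq_or g x v with he | he <;> rw [he]
          · exact h1
          · rw [anti_mul_right]
            tauto
      exact (fixOp_mem (Subgroup.subset_closure (Set.mem_insert _ _))).mp (hle hmem)
    -- Otherwise everything that commutes with `X` commutes with `x` too, and `x` is superfluous.
    · push Not at hx
      refine hle (ih fun h hh => hv h fun y hy => ?_)
      rcases Set.mem_insert_iff.mp hy with rfl | hy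
      · exact hx h hh
      · exact hh y hy

/-- The operators that act only on the qubits in `M`. -/
def supportedOn (M : Finset (Fin N)) : Subgroup (PauliOp N) where
  carrier := {e | ∀ k, k ∉ M → e k = 1}
  one_mem' := fun _ _ => rfl
  mul_mem' := fun ha hb k hk => by rw [Pi.mul_apply, ha k hk, hb k hk, one_mul]
  inv_mem' := fun ha k hk => by rw [Pi.inv_apply, ha k hk, inv_one]

theorem weight_le_card {M : Finset (Fin N)} {e : PauliOp N} (he : e ∈ supportedOn M) :
    weight e ≤ M.card :=
  Finset.card_le_card fun k hk => by
    by_contra hkM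
    exact (Finset.mem_filter.mp hk).2 (he k hkM)

/-- If no undetectable error on `M` acts on `a`, then up to an operator generated by `S` the
operator `a` acts on the complement of `M` only. -/
theorem exists_supportedOn_compl {S : Set (PauliOp N)} {a : PauliOp N} {M : Finset (Fin N)}
    (h : ∀ e ∈ supportedOn M, ¬ IsUndetectableError S a e) :
    ∃ s ∈ Subgroup.closure S, ∃ a' ∈ supportedOn Mᶜ, s * a' = a := by
  have hmem : a ∈ Subgroup.closure (S ∪ (supportedOn Mᶜ : Set (PauliOp N))) := by
    -- By duality it suffices to test operators that commute with `S` and with everything off `M`;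
    -- these are undetectable errors on `M`.
    refine mem_closure_of_forall_commute fun e he ha => ?_
    refine h e (fun k hk => ?_) ⟨fun s hs => he s (Or.inl hs), ha⟩
    by_contra hek
    obtain ⟨b, hb⟩ := exists_anti_singleOp hek
    refine he (singleOp (k, b)) (Or.inr fun j hj => ?_) hb
    have : j ≠ k := by
      rintro rfl
      exact hj (Finset.mem_compl.mpr hk)
    simp [singleOp, Function.update_of_ne this]
  rw [Subgroup.closure_union, Subgroup.closure_eq, Subgroup.mem_sup] at hmem
  exact hmem

/-- The distance of a qubit is at most `(N + 1) / 2`. -/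
theorem two_mul_pairDist_le {S : Set (PauliOp N)} (hS : ∀ s ∈ S, ∀ t ∈ S, ¬ Anti s t)
    {q : OpPair N} (h1 : q.1 ∈ centralizer S) (h2 : q.2 ∈ centralizer S) (hq : Anti q.1 q.2) :
    2 * pairDist S q ≤ N + 1 := by
  by_contra! hlt
  -- Both a half of the qubits and its complement have fewer elements than the assumed distance.
  obtain ⟨M, -, hM⟩ := Finset.exists_subset_card_eq (s := (Finset.univ : Finset (Fin N)))
    (n := N / 2) (by simp; omega)
  have hMc : Mᶜ.card = N - N / 2 := by rw [Finset.card_compl, hM, Fintype.card_fin]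
  have hno : ∀ e ∈ supportedOn M, ¬ IsUndetectableError S q.1 e := by
    intro e he hu
    have := omega_le hu
    have := weight_le_card he
    have : pairDist S q ≤ omega S q.1 := min_le_left _ _
    omega
  obtain ⟨s, hs, a, ha, hsa⟩ := exists_supportedOn_compl hno
  have hs2 : ¬ Anti s q.2 := fun h => by
    obtain ⟨x, hx, hax⟩ := exists_anti_of_anti_closure hs h.symm
    exact h2 x hx hax
  have hsS : s ∈ commutant S := by
    refine (Subgroup.closure_le _).mpr ?_ hs
    exact fun x hx t ht => hS x hx t ht
  have haS : a ∈ commutant S := by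
    rw [← mem_commutant, ← hsa] at h1
    exact ((commutant S).mul_mem_cancel_left hsS).mp h1
  -- Moving `q.1` off `M` changes it by `s`, which commutes with `q.2`. What remains is an error on
  -- `q.2` supported on the complement.
  have hact : IsUndetectableError S q.2 a := by
    refine ⟨haS, ?_⟩
    rw [← hsa, anti_mul_left] at hq
    tauto
  have := omega_le hact
  have := weight_le_card ha
  have : pairDist S q ≤ omega S q.2 := min_le_right _ _
  omega

theorem exists_prod_of_mem_closure {l : List (PauliOp N)} {v : PauliOp N}
    (hv : v ∈ Subgroup.closure {p | p ∈ l}) :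
    ∃ f : Fin l.length → Bool, v = ∏ i, bitPow (l.get i) (f i) := by
  induction hv using Subgroup.closure_induction with
  | mem x hx =>
    obtain ⟨i, rfl⟩ := List.get_of_mem hx
    refine ⟨fun j => decide (j = i), ?_⟩
    rw [Finset.prod_eq_single i] <;> simp +contextual [bitPow]
  | one => exact ⟨fun _ => false, by simp [bitPow]⟩
  | mul x y _ _ hx hy =>
    obtain ⟨f, rfl⟩ := hx
    obtain ⟨g, rfl⟩ := hy
    refine ⟨fun i => xor (f i) (g i), ?_⟩
    rw [← Finset.prod_mul_distrib]
    refine Finset.prod_congr rfl fun i _ => ?_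
    dsimp only
    generalize f i = x
    generalize g i = y
    cases x <;> cases y <;> simp [bitPow, PauliOp.mul_self]
  | inv x _ hx => rwa [inv_eq_of_mul_eq_one_left (PauliOp.mul_self x)]

/-- Generators of the centralizer of commuting operators number at least `N`. -/
theorem le_length_of_closure_eq_centralizer {S : Set (PauliOp N)}
    (hS : ∀ s ∈ S, ∀ t ∈ S, ¬ Anti s t) {l : List (PauliOp N)}
    (hl : Subgroup.closure {p | p ∈ l} = commutant S) : N ≤ l.length := by
  classical
  let ρ : PauliOp N → Fin l.length → Bool := fun p i => decide (Anti p (l.get i))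
  -- Operators with equal patterns differ by an element of the generated group: the difference
  -- commutes with the centralizer of `S`, which contains `S` as `S` is commutative.
  have hker : ∀ p q, ρ p = ρ q → p * q ∈ Subgroup.closure {p | p ∈ l} := by
    intro p q hpq
    have hc : ∀ x ∈ {p | p ∈ l}, ¬ Anti (p * q) x := by
      intro x hx
      obtain ⟨i, rfl⟩ := List.get_of_mem hx
      have := congrFun hpq i
      simp only [ρ, decide_eq_decide] at this
      rw [anti_mul_left, this]
      tauto
    rw [hl]
    intro s hs ha
    have hsl : s ∈ Subgroup.closure {p | p ∈ l} := by
      rw [hl]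
      exact fun t ht => hS s hs t ht
    obtain ⟨x, hx, hax⟩ := exists_anti_of_anti_closure hsl ha
    exact hc x hx hax
  -- An operator is recovered from its pattern and from the exponents of that difference, whence `4
  -- ^ N ≤ 4 ^ |l|`.
  let τ : (Fin l.length → Bool) × (Fin l.length → Bool) → PauliOp N := fun fg =>
    (if h : ∃ p, ρ p = fg.1 then h.choose else 1) * ∏ i, bitPow (l.get i) (fg.2 i)
  have hsurj : Function.Surjective τ := by
    intro p
    have hp : ∃ p', ρ p' = ρ p := ⟨p, rfl⟩
    obtain ⟨f, hf⟩ := exists_prod_of_mem_closure (hker _ _ hp.choose_spec)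
    refine ⟨(ρ p, f), ?_⟩
    simp only [τ]
    rw [dif_pos hp, ← hf, ← mul_assoc, PauliOp.mul_self, one_mul]
  have := Fintype.card_le_of_surjective τ hsurj
  simp only [PauliOp, Fintype.card_pi, Fintype.card_prod, Fintype.card_bool, Finset.prod_const,
    Finset.card_univ, Fintype.card_fin, Fintype.card_multiplicative, ZMod.card, ← mul_pow] at this
  exact (Nat.pow_le_pow_iff_right (by norm_num)).mp this

end Duality

/-! ### Gaussian elimination -/

section Elimination

variable {N : ℕ}

/-! ### Values and times of the elementary operations. -/

@[simp] theorem Timed.val_pure {α : Type} (a : α) : (pure a : Timed α).val = a := rfl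

@[simp] theorem Timed.time_pure {α : Type} (a : α) : (pure a : Timed α).time = 0 := rfl

@[simp] theorem Timed.val_bind {α β : Type} (x : Timed α) (f : α → Timed β) :
    (x >>= f).val = (f x.val).val := rfl

@[simp] theorem Timed.time_bind {α β : Type} (x : Timed α) (f : α → Timed β) :
    (x >>= f).time = x.time + (f x.val).time := rfl

@[simp] theorem mulT_val (p q : PauliOp N) : (mulT p q).val = p * q := rfl

@[simp] theorem mulT_time (p q : PauliOp N) : (mulT p q).time = 1 := rfl

@[simp] theorem antiT_val (p q : PauliOp N) : (antiT p q).val = decide (Anti p q) := rfl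

@[simp] theorem antiT_time (p q : PauliOp N) : (antiT p q).time = 1 := rfl

@[simp] theorem fixOpT_val (h o x : PauliOp N) : (fixOpT h o x).val = fixOp h o x := by
  by_cases hx : Anti h x <;> simp [fixOpT, fixOp, hx]

theorem fixOpT_time_le (h o x : PauliOp N) : (fixOpT h o x).time ≤ 2 := by
  by_cases hx : Anti h x <;> simp [fixOpT, hx]

/-- Each row is the only one that anti-commutes with its pivot. -/
def IsPivotSystem (rows : List (Row N)) : Prop :=
  (∀ r ∈ rows, Anti (singleOp r.2) r.1) ∧
    rows.Pairwise fun r r' => ¬ Anti (singleOp r.2) r'.1 ∧ ¬ Anti (singleOp r'.2) r.1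

theorem isPivotSystem_cons {r : Row N} {rows : List (Row N)} :
    IsPivotSystem (r :: rows) ↔ Anti (singleOp r.2) r.1 ∧
      (∀ r' ∈ rows, ¬ Anti (singleOp r.2) r'.1 ∧ ¬ Anti (singleOp r'.2) r.1) ∧
      IsPivotSystem rows := by
  simp only [IsPivotSystem, List.mem_cons, forall_eq_or_imp, List.pairwise_cons]
  tauto

theorem reduceT_mem {H : Subgroup (PauliOp N)} {rows : List (Row N)}
    (hr : ∀ r ∈ rows, r.1 ∈ H) (o : PauliOp N) : (reduceT rows o).val ∈ H ↔ o ∈ H := by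
  induction rows generalizing o with
  | nil => rfl
  | cons r rows ih =>
    simp only [reduceT, Timed.val_bind, fixOpT_val]
    rw [ih (fun r' hr' => hr r' (List.mem_cons_of_mem _ hr')), fixOp_mem (hr r List.mem_cons_self)]

theorem anti_reduceT {rows : List (Row N)} {c : PauliOp N} (hc : ∀ r ∈ rows, ¬ Anti c r.1)
    (o : PauliOp N) : Anti c (reduceT rows o).val ↔ Anti c o := by
  induction rows generalizing o with
  | nil => rfl
  | cons r rows ih =>
    simp only [reduceT, Timed.val_bind, fixOpT_val]
    rw [ih (fun r' hr' => hc r' (List.mem_cons_of_mem _ hr'))]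
    have := hc r List.mem_cons_self
    rcases fixOp_eq_or (singleOp r.2) r.1 o with h | h <;> rw [h]
    rw [anti_mul_right]
    tauto

theorem not_anti_reduceT {rows : List (Row N)} (h : IsPivotSystem rows) (o : PauliOp N) :
    ∀ r ∈ rows, ¬ Anti (singleOp r.2) (reduceT rows o).val := by
  induction rows generalizing o with
  | nil => simp
  | cons r rows ih =>
    obtain ⟨h1, h2, h3⟩ := isPivotSystem_cons.mp h
    simp only [reduceT, Timed.val_bind, fixOpT_val]
    intro r' hr'
    rcases List.mem_cons.mp hr' with rfl | hr'
    · rw [anti_reduceT fun r'' hr'' => (h2 r'' hr'').1]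
      exact not_anti_fixOp h1 o
    · exact ih h3 _ r' hr'

theorem reduceT_time_le (rows : List (Row N)) (o : PauliOp N) :
    (reduceT rows o).time ≤ 2 * rows.length := by
  induction rows generalizing o with
  | nil => simp [reduceT]
  | cons r rows ih =>
    simp only [reduceT, Timed.time_bind, List.length_cons]
    have := ih (fixOpT (singleOp r.2) r.1 o).val
    have := fixOpT_time_le (singleOp r.2) r.1 o
    omega

theorem findPivotT_spec (o : PauliOp N) (l : List (Fin N × Bool)) :
    ((findPivotT o l).val = none → ∀ c ∈ l, ¬ Anti o (singleOp c)) ∧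
      (∀ c, (findPivotT o l).val = some c → Anti o (singleOp c)) ∧
      (findPivotT o l).time ≤ l.length := by
  induction l with
  | nil => simp [findPivotT]
  | cons c l ih =>
    by_cases hc : Anti o (singleOp c)
    · simp [findPivotT, hc]
    · simp only [findPivotT, Timed.val_bind, Timed.time_bind, antiT_val, antiT_time, hc,
        decide_false, Bool.false_eq_true, if_false, List.mem_cons, forall_eq_or_imp,
        not_false_eq_true, true_and, List.length_cons]
      exact ⟨ih.1, ih.2.1, by omega⟩

theorem eliminateT_val (o : PauliOp N) (c : Fin N × Bool) (rows : List (Row N)) :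
    (eliminateT o c rows).val = rows.map fun r => (fixOp (singleOp c) o r.1, r.2) := by
  induction rows with
  | nil => rfl
  | cons r rows ih => simp [eliminateT, ih]

theorem eliminateT_time_le (o : PauliOp N) (c : Fin N × Bool) (rows : List (Row N)) :
    (eliminateT o c rows).time ≤ 2 * rows.length := by
  induction rows with
  | nil => simp [eliminateT]
  | cons r rows ih =>
    simp only [eliminateT, Timed.time_bind, Timed.time_pure, List.length_cons]
    have := fixOpT_time_le (singleOp c) o r.1
    omega

theorem length_allPivots : (allPivots N).length = 2 * N := by
  simp [allPivots, List.length_flatMap, mul_comm]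

theorem mem_allPivots (c : Fin N × Bool) : c ∈ allPivots N := by
  obtain ⟨n, _ | _⟩ := c <;> simp [allPivots]

/-- The new row `o` is already reduced, so multiplying by it does not disturb the old pivots, while
it clears the new pivot from the old rows. -/
theorem IsPivotSystem.eliminate {rows : List (Row N)} (h : IsPivotSystem rows) {o : PauliOp N}
    {c : Fin N × Bool} (ho : ∀ r ∈ rows, ¬ Anti (singleOp r.2) o) (hc : Anti (singleOp c) o) :
    IsPivotSystem ((rows.map fun r => (fixOp (singleOp c) o r.1, r.2)) ++ [(o, c)]) := by
  have key : ∀ r ∈ rows, ∀ x, Anti (singleOp r.2) (fixOp (singleOp c) o x) ↔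
      Anti (singleOp r.2) x := by
    intro r hr x
    have := ho r hr
    rcases fixOp_eq_or (singleOp c) o x with h | h <;> rw [h]
    rw [anti_mul_right]
    tauto
  refine ⟨?_, ?_⟩
  · intro r hr
    rcases List.mem_append.mp hr with hr | hr
    · obtain ⟨x, hx, rfl⟩ := List.mem_map.mp hr
      exact (key x hx _).mpr (h.1 x hx)
    · rw [List.mem_singleton.mp hr]
      exact hc
  · rw [List.pairwise_append, List.pairwise_map]
    refine ⟨h.2.imp_of_mem fun {x y} hx hy hxy => ?_, List.pairwise_singleton _ _, ?_⟩
    · rw [key x hx, key y hy]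
      exact hxy
    · intro r hr r' hr'
      obtain ⟨x, hx, rfl⟩ := List.mem_map.mp hr
      rw [List.mem_singleton.mp hr']
      exact ⟨ho x hx, not_anti_fixOp hc _⟩

/-- Preservation of the generated group is phrased through the subgroups that contain the rows, a
form that each row operation visibly respects. An operator costs a reduction, a pivot search of at
most `2 * N` tests and an elimination. -/
theorem rowsT_spec (os : List (PauliOp N)) (rows : List (Row N)) (h : IsPivotSystem rows) :
    IsPivotSystem (rowsT os rows).val ∧
      (∀ H : Subgroup (PauliOp N), (∀ r ∈ (rowsT os rows).val, r.1 ∈ H) ↔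
        (∀ r ∈ rows, r.1 ∈ H) ∧ ∀ o ∈ os, o ∈ H) ∧
      (rowsT os rows).time ≤ os.length * (4 * (rows.length + os.length) + 2 * N) := by
  induction os generalizing rows with
  | nil => simp [rowsT, h]
  | cons o os ih =>
    have ht := reduceT_time_le rows o
    have hp := not_anti_reduceT h o
    have hm := fun (H : Subgroup (PauliOp N)) (hr : ∀ r ∈ rows, r.1 ∈ H) => reduceT_mem hr o
    simp only [rowsT, Timed.val_bind, Timed.time_bind]
    set o' := (reduceT rows o).val with ho'
    have hmono : os.length * (4 * (rows.length + os.length) + 2 * N) + 2 * rows.length ≤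
        (o :: os).length * (4 * (rows.length + (o :: os).length) + 2 * N) := by
      rw [List.length_cons]
      nlinarith
    by_cases h1 : o' = 1
    · simp only [if_pos h1]
      obtain ⟨i1, i2, i3⟩ := ih rows h
      refine ⟨i1, fun H => ?_, by omega⟩
      rw [i2, List.forall_mem_cons]
      refine and_congr_right fun hr => ?_
      have := hm H hr
      rw [h1] at this
      simp [this.mp H.one_mem]
    · simp only [if_neg h1]
      obtain ⟨f1, f2, f3⟩ := findPivotT_spec o' (allPivots N)
      rw [length_allPivots] at f3
      simp only [Timed.val_bind, Timed.time_bind]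
      cases hfp : (findPivotT o' (allPivots N)).val with
      | none =>
        -- The candidates `X` and `Z` on all qubits detect every operator other than the identity,
        -- so a pivot is always found.
        exact absurd (eq_one_of_forall_not_anti fun c => f1 hfp c (mem_allPivots c)) h1
      | some c =>
        have hc : Anti (singleOp c) o' := (f2 c hfp).symm
        have he := eliminateT_time_le o' c rows
        simp only [Timed.val_bind, Timed.time_bind]
        rw [eliminateT_val]
        obtain ⟨i1, i2, i3⟩ := ih _ (h.eliminate hp hc)
        refine ⟨i1, fun H => ?_, ?_⟩
        · rw [i2, List.forall_mem_cons, ← and_assoc]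
          refine and_congr_left fun _ => ?_
          simp only [List.forall_mem_append, List.forall_mem_map, List.forall_mem_singleton]
          constructor
          · rintro ⟨hr, ho⟩
            have hr' : ∀ r ∈ rows, r.1 ∈ H := fun r hr1 => (fixOp_mem ho).mp (hr r hr1)
            exact ⟨hr', (hm H hr').mp ho⟩
          · rintro ⟨hr, ho⟩
            have ho2 := (hm H hr).mpr ho
            exact ⟨fun r hr1 => (fixOp_mem ho2).mpr (hr r hr1), ho2⟩
        · simp only [List.length_append, List.length_map, List.length_singleton] at i3
          have : os.length * (4 * (rows.length + 1 + os.length) + 2 * N) + 4 * rows.length + 2 * N ≤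
              (o :: os).length * (4 * (rows.length + (o :: os).length) + 2 * N) := by
            rw [List.length_cons]
            nlinarith
          omega

/-- The rows whose pivots lie on qubit `n`. -/
def rowGroup (rows : List (Row N)) (n : Fin N) : List (PauliOp N) :=
  (rows.filter fun r => r.2.1 = n).map Prod.fst

theorem pseudoGeneratorsT_val (C : List (PauliOp N)) :
    (pseudoGeneratorsT C).val =
      ((List.finRange N).map (rowGroup (rowsT C []).val)).filter fun g => !g.isEmpty := rfl

theorem length_pseudoGeneratorsT_le (C : List (PauliOp N)) :
    (pseudoGeneratorsT C).val.length ≤ N := by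
  rw [pseudoGeneratorsT_val]
  refine (List.length_filter_le _ _).trans ?_
  simp

theorem mem_closure_of_mem_pseudoGeneratorsT {C g : List (PauliOp N)} {p : PauliOp N}
    (hg : g ∈ (pseudoGeneratorsT C).val) (hp : p ∈ g) : p ∈ Subgroup.closure {p | p ∈ C} := by
  rw [pseudoGeneratorsT_val] at hg
  obtain ⟨n, -, rfl⟩ := List.mem_map.mp (List.mem_filter.mp hg).1
  obtain ⟨r, hr, rfl⟩ := List.mem_map.mp hp
  exact ((rowsT_spec C [] ⟨by simp, List.Pairwise.nil⟩).2.1 _).mpr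
    ⟨by simp, fun o ho => Subgroup.subset_closure ho⟩ r (List.mem_filter.mp hr).1

/-- The product of the rows whose pivots anti-commute with `e`. -/
def rowProd (e : PauliOp N) (rows : List (Row N)) : PauliOp N :=
  (rows.map fun r => partnerFactor e (singleOp r.2) r.1).prod

theorem rowProd_cons (e : PauliOp N) (r : Row N) (rows : List (Row N)) :
    rowProd e (r :: rows) = partnerFactor e (singleOp r.2) r.1 * rowProd e rows := by
  simp [rowProd]

theorem rowProd_eq_one {e : PauliOp N} {rows : List (Row N)}
    (h : ∀ r ∈ rows, ¬ Anti e (singleOp r.2)) : rowProd e rows = 1 :=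
  List.prod_eq_one fun x hx => by
    obtain ⟨r, hr, rfl⟩ := List.mem_map.mp hx
    exact if_neg (h r hr)

/-- Pivots read off the coefficients of an operator in terms of the rows. Both sides are
multiplicative in `e`, so it suffices to check the rows themselves. -/
theorem IsPivotSystem.rowProd_eq {rows : List (Row N)} (h : IsPivotSystem rows) {e : PauliOp N}
    (he : e ∈ Subgroup.closure {p | p ∈ rows.map Prod.fst}) : rowProd e rows = e := by
  induction he using Subgroup.closure_induction with
  | mem x hx =>
    obtain ⟨r, hr, rfl⟩ := List.mem_map.mp hx
    clear hx
    induction rows with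
    | nil => simp at hr
    | cons r' rows ih =>
      obtain ⟨h1, h2, h3⟩ := isPivotSystem_cons.mp h
      rw [rowProd_cons]
      rcases List.mem_cons.mp hr with rfl | hr
      · rw [rowProd_eq_one fun r' hr' => mt anti_comm.mp (h2 r' hr').2, mul_one]
        exact if_pos h1.symm
      · rw [ih h3 hr]
        have : partnerFactor r.1 (singleOp r'.2) r'.1 = 1 := if_neg (mt anti_comm.mp (h2 r hr).1)
        rw [this, one_mul]
  | one => exact rowProd_eq_one fun _ _ => not_anti_one_left _
  | mul x y _ _ hx hy =>
    have key : ∀ rows : List (Row N), rowProd (x * y) rows = rowProd x rows * rowProd y rows := by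
      intro rows
      rw [rowProd, rowProd, rowProd, ← List.prod_map_mul]
      congr 2
      funext r
      simp only [partnerFactor, anti_mul_left]
      by_cases h1 : Anti x (singleOp r.2) <;> by_cases h2 : Anti y (singleOp r.2) <;>
        simp [h1, h2, PauliOp.mul_self]
    rw [key, hx, hy]
  | inv x _ hx => rwa [inv_eq_of_mul_eq_one_left (PauliOp.mul_self x)]

theorem rowProd_eq_prod_groups (e : PauliOp N) (rows : List (Row N)) :
    rowProd e rows =
      ((List.finRange N).map fun n => rowProd e (rows.filter fun r => r.2.1 = n)).prod := by
  rw [← Fin.prod_univ_def]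
  induction rows with
  | nil => simp [rowProd]
  | cons r rows ih =>
    have : ∀ n, rowProd e ((r :: rows).filter fun r => r.2.1 = n) =
        (if r.2.1 = n then partnerFactor e (singleOp r.2) r.1 else 1) *
          rowProd e (rows.filter fun r => r.2.1 = n) := by
      intro n
      by_cases hn : r.2.1 = n <;> simp [hn, rowProd_cons]
    simp only [this]
    rw [Finset.prod_mul_distrib, ← ih, rowProd_cons, Finset.prod_ite_eq]
    simp

theorem rowProd_mem_spanT {rows : List (Row N)} {e : PauliOp N} (hlen : rows.length ≤ 2)
    (he : ∃ r ∈ rows, Anti e (singleOp r.2)) : rowProd e rows ∈ (spanT (rows.map Prod.fst)).val := by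
  match rows, hlen, he with
  | [r], _, he =>
    have : Anti e (singleOp r.2) := by simpa using he
    simp [spanT, rowProd, partnerFactor, this]
  | [r, r'], _, he =>
    have : Anti e (singleOp r.2) ∨ Anti e (singleOp r'.2) := by simpa using he
    by_cases h1 : Anti e (singleOp r.2) <;> by_cases h2 : Anti e (singleOp r'.2)
    · simp [spanT, rowProd, partnerFactor, h1, h2]
    · simp [spanT, rowProd, partnerFactor, h1, h2]
    · simp [spanT, rowProd, partnerFactor, h1, h2]
    · tauto

/-- Different rows have different pivots, and a qubit offers only two of them. -/
theorem IsPivotSystem.length_group_le {rows : List (Row N)} (h : IsPivotSystem rows) (n : Fin N) :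
    (rows.filter fun r => r.2.1 = n).length ≤ 2 := by
  have hnd : ((rows.filter fun r => r.2.1 = n).map fun r => r.2.2).Nodup := by
    rw [List.Nodup, List.pairwise_map]
    refine (h.2.sublist List.filter_sublist).imp_of_mem fun {x y} hx hy hxy he => hxy.1 ?_
    have hx' := List.mem_filter.mp hx
    have hy' := List.mem_filter.mp hy
    have : x.2 = y.2 := Prod.ext
      ((of_decide_eq_true hx'.2).trans (of_decide_eq_true hy'.2).symm) he
    rw [this]
    exact h.1 y hy'.1
  simpa using hnd.length_le_card

/-! ### Pseudo-products and their cost. -/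

theorem mem_mulEachT {x p : PauliOp N} {l : List (PauliOp N)} :
    p ∈ (mulEachT x l).val ↔ ∃ y ∈ l, p = x * y := by
  induction l with
  | nil => simp [mulEachT]
  | cons y l ih => simp [mulEachT, ih]

theorem mulEachT_size (x : PauliOp N) (l : List (PauliOp N)) :
    (mulEachT x l).val.length = l.length ∧ (mulEachT x l).time = l.length := by
  induction l with
  | nil => simp [mulEachT]
  | cons y l ih =>
    simp [mulEachT, ih]
    omega

theorem mem_mulAllT {p : PauliOp N} {l l' : List (PauliOp N)} :
    p ∈ (mulAllT l l').val ↔ ∃ x ∈ l, ∃ y ∈ l', p = x * y := by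
  induction l with
  | nil => simp [mulAllT]
  | cons y l ih => simp [mulAllT, ih, mem_mulEachT]

theorem mulAllT_size (l l' : List (PauliOp N)) :
    (mulAllT l l').val.length = l.length * l'.length ∧
      (mulAllT l l').time = l.length * l'.length := by
  induction l with
  | nil => simp [mulAllT]
  | cons y l ih =>
    obtain ⟨h1, h2⟩ := mulEachT_size y l'
    simp only [mulAllT, Timed.val_bind, Timed.time_bind, Timed.val_pure, Timed.time_pure,
      List.length_append, h1, h2, ih, List.length_cons]
    constructor <;> ring

theorem mem_pseudoProductT_cons {p : PauliOp N} {g : List (PauliOp N)}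
    {gs : List (List (PauliOp N))} :
    p ∈ (pseudoProductT (g :: gs)).val ↔
      ∃ x ∈ (spanT g).val, ∃ y ∈ (pseudoProductT gs).val, p = x * y := by
  simp only [pseudoProductT, Timed.val_bind, mem_mulAllT]

theorem spanT_spec (g : List (PauliOp N)) :
    (spanT g).val.length ≤ 3 ∧ (spanT g).time ≤ 1 ∧
      ∀ H : Subgroup (PauliOp N), (∀ p ∈ g, p ∈ H) → ∀ p ∈ (spanT g).val, p ∈ H := by
  match g with
  | [] => simp [spanT]
  | [a] => simp [spanT]
  | a :: b :: _ =>
    simp only [spanT, Timed.val_bind, Timed.time_bind, mulT_val, mulT_time, Timed.val_pure,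
      Timed.time_pure, List.length_cons, List.length_nil]
    refine ⟨by omega, by omega, fun H hH p hp => ?_⟩
    simp only [List.mem_cons, List.not_mem_nil, or_false] at hp
    have ha := hH a (by simp)
    have hb := hH b (by simp)
    rcases hp with rfl | rfl | rfl
    · exact ha
    · exact hb
    · exact mul_mem ha hb

theorem pseudoProductT_spec (gs : List (List (PauliOp N))) :
    (pseudoProductT gs).val.length ≤ 3 ^ gs.length ∧
      (pseudoProductT gs).time + 2 ≤ 2 * 3 ^ gs.length ∧
      ∀ H : Subgroup (PauliOp N), (∀ g ∈ gs, ∀ p ∈ g, p ∈ H) →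
        ∀ p ∈ (pseudoProductT gs).val, p ∈ H := by
  induction gs with
  | nil =>
    refine ⟨by simp [pseudoProductT], by simp [pseudoProductT], fun H _ p hp => ?_⟩
    rw [List.mem_singleton.mp hp]
    exact H.one_mem
  | cons g gs ih =>
    obtain ⟨i1, i2, i3⟩ := ih
    obtain ⟨s1, s2, s3⟩ := spanT_spec g
    obtain ⟨m1, m2⟩ := mulAllT_size (spanT g).val (pseudoProductT gs).val
    have hmul := Nat.mul_le_mul s1 i1
    have hpos : 0 < 3 ^ gs.length := by positivity
    refine ⟨?_, ?_, fun H hH p hp => ?_⟩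
    · simp only [pseudoProductT, Timed.val_bind, m1, List.length_cons, pow_succ]
      omega
    · simp only [pseudoProductT, Timed.time_bind, m2, List.length_cons, pow_succ]
      omega
    · obtain ⟨x, hx, y, hy, rfl⟩ := mem_pseudoProductT_cons.mp hp
      exact mul_mem (s3 H (hH g List.mem_cons_self) x hx)
        (i3 H (fun g' hg' => hH g' (List.mem_cons_of_mem _ hg')) y hy)

/-- Every generated operator is a pseudo-product of at most as many pseudo-generators as its
weight. -/
theorem exists_pseudoProductT {C : List (PauliOp N)} {e : PauliOp N}
    (he : e ∈ Subgroup.closure {p | p ∈ C}) :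
    ∃ H, H.Sublist (pseudoGeneratorsT C).val ∧ H.length ≤ weight e ∧
      e ∈ (pseudoProductT H).val := by
  obtain ⟨hsys, hgen, -⟩ := rowsT_spec C [] ⟨by simp, List.Pairwise.nil⟩
  set rows := (rowsT C []).val with hrows
  have he' : e ∈ Subgroup.closure {p | p ∈ rows.map Prod.fst} := by
    refine (Subgroup.closure_le _).mpr ?_ he
    exact ((hgen (Subgroup.closure {p | p ∈ rows.map Prod.fst})).mp fun r hr =>
      Subgroup.subset_closure (List.mem_map_of_mem hr)).2
  let grp : Fin N → List (Row N) := fun n => rows.filter fun r => r.2.1 = n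
  let act : Fin N → Bool := fun n => (grp n).any fun r => decide (Anti e (singleOp r.2))
  have hact : ∀ n, act n = true ↔ ∃ r ∈ grp n, Anti e (singleOp r.2) := fun n => by
    simp [act]
  refine ⟨((List.finRange N).filter act).map (rowGroup rows), ?_, ?_, ?_⟩
  · rw [pseudoGeneratorsT_val, ← hrows, List.filter_map]
    refine (List.monotone_filter_right _ fun n hn => ?_).map _
    obtain ⟨r, hr, -⟩ := (hact n).mp hn
    have : r.1 ∈ rowGroup rows n := List.mem_map_of_mem hr
    simpa using List.ne_nil_of_mem this
  -- A group is used only if `e` anti-commutes with one of its pivots, and then `e` is not the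
  -- identity on that qubit.
  · rw [List.length_map, weight]
    have hnd : ((List.finRange N).filter act).Nodup := (List.nodup_finRange N).filter _
    rw [← List.toFinset_card_of_nodup hnd]
    refine Finset.card_le_card fun n hn => ?_
    rw [List.mem_toFinset] at hn
    obtain ⟨r, hr, har⟩ := (hact n).mp (List.mem_filter.mp hn).2
    have hrn : r.2.1 = n := of_decide_eq_true (List.mem_filter.mp hr).2
    rw [Finset.mem_filter]
    exact ⟨Finset.mem_univ _, hrn ▸ ne_one_of_anti_singleOp har⟩
  · have hprod : ∀ l : List (Fin N), (l.map fun n => rowProd e (grp n)).prod ∈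
        (pseudoProductT ((l.filter act).map (rowGroup rows))).val := by
      intro l
      induction l with
      | nil => simp [pseudoProductT]
      | cons n l ih =>
        rw [List.map_cons, List.prod_cons]
        by_cases hn : act n = true
        · rw [List.filter_cons_of_pos hn, List.map_cons, mem_pseudoProductT_cons]
          exact ⟨_, rowProd_mem_spanT (hsys.length_group_le n) ((hact n).mp hn), _, ih, rfl⟩
        · rw [List.filter_cons_of_neg hn, rowProd_eq_one, one_mul]
          · exact ih
          · intro r hr har
            exact hn ((hact n).mpr ⟨r, hr, har⟩)
    have := hprod (List.finRange N)
    rwa [← rowProd_eq_prod_groups, hsys.rowProd_eq he'] at this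

end Elimination

/-! ### The search for an error -/

section Search

variable {N : ℕ}

/-- `best` is an undetectable error that acts on some operator in `X`, of minimal weight compared
to those in `A`. -/
def IsBest (S X A : Set (PauliOp N)) (best : Option (PauliOp N)) : Prop :=
  (∀ m ∈ best, ∃ x ∈ X, IsUndetectableError S x m) ∧
    ∀ e ∈ A, (∃ x ∈ X, IsUndetectableError S x e) → ∃ m ∈ best, weight m ≤ weight e

theorem anyAntiT_spec (e : PauliOp N) (l : List (PauliOp N)) :
    ((anyAntiT e l).val = true ↔ ∃ x ∈ l, Anti e x) ∧ (anyAntiT e l).time ≤ l.length := by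
  induction l with
  | nil => simp [anyAntiT]
  | cons x l ih =>
    by_cases hx : Anti e x
    · simp [anyAntiT, hx]
    · simp only [anyAntiT, Timed.val_bind, Timed.time_bind, antiT_val, antiT_time, hx,
        decide_false, Bool.false_eq_true, if_false, List.mem_cons, exists_eq_or_imp, false_or,
        List.length_cons]
      exact ⟨ih.1, by omega⟩

theorem scanT_spec {S A : Set (PauliOp N)} (X es : List (PauliOp N))
    (hes : ∀ e ∈ es, e ∈ centralizer S) (best : Option (PauliOp N))
    (hb : IsBest S {x | x ∈ X} A best) :
    IsBest S {x | x ∈ X} (A ∪ {e | e ∈ es}) (scanT X es best).val ∧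
      (scanT X es best).time ≤ es.length * X.length := by
  induction es generalizing A best with
  | nil => simpa [scanT] using hb
  | cons e es ih =>
    have hes' : ∀ e ∈ es, e ∈ centralizer S := fun e' he' => hes e' (List.mem_cons_of_mem _ he')
    have hA : A ∪ {e' | e' ∈ e :: es} = insert e A ∪ {e' | e' ∈ es} := by
      ext p
      simp only [Set.mem_union, Set.mem_ofPred_eq, List.mem_cons, Set.mem_insert_iff]
      tauto
    rw [hA, List.length_cons, add_mul, one_mul]
    rw [scanT]
    split_ifs with hw
    · have hbest : IsBest S {x | x ∈ X} (insert e A) best := by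
        refine ⟨hb.1, fun e' he' hact => ?_⟩
        rcases Set.mem_insert_iff.mp he' with rfl | he'
        · obtain ⟨m, hme⟩ := (Option.any_eq_true_iff_get _ _).mp hw
          exact ⟨_, Option.get_mem m, of_decide_eq_true hme⟩
        · exact hb.2 e' he' hact
      obtain ⟨i1, i2⟩ := ih hes' best hbest
      exact ⟨i1, by omega⟩
    · obtain ⟨a1, a2⟩ := anyAntiT_spec e X
      simp only [Timed.val_bind, Timed.time_bind]
      split_ifs with ha
      · have hbest : IsBest S {x | x ∈ X} (insert e A) (some e) := by
          refine ⟨fun m hm => ?_, fun e' he' hact => ⟨e, rfl, ?_⟩⟩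
          · obtain rfl := Option.some.inj hm
            obtain ⟨x, hx, hax⟩ := a1.mp ha
            exact ⟨x, hx, hes _ List.mem_cons_self, hax⟩
          · rcases Set.mem_insert_iff.mp he' with rfl | he'
            · exact le_rfl
            · obtain ⟨m, hm, hme⟩ := hb.2 e' he' hact
              refine le_trans ?_ hme
              obtain rfl := Option.mem_def.mp hm
              simp only [Option.any_some, decide_eq_true_eq] at hw
              omega
        obtain ⟨i1, i2⟩ := ih hes' _ hbest
        exact ⟨i1, by omega⟩
      · have hbest : IsBest S {x | x ∈ X} (insert e A) best := by
          refine ⟨hb.1, fun e' he' hact => ?_⟩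
          rcases Set.mem_insert_iff.mp he' with rfl | he'
          · obtain ⟨x, hx, hax⟩ := hact
            exact absurd (a1.mpr ⟨x, hx, hax.2⟩) ha
          · exact hb.2 e' he' hact
        obtain ⟨i1, i2⟩ := ih hes' _ hbest
        exact ⟨i1, by omega⟩

/-- There are at most `3 ^ r` candidates per collection; each costs up to `|X|` tests, and forming
them all costs at most two products per candidate. -/
theorem scanLevelT_spec {S A : Set (PauliOp N)} (X : List (PauliOp N)) (r : ℕ)
    (Hs : List (List (List (PauliOp N))))
    (hHs : ∀ H ∈ Hs, H.length = r ∧ ∀ g ∈ H, ∀ p ∈ g, p ∈ centralizer S)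
    (best : Option (PauliOp N)) (hb : IsBest S {x | x ∈ X} A best) :
    IsBest S {x | x ∈ X} (A ∪ {e | ∃ H ∈ Hs, e ∈ (pseudoProductT H).val})
        (scanLevelT X Hs best).val ∧
      (scanLevelT X Hs best).time ≤ Hs.length * (3 ^ r * (X.length + 2)) := by
  induction Hs generalizing A best with
  | nil => simpa [scanLevelT] using hb
  | cons H Hs ih =>
    obtain ⟨hr, hH⟩ := hHs H List.mem_cons_self
    obtain ⟨p1, p2, p3⟩ := pseudoProductT_spec H
    rw [hr] at p1 p2
    obtain ⟨s1, s2⟩ := scanT_spec X (pseudoProductT H).val (p3 (commutant S) hH) best hb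
    obtain ⟨i1, i2⟩ := ih (fun H' hH' => hHs H' (List.mem_cons_of_mem _ hH')) _ s1
    have hA : A ∪ {e | ∃ H' ∈ H :: Hs, e ∈ (pseudoProductT H').val} =
        A ∪ {e | e ∈ (pseudoProductT H).val} ∪ {e | ∃ H ∈ Hs, e ∈ (pseudoProductT H).val} := by
      ext p
      simp only [Set.mem_union, Set.mem_ofPred_eq, List.mem_cons, exists_eq_or_imp, or_assoc]
    refine ⟨by rw [hA]; exact i1, ?_⟩
    simp only [scanLevelT, Timed.time_bind, List.length_cons, add_mul, one_mul]
    have := Nat.mul_le_mul_right X.length p1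
    rw [mul_add] at i2 ⊢
    omega

/-- The operators that are pseudo-products of fewer than `r` pseudo-generators. -/
def pseudoProductsBelow (G : List (List (PauliOp N))) (r : ℕ) : Set (PauliOp N) :=
  {e | ∃ H, H.Sublist G ∧ H.length < r ∧ e ∈ (pseudoProductT H).val}

theorem pseudoProductsBelow_succ (G : List (List (PauliOp N))) (r : ℕ) :
    pseudoProductsBelow G (r + 1) = pseudoProductsBelow G r ∪
      {e | ∃ H ∈ List.sublistsLen r G, e ∈ (pseudoProductT H).val} := by
  ext e
  simp only [pseudoProductsBelow, Set.mem_union, Set.mem_ofPred_eq, List.mem_sublistsLen]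
  constructor
  · rintro ⟨H, h1, h2, h3⟩
    rcases Nat.lt_succ_iff_lt_or_eq.mp h2 with h2 | h2
    · exact Or.inl ⟨H, h1, h2, h3⟩
    · exact Or.inr ⟨H, ⟨h1, h2⟩, h3⟩
  · rintro (⟨H, h1, h2, h3⟩ | ⟨H, ⟨h1, h2⟩, h3⟩)
    · exact ⟨H, h1, by omega, h3⟩
    · exact ⟨H, h1, by omega, h3⟩

/-- Before level `r` all errors of weight below `r` have been met. A known error of weight at most
`r` is therefore no heavier than any unseen one, and stopping is safe. The given error `e` bounds
the time and need not be optimal. -/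
theorem searchT_spec {S : Set (PauliOp N)} {G : List (List (PauliOp N))} (X : List (PauliOp N))
    (hG : ∀ g ∈ G, ∀ p ∈ g, p ∈ centralizer S)
    (hcov : ∀ e ∈ centralizer S, e ∈ pseudoProductsBelow G (weight e + 1))
    {e : PauliOp N} (he : ∃ x ∈ X, IsUndetectableError S x e) {d B : ℕ} (hed : weight e ≤ d)
    (hB : ∀ r ≤ d, G.length.choose r * (3 ^ r * (X.length + 2)) ≤ B)
    (k r : ℕ) (hk : G.length < r + k) (best : Option (PauliOp N))
    (hb : IsBest S {x | x ∈ X} (pseudoProductsBelow G r) best) :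
    IsBest S {x | x ∈ X} (centralizer S) (searchT G X (List.range' r k) best).val ∧
      (searchT G X (List.range' r k) best).time ≤ (d + 1 - r) * B := by
  induction k generalizing r best with
  | zero =>
    simp only [List.range'_zero, searchT, Timed.val_pure, Timed.time_pure, zero_le, and_true]
    refine ⟨hb.1, fun e he hact => hb.2 e ?_ hact⟩
    obtain ⟨H, h1, h2, h3⟩ := hcov e he
    exact ⟨H, h1, by have := h1.length_le; omega, h3⟩
  | succ k ih =>
    have hbelow : ∀ e, weight e < r → (∃ x ∈ X, IsUndetectableError S x e) →
        ∃ m ∈ best, weight m ≤ weight e := by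
      intro e her hact
      obtain ⟨H, h1, h2, h3⟩ := hcov e (hact.elim fun _ h => h.2.1)
      exact hb.2 e ⟨H, h1, by omega, h3⟩ hact
    rw [List.range'_succ, searchT]
    split_ifs with hw
    · simp only [Timed.val_pure, Timed.time_pure, zero_le, and_true]
      refine ⟨hb.1, fun e _ hact => ?_⟩
      rcases lt_or_ge (weight e) r with her | her
      · exact hbelow e her hact
      · obtain ⟨hm, hmr⟩ := (Option.any_eq_true_iff_get _ _).mp hw
        exact ⟨_, Option.get_mem hm, (of_decide_eq_true hmr).trans her⟩
    -- Beyond level `d` the error `e` would have been met, and the search would have stopped.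
    · have hrd : r ≤ d := by
        by_contra! hlt
        obtain ⟨m, hm, hme⟩ := hbelow e (by omega) he
        obtain rfl := Option.mem_def.mp hm
        simp only [Option.any_some, decide_eq_true_eq] at hw
        omega
      obtain ⟨s1, s2⟩ := scanLevelT_spec X r (List.sublistsLen r G) (fun H hH => by
        obtain ⟨h1, h2⟩ := List.mem_sublistsLen.mp hH
        exact ⟨h2, fun g hg => hG g (h1.subset hg)⟩) best hb
      rw [← pseudoProductsBelow_succ] at s1
      rw [List.length_sublistsLen] at s2
      obtain ⟨i1, i2⟩ := ih (r + 1) (by omega) _ s1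
      simp only [Timed.val_bind, Timed.time_bind]
      refine ⟨i1, ?_⟩
      have h1 := hB r hrd
      have h2 : d + 1 - r = (d + 1 - (r + 1)) + 1 := by omega
      rw [h2, add_mul, one_mul]
      omega

/-- The search finds an error of minimal weight; its time is bounded by the number `d` of levels
times a bound for the time of a level. -/
theorem findErrorT_spec {S : Set (PauliOp N)} {G : List (List (PauliOp N))} (X : List (PauliOp N))
    (hG : ∀ g ∈ G, ∀ p ∈ g, p ∈ centralizer S)
    (hcov : ∀ e ∈ centralizer S, e ∈ pseudoProductsBelow G (weight e + 1))
    {e : PauliOp N} (he : ∃ x ∈ X, IsUndetectableError S x e) {d B : ℕ} (hed : weight e ≤ d)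
    (hB : ∀ r ≤ d, G.length.choose r * (3 ^ r * (X.length + 2)) ≤ B) :
    (∃ h, (findErrorT G X).val = some h ∧ IsMinimalError S {x | x ∈ X} h) ∧
      (findErrorT G X).time ≤ d * B := by
  have hb : IsBest S {x | x ∈ X} (pseudoProductsBelow G 1) none := by
    refine ⟨by simp, ?_⟩
    rintro e' ⟨H, -, h2, h3⟩ ⟨x, hx, hu⟩
    -- Level 0 consists of the identity, which acts on nothing, so starting at level 1 without an
    -- error is correct.
    rw [Nat.lt_one_iff, List.length_eq_zero_iff] at h2
    subst h2
    rw [List.mem_singleton.mp h3] at hu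
    exact absurd hu.2 (not_anti_one_left _)
  have hrange : (List.range G.length).map (· + 1) = List.range' 1 G.length := by
    rw [List.range'_eq_map_range]
    simp [add_comm]
  obtain ⟨i1, i2⟩ := searchT_spec X hG hcov he hed hB G.length 1 (by omega) none hb
  rw [findErrorT, hrange]
  refine ⟨?_, by simpa using i2⟩
  obtain ⟨m, hm, -⟩ := i1.2 e (he.elim fun _ h => h.2.1) he
  refine ⟨m, hm, i1.1 m hm, fun e' he' => ?_⟩
  obtain ⟨m', hm', hme⟩ := i1.2 e' (he'.elim fun _ h => h.2.1) he'
  rwa [Option.some.inj (hm.symm.trans hm')]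

/-- Binomial coefficients increase weakly up to `(n + 1) / 2`; the distance bound keeps `d` in this
range. -/
theorem choose_le_choose_of_le {n r d : ℕ} (hrd : r ≤ d) (hd : 2 * d ≤ n + 1) :
    n.choose r ≤ n.choose d := by
  induction d, hrd using Nat.le_induction with
  | base => exact le_rfl
  | succ d hrd ih =>
    refine (ih (by omega)).trans ?_
    have h := Nat.choose_succ_right_eq n d
    have h2 : n.choose d * (d + 1) ≤ n.choose d * (n - d) := Nat.mul_le_mul_left _ (by omega)
    rw [← h] at h2
    exact Nat.le_of_mul_le_mul_right h2 (Nat.succ_pos d)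

end Search

/-! ### The steps of the algorithm -/

section Algorithm

variable {N : ℕ}

theorem splitFlaggedT_spec (h : PauliOp N) (l : List (OpPair N × Bool)) :
    ((splitFlaggedT h l).val = none → ∀ y ∈ l, y.2 = true → ¬ Anti h y.1.2) ∧
      (∀ pre q post, (splitFlaggedT h l).val = some (pre, q, post) →
        l = pre ++ (q, true) :: post ∧ Anti h q.2 ∧ ∀ y ∈ pre, y.2 = true → ¬ Anti h y.1.2) ∧
      (splitFlaggedT h l).time ≤ l.length := by
  induction l with
  | nil => simp [splitFlaggedT]
  | cons y l ih =>
    obtain ⟨i1, i2, i3⟩ := ih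
    have htest : ((if y.2 then antiT h y.1.2 else pure false : Timed Bool).val = true ↔
        y.2 = true ∧ Anti h y.1.2) ∧
        (if y.2 then antiT h y.1.2 else pure false : Timed Bool).time ≤ 1 := by
      split_ifs with hy <;> simp [hy]
    simp only [splitFlaggedT, Timed.val_bind, Timed.time_bind, List.length_cons]
    by_cases hy : y.2 = true ∧ Anti h y.1.2
    · simp only [htest.1.mpr hy, if_true, Timed.val_pure, Timed.time_pure]
      refine ⟨by simp, ?_, by omega⟩
      intro pre q post heq
      simp only [Option.some.injEq, Prod.mk.injEq] at heq
      obtain ⟨rfl, rfl, rfl⟩ := heq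
      refine ⟨?_, hy.2, by simp⟩
      rw [List.nil_append, ← hy.1]
    · have hf := mt htest.1.mp hy
      simp only [if_neg hf, Timed.val_bind, Timed.time_bind]
      cases hs : (splitFlaggedT h l).val with
      | none =>
        simp only [Timed.val_pure, Timed.time_pure]
        refine ⟨fun _ z hz => ?_, by simp, by omega⟩
        rcases List.mem_cons.mp hz with rfl | hz
        · tauto
        · exact i1 hs z hz
      | some t =>
        obtain ⟨pre', q', post'⟩ := t
        simp only [Timed.val_pure, Timed.time_pure]
        obtain ⟨j1, j2, j3⟩ := i2 _ _ _ hs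
        refine ⟨by simp, ?_, by omega⟩
        intro pre q post heq
        simp only [Option.some.injEq, Prod.mk.injEq] at heq
        obtain ⟨rfl, rfl, rfl⟩ := heq
        refine ⟨by rw [j1]; rfl, j2, fun z hz => ?_⟩
        rcases List.mem_cons.mp hz with rfl | hz
        · tauto
        · exact j3 z hz

theorem takePendingT_spec (h : PauliOp N) (l : List (OpPair N)) :
    ((takePendingT h l).val = none → ∀ q ∈ l, ¬ Anti h q.1 ∧ ¬ Anti h q.2) ∧
      (∀ q rest, (takePendingT h l).val = some (q, rest) →
        Anti h q.1 ∧ ∃ q', (q' = q ∨ q' = q.swap) ∧ l.Perm (q' :: rest)) ∧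
      (takePendingT h l).time ≤ 2 * l.length := by
  induction l with
  | nil => simp [takePendingT]
  | cons p l ih =>
    obtain ⟨i1, i2, i3⟩ := ih
    simp only [takePendingT, Timed.val_bind, Timed.time_bind, antiT_val, antiT_time,
      decide_eq_true_eq, List.length_cons]
    by_cases h1 : Anti h p.1
    · simp only [if_pos h1, Timed.val_pure, Timed.time_pure]
      refine ⟨by simp, fun q rest heq => ?_, by omega⟩
      simp only [Option.some.injEq, Prod.mk.injEq] at heq
      obtain ⟨rfl, rfl⟩ := heq
      exact ⟨h1, _, Or.inl rfl, List.Perm.refl _⟩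
    · simp only [if_neg h1, Timed.val_bind, Timed.time_bind, antiT_val, antiT_time,
        decide_eq_true_eq]
      by_cases h2 : Anti h p.2
      · simp only [if_pos h2, Timed.val_pure, Timed.time_pure]
        refine ⟨by simp, fun q rest heq => ?_, by omega⟩
        simp only [Option.some.injEq, Prod.mk.injEq] at heq
        obtain ⟨rfl, rfl⟩ := heq
        exact ⟨h2, _, Or.inr rfl, by simp⟩
      · simp only [if_neg h2, Timed.val_bind, Timed.time_bind]
        cases hs : (takePendingT h l).val with
        | none =>
          simp only [Timed.val_pure, Timed.time_pure]
          refine ⟨fun _ z hz => ?_, by simp, by omega⟩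
          rcases List.mem_cons.mp hz with rfl | hz
          · exact ⟨h1, h2⟩
          · exact i1 hs z hz
        | some t =>
          obtain ⟨q', rest'⟩ := t
          simp only [Timed.val_pure, Timed.time_pure]
          obtain ⟨j1, q'', j2, j3⟩ := i2 _ _ hs
          refine ⟨by simp, fun q rest heq => ?_, by omega⟩
          simp only [Option.some.injEq, Prod.mk.injEq] at heq
          obtain ⟨rfl, rfl⟩ := heq
          exact ⟨j1, q'', j2, (j3.cons p).trans (List.Perm.swap _ _ _)⟩

theorem fixFlaggedT_spec (h o acc : PauliOp N) (l : List (OpPair N × Bool)) :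
    (fixFlaggedT h o acc l).val = (acc * flaggedFactor h l, l.map (fixFlagged h o)) ∧
      (fixFlaggedT h o acc l).time ≤ 3 * l.length := by
  induction l generalizing acc with
  | nil => simp [fixFlaggedT, flaggedFactor]
  | cons y l ih =>
    obtain ⟨⟨a, b⟩, _ | _⟩ := y
    · obtain ⟨i1, i2⟩ := ih acc
      simp only [fixFlaggedT, Bool.false_eq_true, if_false, Timed.val_bind, Timed.time_bind,
        Timed.val_pure, Timed.time_pure, i1, List.length_cons]
      exact ⟨by simp [flaggedFactor, fixFlagged], by omega⟩
    · by_cases hb : Anti h b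
      · obtain ⟨i1, i2⟩ := ih (acc * a)
        simp only [fixFlaggedT, if_true, Timed.val_bind, Timed.time_bind, antiT_val, antiT_time,
          Timed.val_pure, Timed.time_pure, decide_eq_true hb, mulT_val, mulT_time, i1,
          List.length_cons]
        exact ⟨by simp [flaggedFactor, fixFlagged, fixOp, partnerFactor, hb, mul_assoc], by omega⟩
      · obtain ⟨i1, i2⟩ := ih acc
        simp only [fixFlaggedT, if_true, Timed.val_bind, Timed.time_bind, antiT_val, antiT_time,
          Timed.val_pure, Timed.time_pure, decide_eq_false hb, Bool.false_eq_true, if_false, i1,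
          List.length_cons]
        exact ⟨by simp [flaggedFactor, fixFlagged, fixOp, partnerFactor, hb], by omega⟩

theorem fixMemberT_spec (h o acc x p : PauliOp N) :
    (fixMemberT h o acc x p).val = (acc * partnerFactor h x p, fixOp h o x) ∧
      (fixMemberT h o acc x p).time ≤ 3 := by
  by_cases hx : Anti h x <;> simp [fixMemberT, partnerFactor, fixOp, hx]

theorem fixPendingT_spec (h o acc : PauliOp N) (l : List (OpPair N)) :
    (fixPendingT h o acc l).val =
        (acc * (l.map fun q => partnerFactor h q.1 q.2 * partnerFactor h q.2 q.1).prod,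
          l.map (fixPair h o)) ∧
      (fixPendingT h o acc l).time ≤ 6 * l.length := by
  induction l generalizing acc with
  | nil => simp [fixPendingT]
  | cons q l ih =>
    obtain ⟨u1, u2⟩ := fixMemberT_spec h o acc q.1 q.2
    obtain ⟨v1, v2⟩ := fixMemberT_spec h o (acc * partnerFactor h q.1 q.2) q.2 q.1
    obtain ⟨i1, i2⟩ := ih (acc * partnerFactor h q.1 q.2 * partnerFactor h q.2 q.1)
    simp only [fixPendingT, Timed.val_bind, Timed.time_bind, Timed.val_pure, Timed.time_pure,
      u1, v1, i1, List.length_cons, List.map_cons, List.prod_cons]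
    exact ⟨by simp [fixPair, mul_assoc], by omega⟩

theorem AlgState.mem_targets (st : AlgState N) :
    {x | x ∈ st.targets} = st.toOptState.X := by
  ext x
  simp only [AlgState.targets, OptState.X, OptState.R, unpack, AlgState.toOptState,
    Set.mem_ofPred_eq, List.mem_append, List.mem_map, List.mem_filter, List.mem_flatMap,
    List.mem_cons, List.not_mem_nil, or_false, Set.mem_union, List.coe_toFinset]
  rw [or_comm]
  refine or_congr_right ⟨?_, ?_⟩
  · rintro ⟨y, ⟨hy, hy2⟩, rfl⟩
    exact ⟨y, hy, hy2, rfl⟩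
  · rintro ⟨y, hy, hy2, rfl⟩
    exact ⟨y, ⟨hy, hy2⟩, rfl⟩

theorem AlgState.length_targets_le (st : AlgState N) :
    st.targets.length ≤ st.Ps.length + 2 * st.pending.length := by
  simp only [AlgState.targets, List.length_append, List.length_map, List.length_flatMap]
  have := List.length_filter_le (fun y : OpPair N × Bool => y.2) st.Ps
  simp
  omega

theorem AlgState.length_pairs {st : AlgState N} (h : st.pending.Nodup) :
    st.toOptState.pairs.length = st.pending.length + st.Ps.length := by
  simp [OptState.pairs, OptState.P, AlgState.toOptState, List.toFinset_card_of_nodup h]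

theorem toFinset_map_fixPair (h o : PauliOp N) (l : List (OpPair N)) :
    (l.map (fixPair h o)).toFinset = l.toFinset.image (fixPair h o) := by
  ext q
  simp

theorem stepT_spec {S : Set (PauliOp N)} {G : List (List (PauliOp N))} {st : AlgState N}
    (hnd : st.pending.Nodup) (hhyp : Hyperbolic st.toOptState.pairs) (hne : st.pending ≠ [])
    {h : PauliOp N} (hfind : (findErrorT G st.targets).val = some h)
    (hmin : IsMinimalError S {x | x ∈ st.targets} h) :
    Step S st.toOptState (stepT G st).val.toOptState ∧ (stepT G st).val.pending.Nodup ∧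
      (stepT G st).time ≤ (findErrorT G st.targets).time +
        10 * (st.pending.length + st.Ps.length) := by
  -- The number of pairs is counted by the finset on one side and by the list on the other. As a
  -- step preserves the first count, the new listing has no repetitions.
  have hnodup : ∀ st' : AlgState N, Step S st.toOptState st'.toOptState →
      st'.pending.length + st'.Ps.length = st.pending.length + st.Ps.length →
      st'.pending.Nodup := by
    intro st' hs hlen
    have h1 := (hs.pairs_hyperbolic hhyp).2.2
    rw [AlgState.length_pairs hnd, ← hlen] at h1
    have h2 : st'.pending.toFinset.card = st'.pending.length := by
      simpa [OptState.pairs, OptState.P, AlgState.toOptState] using h1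
    exact Multiset.coe_nodup.mp
      ((Multiset.toFinset_card_eq_card_iff_nodup (m := Multiset.ofList st'.pending)).mp h2)
  rw [AlgState.mem_targets] at hmin
  obtain ⟨s1, s2, s3⟩ := splitFlaggedT_spec h st.Ps
  have hlenpos : 0 < st.pending.length := List.length_pos_iff.mpr hne
  simp only [stepT, Timed.val_bind, Timed.time_bind, hfind]
  cases hs : (splitFlaggedT h st.Ps).val with
  | some t =>
    obtain ⟨pre, ⟨a, o⟩, post⟩ := t
    obtain ⟨j1, j2, j3⟩ := s2 _ _ _ hs
    obtain ⟨u1, u2⟩ := fixFlaggedT_spec h o a post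
    obtain ⟨v1, v2⟩ := fixPendingT_spec h o (a * flaggedFactor h post) st.pending
    simp only [Timed.val_bind, Timed.time_bind, Timed.val_pure, Timed.time_pure, u1, v1]
    have hst : st.toOptState = ⟨st.pending.toFinset, pre ++ ((a, o), true) :: post⟩ := by
      rw [AlgState.toOptState, j1]
    have hstep : Step S st.toOptState (AlgState.toOptState ⟨st.pending.map (fixPair h o),
        pre ++ ((a * flaggedFactor h post *
          (st.pending.map fun q => partnerFactor h q.1 q.2 * partnerFactor h q.2 q.1).prod, o),
            false) :: post.map (fixFlagged h o)⟩) := by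
      have hprod : (st.pending.map fun q =>
          partnerFactor h q.1 q.2 * partnerFactor h q.2 q.1).prod =
            pairsFactor h st.pending.toFinset := (List.prod_toFinset _ hnd).symm
      rw [hprod]
      simp only [AlgState.toOptState, toFinset_map_fixPair, j1]
      exact Step.case1 _ _ _ _ _ _ (by simpa using hne) (hst ▸ hmin) j2 j3
    have hlen := congrArg List.length j1
    simp only [List.length_append, List.length_cons] at hlen
    exact ⟨hstep, hnodup _ hstep (by simp [j1]), by omega⟩
  | none =>
    have hR := s1 hs
    obtain ⟨t1, t2, t3⟩ := takePendingT_spec h st.pending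
    simp only [Timed.val_bind, Timed.time_bind]
    cases ht : (takePendingT h st.pending).val with
    | none =>
      exfalso
      obtain ⟨x, hx, hact⟩ := hmin.1
      rcases hx with ⟨q, hq, hxq⟩ | ⟨y, hy, hy2, rfl⟩
      · have := t1 ht q (by simpa [AlgState.toOptState] using hq)
        rcases hxq with rfl | rfl
        · exact this.1 hact.2
        · exact this.2 hact.2
      · exact hR y hy hy2 hact.2
    | some t =>
      obtain ⟨⟨o, b⟩, rest⟩ := t
      obtain ⟨j1, q, j2, j3⟩ := t2 _ _ ht
      obtain ⟨v1, v2⟩ := fixPendingT_spec h o b rest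
      have w := fixOpT_time_le h o
        (b * (rest.map fun q => partnerFactor h q.1 q.2 * partnerFactor h q.2 q.1).prod)
      simp only [Timed.val_bind, Timed.time_bind, Timed.val_pure, Timed.time_pure, v1, fixOpT_val]
      have hnd' := List.nodup_cons.mp (j3.nodup_iff.mp hnd)
      have herase : st.pending.toFinset.erase q = rest.toFinset := by
        rw [List.toFinset_eq_of_perm _ _ j3, List.toFinset_cons,
          Finset.erase_insert (by simpa using hnd'.1)]
      have hstep : Step S st.toOptState (AlgState.toOptState ⟨rest.map (fixPair h o),
          st.Ps ++ [((o, fixOp h o (b *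
            (rest.map fun q => partnerFactor h q.1 q.2 * partnerFactor h q.2 q.1).prod)),
              true)]⟩) := by
        have hprod : (rest.map fun q =>
            partnerFactor h q.1 q.2 * partnerFactor h q.2 q.1).prod =
              pairsFactor h rest.toFinset := (List.prod_toFinset _ hnd'.2).symm
        rw [hprod]
        simp only [AlgState.toOptState, toFinset_map_fixPair, ← herase]
        refine Step.case2 _ _ q o b h hmin ?_ ?_ j2 j1
        · rintro r ⟨y, hy, hy2, rfl⟩
          exact hR y hy hy2
        · rw [List.mem_toFinset, j3.mem_iff]
          exact List.mem_cons_self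
      have hlen := j3.length_eq
      rw [List.length_cons] at hlen
      exact ⟨hstep, hnodup _ hstep (by simp; omega), by omega⟩

/-- If a step exhausts `Q`, it appends a pair that is generated by the operators protected so far. -/
theorem Step.exists_getLast {S : Set (PauliOp N)} {st st' : OptState N} (hs : Step S st st')
    (hQ : st'.Q = ∅) : ∃ q, st'.P.getLast? = some q ∧ q.1 ∈ Subgroup.closure st.X ∧
      q.2 ∈ Subgroup.closure st.X := by
  obtain ⟨-, -, -, -, -, hsub, -⟩ := hs.exists_error
  cases hs with
  | case1 Q pre post a o h hQ' hmin hact hfirst =>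
    rw [Finset.image_eq_empty] at hQ
    exact absurd hQ hQ'.ne_empty
  | case2 Q Ps q o b h hmin hR hq hqo hact =>
    refine ⟨(o, fixOp h o (b * pairsFactor h (Q.erase q))), by simp [OptState.P],
      Subgroup.subset_closure ?_, hsub _ (Or.inr ⟨((o, _), true), by simp, rfl, rfl⟩)⟩
    rcases hqo with rfl | rfl
    · exact Or.inl ⟨_, hq, Or.inl rfl⟩
    · exact Or.inl ⟨_, hq, Or.inr rfl⟩

/-- An error whose weight is the distance of the qubit. -/
theorem exists_weight_eq_pairDist {S : Set (PauliOp N)} {q : OpPair N}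
    (h1 : q.1 ∈ centralizer S) (h2 : q.2 ∈ centralizer S) (hq : Anti q.1 q.2) :
    ∃ e, (IsUndetectableError S q.1 e ∨ IsUndetectableError S q.2 e) ∧
      weight e = pairDist S q := by
  obtain ⟨e, he, hw⟩ := exists_weight_eq_omega (S := S) (l := q.1) (e := q.2) ⟨h2, hq.symm⟩
  obtain ⟨e', he', hw'⟩ := exists_weight_eq_omega (S := S) (l := q.2) (e := q.1) ⟨h1, hq⟩
  rcases le_total (omega S q.1) (omega S q.2) with h | h
  · exact ⟨e, Or.inl he, by rw [hw, pairDist, min_eq_left h]⟩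
  · exact ⟨e', Or.inr he', by rw [hw', pairDist, min_eq_right h]⟩

/-- The time of every step is measured by the final distance `d`: protected groups decrease, so the
last pair of the result lies in the present one, and an error of weight `d` on that pair is a
candidate for the present search. -/
theorem loopT_spec {S : Set (PauliOp N)} {L : Finset (OpPair N)} {G : List (List (PauliOp N))}
    (hL : Hyperbolic L.toList) (hLS : ∀ v ∈ pairSpan L.toList, v ∈ centralizer S)
    (hG : ∀ g ∈ G, ∀ p ∈ g, p ∈ centralizer S)
    (hcov : ∀ e ∈ centralizer S, e ∈ pseudoProductsBelow G (weight e + 1))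
    (fuel : ℕ) (st : AlgState N) (hnd : st.pending.Nodup)
    (hI : ∃ E, OptInvariant S L st.toOptState E) (hfuel : st.toOptState.size ≤ fuel) :
    (loopT G fuel st).val.head? = some st ∧
      (loopT G fuel st).val.IsChain
        (fun a b => a.pending ≠ [] ∧ Step S a.toOptState b.toOptState) ∧
      ∃ last, (loopT G fuel st).val.getLast? = some last ∧ last.pending = [] ∧
        (∃ E, OptInvariant S L last.toOptState E) ∧
        (st.pending ≠ [] → ∃ q, last.toOptState.P.getLast? = some q ∧
          q.1 ∈ Subgroup.closure st.toOptState.X ∧ q.2 ∈ Subgroup.closure st.toOptState.X) ∧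
        ∀ d B, d = (distances S last.toOptState.P).getLastD 0 →
          (∀ r ≤ d, G.length.choose r * (3 ^ r * (2 * L.card + 2)) ≤ B) →
          (loopT G fuel st).time ≤ fuel * (d * B + 10 * L.card) := by
  induction fuel generalizing st with
  | zero =>
    have hp : st.pending = [] := by
      have : st.pending.toFinset.card = 0 := by
        simp only [OptState.size, AlgState.toOptState] at hfuel
        omega
      simpa using this
    refine ⟨rfl, List.isChain_singleton _, st, rfl, hp, hI, fun h => absurd hp h, ?_⟩
    intros
    simp [loopT]
  | succ fuel ih =>
    rw [loopT]
    by_cases hp : st.pending = []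
    · simp only [hp, List.isEmpty_nil, if_true, Timed.val_pure, Timed.time_pure]
      refine ⟨rfl, List.isChain_singleton _, st, rfl, hp, hI, fun h => absurd rfl h, ?_⟩
      intros
      exact Nat.zero_le _
    · have hemp : ¬ st.pending.isEmpty = true := by simpa using hp
      simp only [if_neg hemp, Timed.val_bind, Timed.time_bind, Timed.val_pure, Timed.time_pure]
      obtain ⟨E, hE⟩ := hI
      have hcard : st.pending.length + st.Ps.length = L.card := by
        rw [← hE.length, AlgState.length_pairs hnd]
      have htgt : st.targets.length + 2 ≤ 2 * L.card + 2 := by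
        have := st.length_targets_le
        omega
      have hmemC : ∀ q ∈ st.toOptState.pairs, q.1 ∈ centralizer S ∧ q.2 ∈ centralizer S :=
        fun q hq => ⟨hLS _ (hE.span ▸ (mem_pairSpan hq).1), hLS _ (hE.span ▸ (mem_pairSpan hq).2)⟩
      obtain ⟨q₀, hq₀⟩ := List.exists_mem_of_ne_nil _ hp
      have hq₀' : q₀ ∈ st.toOptState.pairs :=
        List.mem_append_left _ (by simpa [AlgState.toOptState] using hq₀)
      have hX := st.mem_targets
      have herr : ∃ x ∈ st.targets, IsUndetectableError S x q₀.2 := by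
        refine ⟨q₀.1, ?_, (hmemC _ hq₀').2, (hE.hyperbolic.1 _ hq₀').symm⟩
        change q₀.1 ∈ {x | x ∈ st.targets}
        rw [hX]
        exact Or.inl ⟨q₀, by simpa [AlgState.toOptState] using hq₀, Or.inl rfl⟩
      -- Only the existence of a minimal error is wanted here, so a crude error and a crude bound
      -- will do; the sum merely dominates each of its terms.
      obtain ⟨h, hfind, hmin⟩ := (findErrorT_spec st.targets hG hcov herr le_rfl
        (B := ∑ r ∈ Finset.range (weight q₀.2 + 1),
          G.length.choose r * (3 ^ r * (st.targets.length + 2)))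
        (fun r hr => Finset.single_le_sum
          (f := fun r => G.length.choose r * (3 ^ r * (st.targets.length + 2)))
          (fun _ _ => Nat.zero_le _) (Finset.mem_range.mpr (Nat.lt_succ_of_le hr)))).1
      obtain ⟨s1, s2, s3⟩ := stepT_spec hnd hE.hyperbolic hp hfind hmin
      set st' := (stepT G st).val
      obtain ⟨i1, i2, last, i3, i4, i5, i6, i7⟩ := ih st' s2 (hE.step s1 hL)
        (by have := s1.size_lt; omega)
      have hlastq : ∃ q, last.toOptState.P.getLast? = some q ∧
          q.1 ∈ Subgroup.closure st.toOptState.X ∧ q.2 ∈ Subgroup.closure st.toOptState.X := by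
        by_cases hp' : st'.pending = []
        · have hlast : last = st' := by
            have hl : (loopT G fuel st').val = [st'] := by
              cases fuel <;> simp [loopT, hp']
            rw [hl] at i3
            simpa using i3.symm
          rw [hlast]
          exact s1.exists_getLast (by simp [AlgState.toOptState, hp'])
        · obtain ⟨q, hq, hq1, hq2⟩ := i6 hp'
          obtain ⟨-, -, -, -, -, hsub, -⟩ := s1.exists_error
          have hle : Subgroup.closure st'.toOptState.X ≤ Subgroup.closure st.toOptState.X :=
            (Subgroup.closure_le _).mpr hsub
          exact ⟨q, hq, hle hq1, hle hq2⟩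
      refine ⟨rfl, ?_, last, ?_, i4, i5, fun _ => hlastq, ?_⟩
      · rw [List.isChain_cons]
        refine ⟨fun b hb => ?_, i2⟩
        rw [i1] at hb
        obtain rfl := Option.some.inj hb
        exact ⟨hp, s1⟩
      · rw [List.getLast?_cons, i3]
        rfl
      · intro d B hd hB
        obtain ⟨q, hq, hq1, hq2⟩ := hlastq
        have hdq : d = pairDist S q := by
          rw [hd, distances, List.getLastD_eq_getLast?, List.getLast?_map, hq]
          rfl
        obtain ⟨E', hE'⟩ := i5
        have hqP : q ∈ last.toOptState.pairs := List.mem_append_right _ (List.mem_of_getLast? hq)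
        obtain ⟨e, he, hew⟩ := exists_weight_eq_pairDist (S := S)
          (hLS _ (hE'.span ▸ (mem_pairSpan hqP).1)) (hLS _ (hE'.span ▸ (mem_pairSpan hqP).2))
          (hE'.hyperbolic.1 q hqP)
        have hact : ∃ x ∈ st.targets, IsUndetectableError S x e := by
          rw [← hX] at hq1 hq2
          rcases he with he | he
          · obtain ⟨x, hx, hex⟩ := exists_anti_of_anti_closure hq1 he.2
            exact ⟨x, hx, he.1, hex⟩
          · obtain ⟨x, hx, hex⟩ := exists_anti_of_anti_closure hq2 he.2
            exact ⟨x, hx, he.1, hex⟩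
        have hfindtime := (findErrorT_spec st.targets hG hcov hact (hew.trans hdq.symm).le
          (B := B) (fun r hr => le_trans
            (Nat.mul_le_mul_left _ (Nat.mul_le_mul_left _ htgt)) (hB r hr))).2
        have := i7 d B hd hB
        rw [hcard] at s3
        rw [add_mul, one_mul]
        omega

end Algorithm

/-! ### The main theorem -/

section Main

variable {N : ℕ}

theorem pairSpan_toList (L : Finset (OpPair N)) :
    pairSpan L.toList = Subgroup.closure (unpack (L : Set (OpPair N))) := by
  simp only [pairSpan, Finset.mem_toList]
  rfl

theorem hyperbolic_toList {S : Set (PauliOp N)} {L : Finset (OpPair N)}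
    (hconj : ∀ q ∈ L, IsConjugalPair (unpack (L : Set (OpPair N)) ∪ S) q)
    (hL : (L : Set (OpPair N)).Pairwise SharesNoOp) : Hyperbolic L.toList :=
  hyperbolic_of_conjugal
    (L.nodup_toList.pairwise_of_set_pairwise (by simpa using hL))
    (fun q hq => ⟨Or.inl ⟨q, by simpa using hq, Or.inl rfl⟩,
      Or.inl ⟨q, by simpa using hq, Or.inr rfl⟩⟩)
    (fun q hq => hconj q (by simpa using hq))

theorem mem_centralizer_of_mem_pairSpan {S : Set (PauliOp N)} {L : Finset (OpPair N)}
    (hLS : unpack (L : Set (OpPair N)) ⊆ centralizer S) :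
    ∀ v ∈ pairSpan L.toList, v ∈ centralizer S := by
  intro v hv
  rw [pairSpan_toList] at hv
  exact (Subgroup.closure_le (K := commutant S)).mpr hLS hv

theorem IsOptSequence.exists_last {S : Set (PauliOp N)} {L : Finset (OpPair N)}
    {O : ℕ → Option (OptState N)} (hO : IsOptSequence S L O) (hL : Hyperbolic L.toList) :
    ∃ n st, O n = some st ∧ O (n + 1) = none ∧ st.Q = ∅ ∧ ∃ E, OptInvariant S L st E := by
  have key : ∀ m i st, O i = some st → (∃ E, OptInvariant S L st E) → st.size ≤ m →
      ∃ n st, O n = some st ∧ O (n + 1) = none ∧ st.Q = ∅ ∧ ∃ E, OptInvariant S L st E := by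
    intro m
    induction m with
    | zero =>
      intro i st hi hE hm
      have hQ : st.Q = ∅ := by
        rw [← Finset.card_eq_zero]
        simp only [OptState.size] at hm
        omega
      exact ⟨i, st, hi, hO.ends i st hi hQ, hQ, hE⟩
    | succ m ih =>
      rintro i st hi ⟨E, hE⟩ hm
      by_cases hQ : st.Q = ∅
      · exact ⟨i, st, hi, hO.ends i st hi hQ, hQ, E, hE⟩
      · obtain ⟨st', hs, hi'⟩ := hO.next i st hi hQ
        exact ih (i + 1) st' hi' (hE.step hs hL) (by have := hs.size_lt; omega)
  exact key _ 0 _ hO.start ⟨[], optInvariant_start hL⟩ le_rfl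

/-- The algorithm computes an optimization sequence within the time bound. -/
theorem optimizeT_spec {S : Set (PauliOp N)} {L : Finset (OpPair N)} {listC : List (PauliOp N)}
    {listL : List (OpPair N)} (hS : ∀ s ∈ S, ∀ t ∈ S, ¬ Anti s t) (hL : Hyperbolic L.toList)
    (hLS : ∀ v ∈ pairSpan L.toList, v ∈ centralizer S)
    (hC : Subgroup.closure {p | p ∈ listC} = commutant S)
    (hnd : listL.Nodup) (hlist : listL.toFinset = L) :
    IsOptSequence S L
        (fun i => ((optimizeT listC listL).val.map AlgState.toOptState)[i]?) ∧
      ∃ n st, ((optimizeT listC listL).val.map AlgState.toOptState)[n]? = some st ∧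
        ((optimizeT listC listL).val.map AlgState.toOptState)[n + 1]? = none ∧
        (optimizeT listC listL).time ≤ 40 * (listC.length ^ 2 +
          L.card ^ 2 * (distances S st.P).getLastD 0 * 3 ^ (distances S st.P).getLastD 0 *
            N.choose ((distances S st.P).getLastD 0)) := by
  have hclosure : ∀ e, e ∈ centralizer S ↔ e ∈ Subgroup.closure {p | p ∈ listC} := fun e => by
    rw [hC]
    rfl
  have hG : ∀ g ∈ (pseudoGeneratorsT listC).val, ∀ p ∈ g, p ∈ centralizer S := fun g hg p hp =>
    (hclosure p).mpr (mem_closure_of_mem_pseudoGeneratorsT hg hp)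
  have hcov : ∀ e ∈ centralizer S,
      e ∈ pseudoProductsBelow (pseudoGeneratorsT listC).val (weight e + 1) := fun e he => by
    obtain ⟨H, h1, h2, h3⟩ := exists_pseudoProductT ((hclosure e).mp he)
    exact ⟨H, h1, Nat.lt_succ_of_le h2, h3⟩
  have hlenL : L.card = listL.length := by rw [← hlist, List.toFinset_card_of_nodup hnd]
  have hstart : AlgState.toOptState ⟨listL, []⟩ = ⟨L, []⟩ := by rw [AlgState.toOptState, hlist]
  obtain ⟨l1, l2, last, l3, l4, l5, l6, l7⟩ := loopT_spec hL hLS hG hcov (2 * listL.length)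
    ⟨listL, []⟩ hnd (by rw [hstart]; exact ⟨[], optInvariant_start hL⟩)
    (by rw [hstart]; simp [OptState.size, hlenL])
  have hval : (optimizeT listC listL).val =
      (loopT (pseudoGeneratorsT listC).val (2 * listL.length) ⟨listL, []⟩).val := rfl
  have htime : (optimizeT listC listL).time = (rowsT listC []).time +
      (loopT (pseudoGeneratorsT listC).val (2 * listL.length) ⟨listL, []⟩).time := rfl
  rw [hval, htime]
  set l := (loopT (pseudoGeneratorsT listC).val (2 * listL.length) ⟨listL, []⟩).val
  have hne : l ≠ [] := fun h => by simp [h] at l1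
  have hlpos : 0 < l.length := List.length_pos_iff.mpr hne
  have hlast : l[l.length - 1]? = some last := by rw [← List.getLast?_eq_getElem?]; exact l3
  rw [List.isChain_iff_getElem] at l2
  refine ⟨⟨?_, ?_, ?_, ?_⟩, l.length - 1, last.toOptState, ?_, ?_, ?_⟩
  · rw [List.getElem?_map, ← List.head?_eq_getElem?, l1, Option.map_some, hstart]
  · intro i st hi hQ
    rw [List.getElem?_map, Option.map_eq_some_iff] at hi
    obtain ⟨a, ha, rfl⟩ := hi
    obtain ⟨hi, rfl⟩ := List.getElem?_eq_some_iff.mp ha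
    rw [List.getElem?_eq_none_iff, List.length_map]
    by_contra! hlt
    exact (l2 i hlt).1 (by simpa [AlgState.toOptState] using hQ)
  · intro i st hi hQ
    rw [List.getElem?_map, Option.map_eq_some_iff] at hi
    obtain ⟨a, ha, rfl⟩ := hi
    obtain ⟨hi, rfl⟩ := List.getElem?_eq_some_iff.mp ha
    have hlt : i + 1 < l.length := by
      by_contra! hge
      obtain rfl : i = l.length - 1 := by omega
      rw [ha] at hlast
      rw [Option.some.inj hlast] at hQ
      exact hQ (by simp [AlgState.toOptState, l4])
    exact ⟨_, (l2 i hlt).2, by simp [hlt]⟩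
  · intro i hi
    rw [List.getElem?_eq_none_iff] at hi ⊢
    omega
  · rw [List.getElem?_map, hlast, Option.map_some]
  · rw [List.getElem?_eq_none_iff, List.length_map]
    omega
  · have hrows := (rowsT_spec listC [] ⟨by simp, List.Pairwise.nil⟩).2.2
    -- This absorbs the pivot searches: `|C| * (4 * |C| + 2 * N) ≤ 6 * |C| ^ 2`.
    have hN := le_length_of_closure_eq_centralizer hS hC
    have hrows' : (rowsT listC []).time ≤ 6 * listC.length ^ 2 := by
      refine hrows.trans ?_
      rw [List.length_nil, zero_add]
      nlinarith
    set d := (distances S last.toOptState.P).getLastD 0 with hd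
    have hloop := l7 d (N.choose d * (3 ^ d * (2 * L.card + 2))) rfl
    by_cases hL0 : listL = []
    · subst hL0
      simp only [loopT, List.length_nil, mul_zero, Timed.time_pure]
      omega
    · obtain ⟨q, hq, -, -⟩ := l6 hL0
      have hdq : d = pairDist S q := by
        rw [hd, distances, List.getLastD_eq_getLast?, List.getLast?_map, hq]
        rfl
      obtain ⟨E, hE⟩ := l5
      have hqP : q ∈ last.toOptState.pairs := List.mem_append_right _ (List.mem_of_getLast? hq)
      have hq1 := hLS _ (hE.span ▸ (mem_pairSpan hqP).1)
      have hq2 := hLS _ (hE.span ▸ (mem_pairSpan hqP).2)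
      have hqq := hE.hyperbolic.1 q hqP
      have hd2 : 2 * d ≤ N + 1 := hdq ▸ two_mul_pairDist_le hS hq1 hq2 hqq
      -- An error that acts on something is not the identity. Positivity of `d` lets the second
      -- summand absorb the cost linear in `|L|`.
      have hd1 : 1 ≤ d := by
        obtain ⟨e, he, hw⟩ := exists_weight_eq_pairDist hq1 hq2 hqq
        rw [hdq, ← hw, weight, Nat.one_le_iff_ne_zero, Finset.card_ne_zero]
        by_contra hemp
        rw [Finset.not_nonempty_iff_eq_empty, Finset.filter_eq_empty_iff] at hemp
        have he1 : e = 1 := funext fun k => not_not.mp (hemp (Finset.mem_univ k))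
        subst he1
        rcases he with he | he <;> exact not_anti_one_left _ he.2
      have hlevel : ∀ r ≤ d, (pseudoGeneratorsT listC).val.length.choose r *
          (3 ^ r * (2 * L.card + 2)) ≤ N.choose d * (3 ^ d * (2 * L.card + 2)) := by
        intro r hr
        refine Nat.mul_le_mul ?_ (Nat.mul_le_mul_right _ (Nat.pow_le_pow_right (by norm_num) hr))
        exact (Nat.choose_le_choose r (length_pseudoGeneratorsT_le listC)).trans
          (choose_le_choose_of_le hr hd2)
      have ht := hloop hlevel
      have hLpos : 1 ≤ L.card := by
        rw [hlenL]
        exact List.length_pos_iff.mpr hL0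
      have hchoose : 1 ≤ N.choose d := Nat.choose_pos (by omega)
      have hpow : 1 ≤ 3 ^ d := Nat.one_le_pow _ _ (by norm_num)
      have hW : 1 ≤ d * 3 ^ d * N.choose d := Nat.mul_pos (Nat.mul_pos hd1 hpow) hchoose
      -- With `W = d * 3 ^ d * N.choose d ≥ 1` the search is at most `4 * |L| * W` and the remaining
      -- work at most `10 * |L| * W`. Over `2 * |L|` steps this gives 28, and elimination adds 6 to
      -- the other summand, both within 40.
      have h1 : d * (N.choose d * (3 ^ d * (2 * L.card + 2))) + 10 * L.card ≤
          14 * (L.card * (d * 3 ^ d * N.choose d)) := by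
        have : d * (N.choose d * (3 ^ d * (2 * L.card + 2))) =
            (2 * L.card + 2) * (d * 3 ^ d * N.choose d) := by ring
        rw [this]
        nlinarith
      have h2 : 2 * listL.length * (14 * (L.card * (d * 3 ^ d * N.choose d))) =
          28 * (L.card ^ 2 * d * 3 ^ d * N.choose d) := by
        rw [← hlenL]
        ring
      have h3 := Nat.mul_le_mul_left (2 * listL.length) h1
      omega

end Main

end PauliCode

open PauliCode
theorem mainTheorem2 :
    (∀ (N : ℕ) (S : Set (PauliOp N)) (L : Finset (OpPair N)),
      (∀ s ∈ S, ∀ t ∈ S, ¬ Anti s t) →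
      unpack (L : Set (OpPair N)) ⊆ centralizer S →
      (∀ q ∈ L, IsConjugalPair (unpack (L : Set (OpPair N)) ∪ S) q) →
      (L : Set (OpPair N)).Pairwise SharesNoOp →
      (∃ O, IsOptSequence S L O) ∧
      ∀ O, IsOptSequence S L O →
        ∃ n st, O n = some st ∧ O (n + 1) = none ∧ st.Q = ∅ ∧
          IsOptimalChoice S st.P ∧
          generated (unpack {q | q ∈ st.P}) = generated (unpack (L : Set (OpPair N)))) ∧
    ∃ K : ℕ, ∀ (N : ℕ) (S C : Set (PauliOp N)) (L : Finset (OpPair N))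
        (listC : List (PauliOp N)) (listL : List (OpPair N)),
      (∀ s ∈ S, ∀ t ∈ S, ¬ Anti s t) →
      unpack (L : Set (OpPair N)) ⊆ centralizer S →
      (∀ q ∈ L, IsConjugalPair (unpack (L : Set (OpPair N)) ∪ S) q) →
      (L : Set (OpPair N)).Pairwise SharesNoOp →
      generated C = centralizer S →
      listC.Nodup → (∀ p, p ∈ listC ↔ p ∈ C) →
      listL.Nodup → (∀ q, q ∈ listL ↔ q ∈ L) →
      ∃ O n st, IsOptSequence S L O ∧ O n = some st ∧ O (n + 1) = none ∧
        (∀ i, O i = ((optimizeT listC listL).val.map AlgState.toOptState)[i]?) ∧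
        (optimizeT listC listL).time ≤
          K * (C.ncard ^ 2 +
            L.card ^ 2 * (distances S st.P).getLastD 0 *
              3 ^ (distances S st.P).getLastD 0 *
              N.choose ((distances S st.P).getLastD 0)) := by
  refine ⟨?_, 40, ?_⟩
  · intro N S L hS hLS hconj hshare
    have hL := hyperbolic_toList hconj hshare
    have hLS' := mem_centralizer_of_mem_pairSpan hLS
    constructor
    -- Existence of a sequence is obtained from the algorithm itself, run on a listing of the whole
    -- centralizer.
    · have hC : Subgroup.closure {p | p ∈ (Set.toFinite (centralizer S)).toFinset.toList} =
          commutant S := by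
        simp only [Finset.mem_toList, Set.Finite.mem_toFinset]
        exact Subgroup.closure_eq (commutant S)
      exact ⟨_, (optimizeT_spec hS hL hLS' hC L.nodup_toList L.toList_toFinset).1⟩
    · intro O hO
      obtain ⟨n, st, h1, h2, h3, E, hE⟩ := hO.exists_last hL
      obtain ⟨h4, h5⟩ := hE.optimal hLS' h3
      refine ⟨n, st, h1, h2, h3, h4, ?_⟩
      rw [pairSpan_toList] at h5
      exact congrArg SetLike.coe h5
  · intro N S C L listC listL hS hLS hconj hshare hgen hCnd hC hLnd hlist
    have hset : {p | p ∈ listC} = C := Set.ext hC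
    have hcl : Subgroup.closure {p | p ∈ listC} = commutant S := by
      rw [hset]
      exact SetLike.coe_injective hgen
    have hcard : C.ncard = listC.length := by
      rw [← List.toFinset_card_of_nodup hCnd, ← hset, ← List.coe_toFinset,
        Set.ncard_coe_finset]
    obtain ⟨h1, n, st, h2, h3, h4⟩ := optimizeT_spec hS (hyperbolic_toList hconj hshare)
      (mem_centralizer_of_mem_pairSpan hLS) hcl hLnd (by ext q; simp [hlist])
    exact ⟨_, n, st, h1, h2, h3, fun _ => rfl, by rw [hcard]; exact h4⟩
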